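/- Let $M$ be a smooth $n$-dimensional manifold (Hausdorff, second countable, without boundary), let $X_0,X_1,\dots,X_d$ be smooth vector fields on $M$, let $x\in M$, let $I=[0,1]$ and let $1<p<\infty$. A control $u=(u_1,\dots,u_d)\in L^p(I,\mathbb{R}^d)$ is called admissible if there is an absolutely continuous curve $\gamma_u:I\to M$, defined on the whole of $I$, with $$\dot\gamma_u(t)=X_0(\gamma_u(t))+\sum_{i=1}^d u_i(t)\,X_i(\gamma_u(t))\quad\text{for a.e. }t\in I,\qquad \gamma_u(0)=x.$$ Let $\Omega\subset L^p(I,\mathbb{R}^d)$ be the set of admissible controls, let $F:\Omega\to M$, $F(u)=\gamma_u(1)$, be the endpoint map, and for $y\in M$ put $\Omega(y)=F^{-1}(y)$, with the topology induced by $L^p(I,\mathbb{R}^d)$. Assume that $M$ is compact or, more generally, that every control is admissible, i.e. $\Omega=L^p(I,\mathbb{R}^d)$. Let $y\in M$ be a regular value of $F$, i.e. $d_uF:L^p(I,\mathbb{R}^d)\to T_yM$ is surjective for every $u\in\Omega(y)$, and write $T_u\Omega(y)=\ker d_uF$. Let $J_p(u)=\sum_{i=1}^d\|u_i\|_p^p$,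 and let $f=J_p|_{\Omega(y)}$, whose differential at $u\in\Omega(y)$ is $d_uf=d_uJ_p|_{T_u\Omega(y)}\in (T_u\Omega(y))^*$, where $T_u\Omega(y)$ carries the norm of $L^p(I,\mathbb{R}^d)$. Then $f$ satisfies the Palais–Smale condition: every sequence $(u_k)_{k\in\mathbb{N}}$ in $\Omega(y)$ such that $(f(u_k))_k$ is bounded and $\|d_{u_k}f\|\to0$ has a subsequence which converges in $L^p(I,\mathbb{R}^d)$ to an element of $\Omega(y)$. -/

import Mathlib

open MeasureTheory Set Filter Topology
open scoped ENNReal Manifold ContDiff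

noncomputable section

namespace ControlSystem

/-- The space `L^p(I, ℝ^d)` of controls, where `I = [0, 1]` carries Lebesgue measure. -/
abbrev Control (d : ℕ) (p : ℝ≥0∞) : Type :=
  Lp (EuclideanSpace ℝ (Fin d)) p (volume.restrict (Icc (0 : ℝ) 1))

/-- The `p`-energy `J_p(u) = ∑ i, ‖u_i‖_p ^ p`. -/
def energy {d : ℕ} {p : ℝ≥0∞} (u : Control d p) : ℝ :=
  ∑ i : Fin d, ∫ t in Icc (0 : ℝ) 1, |u t i| ^ p.toReal

section

variable {n : ℕ} {M : Type*} [TopologicalSpace M] [ChartedSpace (EuclideanSpace ℝ (Fin n)) M]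

/-- A vector field `V` on `M` is smooth, as a section of the tangent bundle. -/
def IsSmoothField [IsManifold (𝓡 n) ∞ M] (V : (q : M) → TangentSpace (𝓡 n) q) : Prop :=
  ContMDiff (𝓡 n) (𝓡 n).tangent ∞ (fun q => (⟨q, V q⟩ : TangentBundle (𝓡 n) M))

/-- A curve in `M`, considered on `[0, 1]` only, is absolutely continuous: it is continuous, and
on every compact subinterval which it maps into a coordinate chart its coordinate expression is
absolutely continuous. -/
def IsAbsolutelyContinuousCurve (n : ℕ) {M : Type*} [TopologicalSpace M]
    [ChartedSpace (EuclideanSpace ℝ (Fin n)) M] (γ : ℝ → M) : Prop :=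
  ContinuousOn γ (Icc 0 1) ∧
    ∀ (c : M) (a b : ℝ), a ≤ b → Icc a b ⊆ Icc 0 1 →
      MapsTo γ (Icc a b) (chartAt (EuclideanSpace ℝ (Fin n)) c).source →
      AbsolutelyContinuousOnInterval (fun t => extChartAt (𝓡 n) c (γ t)) a b

variable {d : ℕ} {p : ℝ≥0∞}

/-- `γ`, on `[0, 1]`, is a trajectory of the control `u` starting at `x`: it is absolutely
continuous, `γ 0 = x`, and `γ' = X₀(γ) + ∑ i, u_i X_i(γ)` almost everywhere on `[0, 1]`. -/
structure IsTrajectory (X₀ : (q : M) → TangentSpace (𝓡 n) q)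
    (X : Fin d → (q : M) → TangentSpace (𝓡 n) q) (x : M) (u : Control d p) (γ : ℝ → M) :
    Prop where
  absolutelyContinuous : IsAbsolutelyContinuousCurve n γ
  initial : γ 0 = x
  velocity : ∀ᵐ t ∂(volume.restrict (Icc (0 : ℝ) 1)),
    HasMFDerivAt 𝓘(ℝ, ℝ) (𝓡 n) γ t
      (ContinuousLinearMap.toSpanSingleton ℝ (X₀ (γ t) + ∑ i : Fin d, u t i • X i (γ t)))

/-- The domain `Ω` of the endpoint map: the controls whose trajectory from `x` is defined on the
whole interval `[0, 1]`. -/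
def admissible (p : ℝ≥0∞) (X₀ : (q : M) → TangentSpace (𝓡 n) q)
    (X : Fin d → (q : M) → TangentSpace (𝓡 n) q) (x : M) : Set (Control d p) :=
  {u | ∃ γ : ℝ → M, IsTrajectory X₀ X x u γ}

open Classical in
/-- The endpoint map `F`, sending an admissible control to `γ 1`, where `γ` is its trajectory from
`x` (the trajectory is unique on `[0, 1]` for smooth fields on a Hausdorff manifold). Outside
`admissible p X₀ X x` it has the irrelevant value `x`. -/
def endpoint (X₀ : (q : M) → TangentSpace (𝓡 n) q)
    (X : Fin d → (q : M) → TangentSpace (𝓡 n) q) (x : M) (u : Control d p) : M :=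
  if h : ∃ γ : ℝ → M, IsTrajectory X₀ X x u γ then h.choose 1 else x

/-- `Ω(y) = F⁻¹(y)`, the admissible controls which steer `x` to `y`. -/
def fiber (p : ℝ≥0∞) (X₀ : (q : M) → TangentSpace (𝓡 n) q)
    (X : Fin d → (q : M) → TangentSpace (𝓡 n) q) (x y : M) : Set (Control d p) :=
  {u | u ∈ admissible p X₀ X x ∧ endpoint X₀ X x u = y}

variable [Fact (1 ≤ p)]

/-- The differential `d_u F` of the endpoint map, from `L^p(I, ℝ^d)` to the tangent space of `M`
at the endpoint `F(u)`. -/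
def endpointDifferential (X₀ : (q : M) → TangentSpace (𝓡 n) q)
    (X : Fin d → (q : M) → TangentSpace (𝓡 n) q) (x : M) (u : Control d p) :
    Control d p →L[ℝ] TangentSpace (𝓡 n) (endpoint X₀ X x u) :=
  mfderiv 𝓘(ℝ, Control d p) (𝓡 n) (endpoint X₀ X x : Control d p → M) u

/-- `y` is a regular value of the endpoint map: `d_u F` is surjective at every `u ∈ Ω(y)`. -/
def IsRegularValue (p : ℝ≥0∞) [Fact (1 ≤ p)] (X₀ : (q : M) → TangentSpace (𝓡 n) q)
    (X : Fin d → (q : M) → TangentSpace (𝓡 n) q) (x y : M) : Prop :=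
  ∀ u ∈ fiber p X₀ X x y,
    Function.Surjective (endpointDifferential X₀ X x u)

/-- The tangent space `T_u Ω(y) = ker d_u F` at `u` of the fibre `Ω(y)` through `u`. -/
def tangentFiber (X₀ : (q : M) → TangentSpace (𝓡 n) q)
    (X : Fin d → (q : M) → TangentSpace (𝓡 n) q) (x : M) (u : Control d p) :
    Submodule ℝ (Control d p) :=
  LinearMap.ker (endpointDifferential X₀ X x u).toLinearMap

/-- The differential at `u` of the restriction `f` of the energy to the fibre `Ω(y)` through `u`:
the restriction of `d_u J_p` to `T_u Ω(y)`, an element of the dual of `T_u Ω(y)`, the latter normed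
as a subspace of `L^p(I, ℝ^d)`. -/
def restrictedEnergyDifferential (X₀ : (q : M) → TangentSpace (𝓡 n) q)
    (X : Fin d → (q : M) → TangentSpace (𝓡 n) q) (x : M) (u : Control d p) :
    tangentFiber X₀ X x u →L[ℝ] ℝ :=
  (fderiv ℝ (energy : Control d p → ℝ) u).comp (tangentFiber X₀ X x u).subtypeL

end

end ControlSystem

end

/-!
Energy-bounded controls have a subsequence whose primitives converge uniformly, to those of a
control `v`; endpoints pass to the limit, so `v` lies over `y`. The derivatives of the endpoint map
`F` pass to it as well, and no variational equation is needed for this: in charts the second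
differences `F (u + 2h) - 2 F (u + h) + F u` are `O(‖h‖²)` uniformly on bounded sets, so that
`d_uF h` is the uniform limit of difference quotients, each of them continuous under convergence of
primitives. As `d_vF` is surjective, any `w` can hence be corrected by some `z` with
`‖z‖ ≤ C ‖d_{u_k}F w‖` so that `w - z` is tangent to the fibre at `u_k`. For `w = u_k - u_l` this
gives `dJ(u_k)(u_k - u_l) → 0`; by convexity of `J` the gap
`(J u_k + J u_l) / 2 - J ((u_k + u_l) / 2)` tends to zero, and by uniform convexity the subsequence
is Cauchy in `L^p`.
-/

namespace ControlSystem

section ConvexFunctions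

variable {E : Type*} [NormedAddCommGroup E] [NormedSpace ℝ E] {f : E → ℝ}

/-- The gap in midpoint convexity of `f` between `a` and `b`. Where it is small and `f` is
uniformly convex, `a` and `b` are close. -/
noncomputable def midpointGap (f : E → ℝ) (a b : E) : ℝ :=
  (f a + f b) / 2 - f (midpoint ℝ a b)

theorem midpointGap_nonneg (hf : ConvexOn ℝ univ f) (a b : E) : 0 ≤ midpointGap f a b := by
  have := hf.2 (mem_univ a) (mem_univ b) (by norm_num : (0 : ℝ) ≤ 2⁻¹) (by norm_num)
    (by norm_num : (2⁻¹ : ℝ) + 2⁻¹ = 1)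
  rw [← smul_add, ← invOf_eq_inv, ← midpoint_eq_smul_add, smul_eq_mul, smul_eq_mul,
    invOf_eq_inv] at this
  rw [midpointGap]
  linarith

theorem eq_of_midpointGap_eq_zero (hf : StrictConvexOn ℝ univ f) {a b : E}
    (h : midpointGap f a b = 0) : a = b := by
  by_contra hab
  have := hf.2 (mem_univ a) (mem_univ b) hab (by norm_num : (0 : ℝ) < 2⁻¹) (by norm_num)
    (by norm_num : (2⁻¹ : ℝ) + 2⁻¹ = 1)
  rw [← smul_add, ← invOf_eq_inv, ← midpoint_eq_smul_add, smul_eq_mul, smul_eq_mul,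
    invOf_eq_inv] at this
  rw [midpointGap] at h
  linarith

theorem fderiv_sub_le_of_convexOn (hf : ConvexOn ℝ univ f) {a : E}
    (ha : DifferentiableAt ℝ f a) (b : E) : fderiv ℝ f a (b - a) ≤ f b - f a := by
  have hline : ConvexOn ℝ univ (fun t : ℝ => f (AffineMap.lineMap a b t)) :=
    hf.comp_affineMap (AffineMap.lineMap a b)
  have hderiv : HasDerivAt (fun t : ℝ => f (AffineMap.lineMap a b t)) (fderiv ℝ f a (b - a)) 0 :=
    HasFDerivAt.comp_hasDerivAt (0 : ℝ) (by simpa using ha.hasFDerivAt)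
      AffineMap.hasDerivAt_lineMap
  simpa [slope_def_field] using
    hline.le_slope_of_hasDerivAt (mem_univ 0) (mem_univ 1) one_pos hderiv

theorem midpointGap_le_fderiv_add_fderiv (hf : ConvexOn ℝ univ f) {a b : E}
    (ha : DifferentiableAt ℝ f a) (hb : DifferentiableAt ℝ f b) :
    midpointGap f a b ≤ (fderiv ℝ f a (a - b) + fderiv ℝ f b (b - a)) / 4 := by
  have hmid_sub_left : midpoint ℝ a b - a = (-2⁻¹ : ℝ) • (a - b) := by
    rw [midpoint_sub_left, invOf_eq_inv]
    module
  have hmid_sub_right : midpoint ℝ a b - b = (-2⁻¹ : ℝ) • (b - a) := by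
    rw [midpoint_sub_right, invOf_eq_inv]
    module
  have hleft := fderiv_sub_le_of_convexOn hf ha (midpoint ℝ a b)
  have hright := fderiv_sub_le_of_convexOn hf hb (midpoint ℝ a b)
  rw [hmid_sub_left, map_smul, smul_eq_mul] at hleft
  rw [hmid_sub_right, map_smul, smul_eq_mul] at hright
  rw [midpointGap]
  linarith

theorem exists_norm_fderiv_le_of_convexOn (hf : ConvexOn ℝ univ f)
    (hbdd : ∀ R : ℝ, ∃ C : ℝ, ∀ a, ‖a‖ ≤ R → |f a| ≤ C) (R : ℝ) :
    ∃ C : ℝ, ∀ a, ‖a‖ ≤ R → ‖fderiv ℝ f a‖ ≤ C := by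
  obtain ⟨C, hC⟩ := hbdd (R + 2)
  have hlip := (hf.subset (subset_univ (Metric.ball 0 (R + 2)))
    (convex_ball _ _)).lipschitzOnWith_of_abs_le one_pos
    fun a ha => hC a (mem_ball_zero_iff.1 ha).le
  refine ⟨_, fun a ha => norm_fderiv_le_of_lipschitzOn ℝ ?_ hlip⟩
  exact Metric.isOpen_ball.mem_nhds (by rw [mem_ball_zero_iff]; linarith)

end ConvexFunctions

section Homogeneous

variable {E : Type*} [NormedAddCommGroup E] [NormedSpace ℝ E]

/-- `g` is positively homogeneous of degree `r`, as a function on `E` with scalar values. -/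
def PosHomogeneous (r : ℝ) (g : E → ℝ) : Prop :=
  ∀ (t : ℝ) (z : E), 0 < t → g (t • z) = t ^ r * g z

theorem PosHomogeneous.map_zero {r : ℝ} {g : E → ℝ} (hg : PosHomogeneous r g) (hr : 0 < r) :
    g 0 = 0 := by
  have h := hg 2 0 two_pos
  rw [smul_zero] at h
  have := Real.one_lt_rpow one_lt_two hr
  nlinarith

theorem posHomogeneous_norm_rpow {F : Type*} [NormedAddCommGroup F] [NormedSpace ℝ F]
    (r : ℝ) {g : E → F} (hg : ∀ (t : ℝ) z, g (t • z) = t • g z) :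
    PosHomogeneous r (fun z => ‖g z‖ ^ r) := fun t z ht => by
  simp only [hg, norm_smul, Real.norm_of_nonneg ht.le, Real.mul_rpow ht.le (norm_nonneg _)]

/-- By homogeneity it is enough to compare on the unit sphere, which is compact. -/
theorem PosHomogeneous.exists_le_add_mul [ProperSpace E] {r : ℝ} (hr : 0 < r) {g h : E → ℝ}
    (hg : PosHomogeneous r g) (hh : PosHomogeneous r h) (hgc : Continuous g) (hhc : Continuous h)
    (hh0 : ∀ z, 0 ≤ h z) (hgh : ∀ z, h z = 0 → g z ≤ 0) {ε : ℝ} (hε : 0 < ε) :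
    ∃ C, 0 ≤ C ∧ ∀ z, g z ≤ ε * ‖z‖ ^ r + C * h z := by
  let U : ℕ → Set E := fun N => {z | g z < ε + N * h z}
  have hUopen : ∀ N, IsOpen (U N) := fun N => isOpen_lt hgc (by fun_prop)
  have hUmono : Monotone U := fun N N' hNN z (hz : g z < ε + N * h z) =>
    hz.trans_le (by gcongr; exact hh0 z)
  have hUcover : Metric.sphere (0 : E) 1 ⊆ ⋃ N, U N := by
    intro z _
    rcases (hh0 z).eq_or_lt with h0 | hpos
    · exact mem_iUnion.2 ⟨0, by simpa [U] using (hgh z h0.symm).trans_lt hε⟩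
    · obtain ⟨N, hN⟩ := exists_nat_gt (g z / h z)
      exact mem_iUnion.2 ⟨N, ((div_lt_iff₀ hpos).1 hN).trans (lt_add_of_pos_left _ hε)⟩
  obtain ⟨N, hN⟩ := (isCompact_sphere (0 : E) 1).elim_directed_cover U hUopen hUcover
    hUmono.directed_le
  refine ⟨N, N.cast_nonneg, fun z => ?_⟩
  rcases eq_or_ne z 0 with rfl | hz
  · simp [hg.map_zero hr, hh.map_zero hr, Real.zero_rpow hr.ne']
  have hsphere : g (‖z‖⁻¹ • z) < ε + N * h (‖z‖⁻¹ • z) := @hN (‖z‖⁻¹ • z) (by simp [norm_smul, hz])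
  have hgz := hg ‖z‖ (‖z‖⁻¹ • z) (norm_pos_iff.2 hz)
  have hhz := hh ‖z‖ (‖z‖⁻¹ • z) (norm_pos_iff.2 hz)
  rw [smul_inv_smul₀ (norm_ne_zero_iff.2 hz)] at hgz hhz
  rw [hgz, hhz]
  nlinarith [Real.rpow_nonneg (norm_nonneg z) r]

theorem norm_prod_rpow_le {F G : Type*} [NormedAddCommGroup F] [NormedAddCommGroup G] (z : F × G)
    (r : ℝ) :
    ‖z‖ ^ r ≤ ‖z.1‖ ^ r + ‖z.2‖ ^ r := by
  have h1 := Real.rpow_nonneg (norm_nonneg z.1) r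
  have h2 := Real.rpow_nonneg (norm_nonneg z.2) r
  rw [Prod.norm_def]
  rcases max_choice ‖z.1‖ ‖z.2‖ with h | h <;> rw [h] <;> linarith

/-- The integrands whose integral functional on `L^P` behaves like the `P`-th power of a smooth
uniformly convex norm. -/
structure IsHomogeneousIntegrand (P : ℝ) (f : E → ℝ) : Prop where
  contDiff : ContDiff ℝ 1 f
  strictConvexOn : StrictConvexOn ℝ univ f
  posHomogeneous : PosHomogeneous P f

namespace IsHomogeneousIntegrand

variable {P : ℝ} {f : E → ℝ}

theorem map_pos (hf : IsHomogeneousIntegrand P f) (hP : 1 < P) {z : E} (hz : z ≠ 0) : 0 < f z := by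
  have hmid := hf.strictConvexOn.2 (mem_univ z) (mem_univ 0) hz (by norm_num : (0 : ℝ) < 2⁻¹)
    (by norm_num) (by norm_num : (2⁻¹ : ℝ) + 2⁻¹ = 1)
  rw [smul_zero, add_zero, hf.posHomogeneous _ _ (by norm_num),
    hf.posHomogeneous.map_zero (by linarith), smul_zero, add_zero, smul_eq_mul] at hmid
  have : (2⁻¹ : ℝ) ^ P < 2⁻¹ := Real.rpow_lt_self_of_lt_one (by norm_num) (by norm_num) hP
  nlinarith

theorem map_nonneg (hf : IsHomogeneousIntegrand P f) (hP : 1 < P) (z : E) : 0 ≤ f z := by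
  rcases eq_or_ne z 0 with rfl | hz
  · exact (hf.posHomogeneous.map_zero (by linarith)).ge
  · exact (hf.map_pos hP hz).le

theorem posHomogeneous_midpointGap (hf : IsHomogeneousIntegrand P f) :
    PosHomogeneous P (fun z : E × E => midpointGap f z.1 z.2) := fun t z ht => by
  have hmid : midpoint ℝ (t • z.1) (t • z.2) = t • midpoint ℝ z.1 z.2 := by
    rw [midpoint_eq_smul_add, midpoint_eq_smul_add, ← smul_add, smul_comm]
  simp only [midpointGap, Prod.smul_fst, Prod.smul_snd, hmid, hf.posHomogeneous _ _ ht]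
  ring

theorem fderiv_smul (hf : IsHomogeneousIntegrand P f) {t : ℝ} (ht : 0 < t) (z : E) :
    fderiv ℝ f (t • z) = t ^ (P - 1) • fderiv ℝ f z := by
  have h : (fun z => f (t • z)) = fun z => t ^ P • f z := funext fun z => hf.posHomogeneous t z ht
  have hd := congrArg (fun F => fderiv ℝ F z) h
  simp only [fderiv_comp_smul, fderiv_fun_const_smul (hf.contDiff.differentiable one_ne_zero z)]
    at hd
  rw [← inv_smul_smul₀ ht.ne' (fderiv ℝ f (t • z)), hd, smul_smul, Real.rpow_sub_one ht.ne',
    inv_mul_eq_div]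

variable [FiniteDimensional ℝ E]

theorem exists_norm_rpow_le (hf : IsHomogeneousIntegrand P f) (hP : 1 < P) :
    ∃ C, 0 ≤ C ∧ ∀ z, ‖z‖ ^ P ≤ C * f z := by
  have := FiniteDimensional.proper ℝ E
  have hvanish : ∀ z, f z = 0 → ‖z‖ ^ P ≤ 0 := fun z hz => by
    rw [of_not_not (mt (hf.map_pos hP) hz.not_gt), norm_zero, Real.zero_rpow (by linarith)]
  obtain ⟨C, hC0, hC⟩ := (posHomogeneous_norm_rpow P fun _ _ => rfl).exists_le_add_mul
    (by linarith) hf.posHomogeneous (continuous_norm.rpow_const fun _ => Or.inr (by linarith))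
    hf.contDiff.continuous (hf.map_nonneg hP) hvanish (ε := 2⁻¹) (by norm_num)
  exact ⟨2 * C, by positivity, fun z => by linarith [hC z]⟩

theorem exists_le_norm_rpow (hf : IsHomogeneousIntegrand P f) (hP : 1 < P) :
    ∃ C, 0 ≤ C ∧ ∀ z, f z ≤ C * ‖z‖ ^ P := by
  have := FiniteDimensional.proper ℝ E
  have hvanish : ∀ z : E, ‖z‖ ^ P = 0 → f z ≤ 0 := fun z hz => by
    rw [norm_eq_zero.1 ((Real.rpow_eq_zero (norm_nonneg z) (by linarith)).1 hz),
      hf.posHomogeneous.map_zero (by linarith)]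
  obtain ⟨C, hC0, hC⟩ := hf.posHomogeneous.exists_le_add_mul (by linarith)
    (posHomogeneous_norm_rpow P fun _ _ => rfl) hf.contDiff.continuous
    (continuous_norm.rpow_const fun _ => Or.inr (by linarith)) (fun z => by positivity)
    hvanish one_pos
  exact ⟨1 + C, by positivity, fun z => by linarith [hC z]⟩

theorem exists_norm_sub_rpow_le (hf : IsHomogeneousIntegrand P f) (hP : 1 < P) {ε : ℝ}
    (hε : 0 < ε) :
    ∃ C, 0 ≤ C ∧ ∀ a b, ‖a - b‖ ^ P ≤ ε * (‖a‖ ^ P + ‖b‖ ^ P) + C * midpointGap f a b := by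
  have := FiniteDimensional.proper ℝ E
  have hfc := hf.contDiff.continuous
  have hvanish : ∀ z : E × E, midpointGap f z.1 z.2 = 0 → ‖z.1 - z.2‖ ^ P ≤ 0 := fun z hz => by
    rw [eq_of_midpointGap_eq_zero hf.strictConvexOn hz, sub_self, norm_zero,
      Real.zero_rpow (by linarith)]
  obtain ⟨C, hC0, hC⟩ := (posHomogeneous_norm_rpow P
    fun _ _ => (smul_sub _ _ _).symm).exists_le_add_mul (by linarith) hf.posHomogeneous_midpointGap
    ((continuous_fst.sub continuous_snd).norm.rpow_const fun _ => Or.inr (by linarith))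
    (by simp only [midpointGap, midpoint_eq_smul_add]; fun_prop)
    (fun z => midpointGap_nonneg hf.strictConvexOn.convexOn z.1 z.2) hvanish hε
  refine ⟨C, hC0, fun a b => (hC (a, b)).trans ?_⟩
  gcongr
  exact norm_prod_rpow_le (a, b) P

theorem exists_norm_fderiv_add_sub_le (hf : IsHomogeneousIntegrand P f) (hP : 1 < P) {ε : ℝ}
    (hε : 0 < ε) : ∃ C, 0 ≤ C ∧ ∀ a b,
      ‖fderiv ℝ f (a + b) - fderiv ℝ f a‖ ≤ ε * ‖a‖ ^ (P - 1) + C * ‖b‖ ^ (P - 1) := by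
  have := FiniteDimensional.proper ℝ E
  have hDc := hf.contDiff.continuous_fderiv one_ne_zero
  have hhom : PosHomogeneous (P - 1)
      (fun z : E × E => ‖fderiv ℝ f (z.1 + z.2) - fderiv ℝ f z.1‖) := fun t z ht => by
    simp only [Prod.smul_fst, Prod.smul_snd, ← smul_add, hf.fderiv_smul ht, ← smul_sub, norm_smul,
      Real.norm_of_nonneg (Real.rpow_nonneg ht.le _)]
  have hvanish : ∀ z : E × E, ‖z.2‖ ^ (P - 1) = 0 →
      ‖fderiv ℝ f (z.1 + z.2) - fderiv ℝ f z.1‖ ≤ 0 := fun z hz => by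
    rw [norm_eq_zero.1 ((Real.rpow_eq_zero (norm_nonneg z.2) (by linarith)).1 hz), add_zero,
      sub_self, norm_zero]
  obtain ⟨C, hC0, hC⟩ := hhom.exists_le_add_mul (by linarith)
    (posHomogeneous_norm_rpow (P - 1) fun _ _ => rfl)
    ((hDc.comp (continuous_fst.add continuous_snd)).sub (hDc.comp continuous_fst)).norm
    (continuous_snd.norm.rpow_const fun _ => Or.inr (by linarith)) (fun z => by positivity)
    hvanish hε
  refine ⟨ε + C, by positivity, fun a b => (hC (a, b)).trans ?_⟩
  nlinarith [norm_prod_rpow_le (a, b) (P - 1)]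

theorem exists_norm_fderiv_le (hf : IsHomogeneousIntegrand P f) (hP : 1 < P) :
    ∃ C, 0 ≤ C ∧ ∀ a, ‖fderiv ℝ f a‖ ≤ C * ‖a‖ ^ (P - 1) := by
  obtain ⟨C, hC0, hC⟩ := hf.exists_norm_fderiv_add_sub_le hP one_pos
  have hzero : fderiv ℝ f 0 = 0 := by
    have h := hf.fderiv_smul two_pos 0
    rw [smul_zero] at h
    have h' : ((2 : ℝ) ^ (P - 1) - 1) • fderiv ℝ f 0 = 0 := by
      rw [sub_smul, one_smul, ← h, sub_self]
    exact (smul_eq_zero.1 h').resolve_left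
      (sub_pos.2 (Real.one_lt_rpow one_lt_two (by linarith))).ne'
  refine ⟨C, hC0, fun a => ?_⟩
  simpa [hzero, Real.zero_rpow (show P - 1 ≠ 0 by linarith)] using hC 0 a

end IsHomogeneousIntegrand

end Homogeneous

theorem one_lt_toReal {p : ℝ≥0∞} (hp : 1 < p) (hp_top : p ≠ ⊤) : 1 < p.toReal := by
  simpa using (ENNReal.toReal_lt_toReal ENNReal.one_ne_top hp_top).2 hp

section Lp

variable {α E : Type*} {m : MeasurableSpace α} {μ : Measure α} {p : ℝ≥0∞} [NormedAddCommGroup E]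

theorem integrable_norm_rpow (hp : 1 < p) (hp_top : p ≠ ⊤) (u : Lp E p μ) :
    Integrable (fun t => ‖u t‖ ^ p.toReal) μ :=
  (Lp.memLp u).integrable_norm_rpow (by positivity) hp_top

theorem integral_norm_rpow (hp : 1 < p) (hp_top : p ≠ ⊤) (u : Lp E p μ) :
    ∫ t, ‖u t‖ ^ p.toReal ∂μ = ‖u‖ ^ p.toReal := by
  have hnonneg : 0 ≤ ∫ t, ‖u t‖ ^ p.toReal ∂μ := by positivity
  rw [Lp.norm_def, (Lp.memLp u).eLpNorm_eq_integral_rpow_norm (by positivity) hp_top,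
    ENNReal.toReal_ofReal (by positivity),
    Real.rpow_inv_rpow hnonneg (by linarith [one_lt_toReal hp hp_top])]

theorem memLp_norm_rpow_sub_one (hp : 1 < p) (hp_top : p ≠ ⊤) (u : Lp E p μ) :
    MemLp (fun t => ‖u t‖ ^ (p.toReal - 1)) (ENNReal.ofReal p.toReal.conjExponent) μ := by
  have hP := one_lt_toReal hp hp_top
  have hexp : ENNReal.ofReal p.toReal.conjExponent = p / ENNReal.ofReal (p.toReal - 1) := by
    rw [Real.conjExponent, ENNReal.ofReal_div_of_pos (by linarith), ENNReal.ofReal_toReal hp_top]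
  simpa only [hexp, ENNReal.toReal_ofReal (sub_nonneg.2 hP.le)] using
    (Lp.memLp u).norm_rpow_div (ENNReal.ofReal (p.toReal - 1))

theorem holderConjugate_conjExponent_toReal (hp : 1 < p) (hp_top : p ≠ ⊤) :
    (ENNReal.ofReal p.toReal.conjExponent).HolderConjugate p := by
  simpa only [ENNReal.ofReal_toReal hp_top] using
    (Real.HolderConjugate.conjExponent (one_lt_toReal hp hp_top)).symm.ennrealOfReal

theorem integrable_norm_rpow_sub_one_mul (hp : 1 < p) (hp_top : p ≠ ⊤) (u w : Lp E p μ) :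
    Integrable (fun t => ‖u t‖ ^ (p.toReal - 1) * ‖w t‖) μ := by
  have := holderConjugate_conjExponent_toReal hp hp_top
  exact (memLp_norm_rpow_sub_one hp hp_top u).integrable_mul (Lp.memLp w).norm

theorem integral_norm_rpow_sub_one_mul_le [Fact (1 ≤ p)] (hp : 1 < p) (hp_top : p ≠ ⊤)
    (u w : Lp E p μ) :
    ∫ t, ‖u t‖ ^ (p.toReal - 1) * ‖w t‖ ∂μ ≤ ‖u‖ ^ (p.toReal - 1) * ‖w‖ := by
  have hP := one_lt_toReal hp hp_top
  have hconj := (Real.HolderConjugate.conjExponent hP).symm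
  have hw : MemLp (fun t => ‖w t‖) (ENNReal.ofReal p.toReal) μ := by
    simpa only [ENNReal.ofReal_toReal hp_top] using (Lp.memLp w).norm
  have hexp : (p.toReal - 1) * p.toReal.conjExponent = p.toReal := hconj.symm.sub_one_mul_conj
  have hexp' : p.toReal * (1 / p.toReal.conjExponent) = p.toReal - 1 := by
    rw [mul_one_div, hconj.symm.div_conj_eq_sub_one]
  refine (integral_mul_le_Lp_mul_Lq_of_nonneg hconj (ae_of_all _ fun t => by positivity)
    (ae_of_all _ fun t => by positivity) (memLp_norm_rpow_sub_one hp hp_top u) hw).trans_eq ?_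
  simp only [← Real.rpow_mul (norm_nonneg _), hexp]
  rw [integral_norm_rpow hp hp_top, integral_norm_rpow hp hp_top,
    ← Real.rpow_mul (norm_nonneg _), hexp', one_div, Real.rpow_rpow_inv (norm_nonneg _)
      (by linarith)]

theorem coeFn_midpoint [NormedSpace ℝ E] (u v : Lp E p μ) :
    ⇑(midpoint ℝ u v : Lp E p μ) =ᵐ[μ] fun t => midpoint ℝ (u t) (v t) := by
  simp only [midpoint_eq_smul_add]
  filter_upwards [Lp.coeFn_smul (⅟2 : ℝ) (u + v), Lp.coeFn_add u v] with t hsmul hadd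
  rw [hsmul, Pi.smul_apply, hadd, Pi.add_apply]

end Lp

section IntegralFunctional

variable {α E : Type*} {m : MeasurableSpace α} {μ : Measure α} {p : ℝ≥0∞} [NormedAddCommGroup E]
  [NormedSpace ℝ E] [FiniteDimensional ℝ E] {f : E → ℝ}

/-- The functional `u ↦ ∫ f(u(t)) dt` on `L^p`. -/
noncomputable def integralFunctional (f : E → ℝ) (u : Lp E p μ) : ℝ :=
  ∫ t, f (u t) ∂μ

namespace IsHomogeneousIntegrand

theorem integrable_comp (hf : IsHomogeneousIntegrand p.toReal f) (hp : 1 < p) (hp_top : p ≠ ⊤)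
    (u : Lp E p μ) : Integrable (fun t => f (u t)) μ := by
  have hP := one_lt_toReal hp hp_top
  obtain ⟨C, -, hC⟩ := hf.exists_le_norm_rpow hP
  refine ((integrable_norm_rpow hp hp_top u).const_mul C).mono'
    (hf.contDiff.continuous.comp_aestronglyMeasurable (Lp.aestronglyMeasurable u))
    (ae_of_all _ fun t => ?_)
  rw [Real.norm_of_nonneg (hf.map_nonneg hP _)]
  exact hC _

theorem memLp_fderiv (hf : IsHomogeneousIntegrand p.toReal f) (hp : 1 < p) (hp_top : p ≠ ⊤)
    (u : Lp E p μ) :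
    MemLp (fun t => fderiv ℝ f (u t)) (ENNReal.ofReal p.toReal.conjExponent) μ := by
  obtain ⟨C, -, hC⟩ := hf.exists_norm_fderiv_le (one_lt_toReal hp hp_top)
  refine ((memLp_norm_rpow_sub_one hp hp_top u).const_mul C).mono'
    ((hf.contDiff.continuous_fderiv one_ne_zero).comp_aestronglyMeasurable
      (Lp.aestronglyMeasurable u)) (ae_of_all _ fun t => hC _)

theorem exists_taylor_le (hf : IsHomogeneousIntegrand p.toReal f) (hp : 1 < p) (hp_top : p ≠ ⊤)
    {ε : ℝ} (hε : 0 < ε) :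
    ∃ C, 0 ≤ C ∧ ∀ a b, |f (a + b) - f a - fderiv ℝ f a b| ≤
      (ε * ‖a‖ ^ (p.toReal - 1) + C * ‖b‖ ^ (p.toReal - 1)) * ‖b‖ := by
  obtain ⟨C, hC0, hC⟩ := hf.exists_norm_fderiv_add_sub_le (one_lt_toReal hp hp_top) hε
  have hdiff := hf.contDiff.differentiable one_ne_zero
  refine ⟨C, hC0, fun a b => ?_⟩
  have hlower := fderiv_sub_le_of_convexOn hf.strictConvexOn.convexOn (hdiff a) (a + b)
  have hupper := fderiv_sub_le_of_convexOn hf.strictConvexOn.convexOn (hdiff (a + b)) a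
  rw [add_sub_cancel_left] at hlower
  rw [sub_add_cancel_left, map_neg] at hupper
  rw [abs_of_nonneg (by linarith)]
  calc f (a + b) - f a - fderiv ℝ f a b ≤ (fderiv ℝ f (a + b) - fderiv ℝ f a) b := by
        rw [_root_.sub_apply]; linarith
    _ ≤ ‖fderiv ℝ f (a + b) - fderiv ℝ f a‖ * ‖b‖ :=
        (Real.le_norm_self _).trans (ContinuousLinearMap.le_opNorm _ _)
    _ ≤ _ := by gcongr; exact hC a b

theorem integrable_fderiv_apply (hf : IsHomogeneousIntegrand p.toReal f) (hp : 1 < p)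
    (hp_top : p ≠ ⊤) (u w : Lp E p μ) : Integrable (fun t => fderiv ℝ f (u t) (w t)) μ := by
  have := holderConjugate_conjExponent_toReal hp hp_top
  exact memLp_one_iff_integrable.1 ((ContinuousLinearMap.id ℝ (E →L[ℝ] ℝ)).memLp_of_bilin 1
    (hf.memLp_fderiv hp hp_top u) (Lp.memLp w))

theorem convexOn_integralFunctional (hf : IsHomogeneousIntegrand p.toReal f) (hp : 1 < p)
    (hp_top : p ≠ ⊤) : ConvexOn ℝ univ (integralFunctional f : Lp E p μ → ℝ) := by
  refine ⟨convex_univ, fun u _ v _ a b ha hb hab => ?_⟩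
  have hu := (hf.integrable_comp hp hp_top u).const_mul a
  have hv := (hf.integrable_comp hp hp_top v).const_mul b
  rw [smul_eq_mul, smul_eq_mul, integralFunctional, integralFunctional, integralFunctional,
    ← integral_const_mul, ← integral_const_mul, ← integral_add hu hv]
  refine integral_mono_ae (hf.integrable_comp hp hp_top _) (hu.add hv) ?_
  filter_upwards [Lp.coeFn_add (a • u) (b • v), Lp.coeFn_smul a u, Lp.coeFn_smul b v]
    with t hadd hau hbv
  simp only [hadd, Pi.add_apply, hau, hbv, Pi.smul_apply]
  exact hf.strictConvexOn.convexOn.2 (mem_univ _) (mem_univ _) ha hb hab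

theorem exists_norm_rpow_le_integralFunctional (hf : IsHomogeneousIntegrand p.toReal f)
    (hp : 1 < p) (hp_top : p ≠ ⊤) :
    ∃ C, 0 ≤ C ∧ ∀ u : Lp E p μ, ‖u‖ ^ p.toReal ≤ C * integralFunctional f u := by
  obtain ⟨C, hC0, hC⟩ := hf.exists_norm_rpow_le (one_lt_toReal hp hp_top)
  refine ⟨C, hC0, fun u => ?_⟩
  rw [← integral_norm_rpow hp hp_top, integralFunctional, ← integral_const_mul]
  exact integral_mono (integrable_norm_rpow hp hp_top u)
    ((hf.integrable_comp hp hp_top u).const_mul C) fun t => hC _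

theorem exists_integralFunctional_le_norm_rpow (hf : IsHomogeneousIntegrand p.toReal f)
    (hp : 1 < p) (hp_top : p ≠ ⊤) :
    ∃ C, 0 ≤ C ∧ ∀ u : Lp E p μ, integralFunctional f u ≤ C * ‖u‖ ^ p.toReal := by
  obtain ⟨C, hC0, hC⟩ := hf.exists_le_norm_rpow (one_lt_toReal hp hp_top)
  refine ⟨C, hC0, fun u => ?_⟩
  rw [← integral_norm_rpow hp hp_top, integralFunctional, ← integral_const_mul]
  exact integral_mono (hf.integrable_comp hp hp_top u)
    ((integrable_norm_rpow hp hp_top u).const_mul C) fun t => hC _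

theorem integrable_midpointGap (hf : IsHomogeneousIntegrand p.toReal f) (hp : 1 < p)
    (hp_top : p ≠ ⊤) (u v : Lp E p μ) : Integrable (fun t => midpointGap f (u t) (v t)) μ := by
  refine (((hf.integrable_comp hp hp_top u).add (hf.integrable_comp hp hp_top v)).div_const 2).sub
    ((hf.integrable_comp hp hp_top (midpoint ℝ u v)).congr ?_)
  filter_upwards [coeFn_midpoint u v] with t ht
  rw [ht]

variable [Fact (1 ≤ p)]

theorem midpointGap_integralFunctional (hf : IsHomogeneousIntegrand p.toReal f) (hp : 1 < p)
    (hp_top : p ≠ ⊤) (u v : Lp E p μ) :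
    midpointGap (integralFunctional f) u v = ∫ t, midpointGap f (u t) (v t) ∂μ := by
  have hu := hf.integrable_comp hp hp_top u
  have hv := hf.integrable_comp hp hp_top v
  have hmid : integralFunctional f (midpoint ℝ u v) = ∫ t, f (midpoint ℝ (u t) (v t)) ∂μ :=
    integral_congr_ae ((coeFn_midpoint u v).fun_comp f)
  have hm : Integrable (fun t => f (midpoint ℝ (u t) (v t))) μ :=
    (hf.integrable_comp hp hp_top (midpoint ℝ u v)).congr ((coeFn_midpoint u v).fun_comp f)
  have huv : Integrable (fun t => (f (u t) + f (v t)) / 2) μ := (hu.add hv).div_const 2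
  rw [midpointGap, hmid, integralFunctional, integralFunctional, ← integral_add hu hv,
    ← integral_div, ← integral_sub huv hm]
  rfl

theorem exists_clm_eq_integral_fderiv (hf : IsHomogeneousIntegrand p.toReal f) (hp : 1 < p)
    (hp_top : p ≠ ⊤) (u : Lp E p μ) :
    ∃ D : Lp E p μ →L[ℝ] ℝ, ∀ w, D w = ∫ t, fderiv ℝ f (u t) (w t) ∂μ := by
  have := holderConjugate_conjExponent_toReal hp hp_top
  have : Fact (1 ≤ ENNReal.ofReal p.toReal.conjExponent) := ⟨ENNReal.HolderConjugate.one_le _ p⟩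
  refine ⟨(ContinuousLinearMap.id ℝ (E →L[ℝ] ℝ)).lpPairing μ _ p
    ((hf.memLp_fderiv hp hp_top u).toLp _), fun w => ?_⟩
  rw [ContinuousLinearMap.lpPairing_eq_integral]
  refine integral_congr_ae ?_
  filter_upwards [(hf.memLp_fderiv hp hp_top u).coeFn_toLp] with t ht
  rw [ht, ContinuousLinearMap.id_apply]

theorem exists_integralFunctional_taylor_le (hf : IsHomogeneousIntegrand p.toReal f) (hp : 1 < p)
    (hp_top : p ≠ ⊤) {ε : ℝ} (hε : 0 < ε) :
    ∃ C, 0 ≤ C ∧ ∀ u w : Lp E p μ,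
      |integralFunctional f (u + w) - integralFunctional f u - ∫ t, fderiv ℝ f (u t) (w t) ∂μ| ≤
        (ε * ‖u‖ ^ (p.toReal - 1) + C * ‖w‖ ^ (p.toReal - 1)) * ‖w‖ := by
  obtain ⟨C, hC0, hC⟩ := hf.exists_taylor_le hp hp_top hε
  refine ⟨C, hC0, fun u w => ?_⟩
  have hint := fun v : Lp E p μ => hf.integrable_comp hp hp_top v
  have hintD := hf.integrable_fderiv_apply hp hp_top u w
  have hintM := fun v : Lp E p μ => integrable_norm_rpow_sub_one_mul hp hp_top v w
  have hintsub : Integrable (fun t => f ((u + w) t) - f (u t)) μ := (hint _).sub (hint u)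
  have hbound : ∀ᵐ t ∂μ, |f ((u + w) t) - f (u t) - fderiv ℝ f (u t) (w t)| ≤
      ε * (‖u t‖ ^ (p.toReal - 1) * ‖w t‖) + C * (‖w t‖ ^ (p.toReal - 1) * ‖w t‖) := by
    filter_upwards [Lp.coeFn_add u w] with t ht
    rw [ht, Pi.add_apply]
    exact (hC _ _).trans_eq (by ring)
  calc _ = |∫ t, f ((u + w) t) - f (u t) - fderiv ℝ f (u t) (w t) ∂μ| := by
        rw [integral_sub hintsub hintD, integral_sub (hint _) (hint u)]
        rfl
    _ ≤ ∫ t, |f ((u + w) t) - f (u t) - fderiv ℝ f (u t) (w t)| ∂μ :=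
        abs_integral_le_integral_abs
    _ ≤ ∫ t, ε * (‖u t‖ ^ (p.toReal - 1) * ‖w t‖) + C * (‖w t‖ ^ (p.toReal - 1) * ‖w t‖) ∂μ :=
        integral_mono_ae (hintsub.sub hintD).abs
          (((hintM u).const_mul ε).add ((hintM w).const_mul C)) hbound
    _ ≤ ε * (‖u‖ ^ (p.toReal - 1) * ‖w‖) + C * (‖w‖ ^ (p.toReal - 1) * ‖w‖) := by
        rw [integral_add ((hintM u).const_mul ε) ((hintM w).const_mul C), integral_const_mul,
          integral_const_mul]
        gcongr <;> exact integral_norm_rpow_sub_one_mul_le hp hp_top _ w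
    _ = _ := by ring

theorem differentiable_integralFunctional (hf : IsHomogeneousIntegrand p.toReal f) (hp : 1 < p)
    (hp_top : p ≠ ⊤) : Differentiable ℝ (integralFunctional f : Lp E p μ → ℝ) := by
  intro u
  have hP := one_lt_toReal hp hp_top
  obtain ⟨D, hD⟩ := hf.exists_clm_eq_integral_fderiv hp hp_top u
  refine ⟨D, ?_⟩
  rw [hasFDerivAt_iff_isLittleO_nhds_zero, Asymptotics.isLittleO_iff]
  intro c hc
  have hu : 0 < ‖u‖ ^ (p.toReal - 1) + 1 := by positivity
  obtain ⟨C, -, hC⟩ := hf.exists_integralFunctional_taylor_le (μ := μ) hp hp_top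
    (div_pos (half_pos hc) hu)
  have hsmall : Tendsto (fun w : Lp E p μ => C * ‖w‖ ^ (p.toReal - 1)) (𝓝 0) (𝓝 0) := by
    have : Continuous fun w : Lp E p μ => C * ‖w‖ ^ (p.toReal - 1) :=
      (continuous_norm.rpow_const fun _ => Or.inr (by linarith)).const_mul C
    simpa [Real.zero_rpow (by linarith : p.toReal - 1 ≠ 0)] using this.tendsto 0
  filter_upwards [hsmall.eventually (gt_mem_nhds (half_pos hc))] with w hw
  rw [hD]
  refine (hC u w).trans (mul_le_mul_of_nonneg_right ?_ (norm_nonneg w))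
  have : c / 2 / (‖u‖ ^ (p.toReal - 1) + 1) * ‖u‖ ^ (p.toReal - 1) ≤ c / 2 := by
    rw [div_mul_eq_mul_div, div_le_iff₀ hu]
    nlinarith
  linarith

theorem exists_norm_sub_rpow_le_integralFunctional (hf : IsHomogeneousIntegrand p.toReal f)
    (hp : 1 < p) (hp_top : p ≠ ⊤) {ε : ℝ} (hε : 0 < ε) :
    ∃ C, 0 ≤ C ∧ ∀ u v : Lp E p μ, ‖u - v‖ ^ p.toReal ≤
      ε * (‖u‖ ^ p.toReal + ‖v‖ ^ p.toReal) + C * midpointGap (integralFunctional f) u v := by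
  obtain ⟨C, hC0, hC⟩ := hf.exists_norm_sub_rpow_le (one_lt_toReal hp hp_top) hε
  refine ⟨C, hC0, fun u v => ?_⟩
  have hnorm := fun w : Lp E p μ => integrable_norm_rpow hp hp_top w
  have hgap := hf.integrable_midpointGap hp hp_top u v
  have hsum : Integrable (fun t => ε * (‖u t‖ ^ p.toReal + ‖v t‖ ^ p.toReal)) μ :=
    ((hnorm u).add (hnorm v)).const_mul ε
  simp only [hf.midpointGap_integralFunctional hp hp_top, ← integral_norm_rpow hp hp_top]
  rw [← integral_add (hnorm u) (hnorm v), ← integral_const_mul, ← integral_const_mul,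
    ← integral_add hsum (hgap.const_mul C)]
  refine integral_mono_ae (hnorm _)
    (hsum.add (hgap.const_mul C)) ?_
  filter_upwards [Lp.coeFn_sub u v] with t ht
  simp only [ht, Pi.sub_apply]
  exact hC _ _

theorem tendsto_sub_of_midpointGap (hf : IsHomogeneousIntegrand p.toReal f) (hp : 1 < p)
    (hp_top : p ≠ ⊤) {ι : Type*} {l : Filter ι} {u v : ι → Lp E p μ} {R : ℝ}
    (hu : ∀ᶠ i in l, ‖u i‖ ≤ R) (hv : ∀ᶠ i in l, ‖v i‖ ≤ R)
    (hgap : Tendsto (fun i => midpointGap (integralFunctional f) (u i) (v i)) l (𝓝 0)) :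
    Tendsto (fun i => u i - v i) l (𝓝 0) := by
  have hP := one_lt_toReal hp hp_top
  rw [tendsto_zero_iff_norm_tendsto_zero]
  suffices h : Tendsto (fun i => ‖u i - v i‖ ^ p.toReal) l (𝓝 0) by
    simpa [Real.rpow_rpow_inv, show p.toReal ≠ 0 by linarith] using
      h.rpow_const (p := p.toReal⁻¹) (Or.inr (by positivity))
  refine tendsto_order.2 ⟨fun a ha => .of_forall fun i => ha.trans_le (by positivity),
    fun ε hε => ?_⟩
  set B := 2 * |R| ^ p.toReal + 1
  have hB0 : 0 < B := by positivity
  obtain ⟨C, -, hC⟩ := hf.exists_norm_sub_rpow_le_integralFunctional (μ := μ) hp hp_top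
    (div_pos (half_pos hε) hB0)
  have hCgap := hgap.const_mul C
  rw [mul_zero] at hCgap
  have hpow : ∀ w : Lp E p μ, ‖w‖ ≤ R → ‖w‖ ^ p.toReal ≤ |R| ^ p.toReal := fun w hw =>
    Real.rpow_le_rpow (norm_nonneg w) (hw.trans (le_abs_self R)) (by linarith)
  filter_upwards [hu, hv, hCgap.eventually (gt_mem_nhds (half_pos hε))] with i hui hvi hgi
  calc ‖u i - v i‖ ^ p.toReal ≤ ε / 2 / B * (‖u i‖ ^ p.toReal + ‖v i‖ ^ p.toReal) +
        C * midpointGap (integralFunctional f) (u i) (v i) := hC _ _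
    _ < ε / 2 / B * B + ε / 2 := by
        gcongr
        linarith [hpow _ hui, hpow _ hvi]
    _ = ε := by field_simp; ring

end IsHomogeneousIntegrand

end IntegralFunctional

section Energy

theorem strictConvexOn_abs_rpow {P : ℝ} (hP : 1 < P) :
    StrictConvexOn ℝ univ fun x : ℝ => |x| ^ P := by
  have hP0 : 0 < P := by linarith
  refine ⟨convex_univ, fun x _ y _ hxy a b ha hb hab => ?_⟩
  simp only [smul_eq_mul]
  have htri : |a * x + b * y| ≤ a * |x| + b * |y| := by
    simpa [abs_mul, abs_of_pos ha, abs_of_pos hb] using abs_add_le (a * x) (b * y)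
  rcases ne_or_eq |x| |y| with hne | heq
  · calc |a * x + b * y| ^ P ≤ (a * |x| + b * |y|) ^ P := by gcongr
      _ < a * |x| ^ P + b * |y| ^ P := by
        simpa using (strictConvexOn_rpow hP).2 (abs_nonneg x) (abs_nonneg y) hne ha hb hab
  · obtain rfl : y = -x := by
      rcases abs_eq_abs.1 heq with h | h
      · exact absurd h hxy
      · linarith
    have hx : x ≠ 0 := by rintro rfl; simp at hxy
    have hlt : |a * x + b * -x| < |x| := by
      rw [show a * x + b * -x = (a - b) * x by ring, abs_mul]
      exact mul_lt_of_lt_one_left (abs_pos.2 hx) (abs_lt.2 ⟨by linarith, by linarith⟩)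
    rw [abs_neg, ← add_mul, hab, one_mul]
    exact Real.rpow_lt_rpow (abs_nonneg _) hlt hP0

/-- The integrand `a ↦ ∑ i, |a_i| ^ P` of the energy. -/
noncomputable def energyIntegrand {d : ℕ} (P : ℝ) (a : EuclideanSpace ℝ (Fin d)) : ℝ :=
  ∑ i, |a i| ^ P

theorem isHomogeneousIntegrand_energyIntegrand {d : ℕ} {P : ℝ} (hP : 1 < P) :
    IsHomogeneousIntegrand P (energyIntegrand P : EuclideanSpace ℝ (Fin d) → ℝ) where
  contDiff := ContDiff.sum fun i _ =>
    (contDiff_norm_rpow (E := ℝ) hP).comp (EuclideanSpace.proj (𝕜 := ℝ) i).contDiff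
  strictConvexOn := by
    refine ⟨convex_univ, fun a _ b _ hab s t hs ht hst => ?_⟩
    have hconv := strictConvexOn_abs_rpow hP
    obtain ⟨i, hi⟩ : ∃ i, a i ≠ b i := by
      by_contra! h
      exact hab (PiLp.ext h)
    simp only [energyIntegrand, Finset.smul_sum, ← Finset.sum_add_distrib]
    exact Finset.sum_lt_sum
      (fun j _ => hconv.convexOn.2 (mem_univ _) (mem_univ _) hs.le ht.le hst)
      ⟨i, Finset.mem_univ i, hconv.2 (mem_univ _) (mem_univ _) hi hs ht hst⟩
  posHomogeneous a t ht := by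
    simp [energyIntegrand, abs_mul, abs_of_pos ht, Real.mul_rpow ht.le, Finset.mul_sum]

variable {d : ℕ} {p : ℝ≥0∞}

theorem energy_eq_integralFunctional (hp : 1 < p) (hp_top : p ≠ ⊤) :
    (energy : Control d p → ℝ) = integralFunctional (energyIntegrand p.toReal) := by
  funext u
  refine (integral_finsetSum _ fun i _ => ?_).symm
  refine (integrable_norm_rpow hp hp_top u).mono' ?_ (ae_of_all _ fun t => ?_)
  · have hcoord : Continuous fun a : EuclideanSpace ℝ (Fin d) => |a i| ^ p.toReal :=
      (by fun_prop : Continuous fun a : EuclideanSpace ℝ (Fin d) => |a i|).rpow_const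
        fun _ => Or.inr ENNReal.toReal_nonneg
    exact hcoord.comp_aestronglyMeasurable (Lp.aestronglyMeasurable u)
  · rw [Real.norm_of_nonneg (by positivity)]
    gcongr
    exact PiLp.norm_apply_le (u t) i

theorem energy_nonneg (u : Control d p) : 0 ≤ energy u :=
  Finset.sum_nonneg fun _ _ => integral_nonneg fun _ => by positivity

theorem convexOn_energy (hp : 1 < p) (hp_top : p ≠ ⊤) :
    ConvexOn ℝ univ (energy : Control d p → ℝ) := by
  rw [energy_eq_integralFunctional hp hp_top]
  exact (isHomogeneousIntegrand_energyIntegrand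
    (one_lt_toReal hp hp_top)).convexOn_integralFunctional hp hp_top

variable [Fact (1 ≤ p)]

theorem exists_norm_le_of_energy_le (hp : 1 < p) (hp_top : p ≠ ⊤) (B : ℝ) :
    ∃ R, ∀ u : Control d p, energy u ≤ B → ‖u‖ ≤ R := by
  have hP := one_lt_toReal hp hp_top
  rw [energy_eq_integralFunctional hp hp_top]
  obtain ⟨C, hC0, hC⟩ := (isHomogeneousIntegrand_energyIntegrand (d := d)
    hP).exists_norm_rpow_le_integralFunctional (μ := volume.restrict (Icc (0 : ℝ) 1)) hp hp_top
  refine ⟨(C * B) ^ p.toReal⁻¹, fun u hu => ?_⟩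
  rw [← Real.rpow_rpow_inv (norm_nonneg u) (show p.toReal ≠ 0 by linarith)]
  gcongr
  exact (hC u).trans (by gcongr)

theorem exists_energy_le_of_norm_le (hp : 1 < p) (hp_top : p ≠ ⊤) (R : ℝ) :
    ∃ B, ∀ u : Control d p, ‖u‖ ≤ R → energy u ≤ B := by
  rw [energy_eq_integralFunctional hp hp_top]
  obtain ⟨C, hC0, hC⟩ := (isHomogeneousIntegrand_energyIntegrand (d := d)
    (one_lt_toReal hp hp_top)).exists_integralFunctional_le_norm_rpow
      (μ := volume.restrict (Icc (0 : ℝ) 1)) hp hp_top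
  exact ⟨C * R ^ p.toReal, fun u hu => (hC u).trans (by gcongr)⟩

theorem differentiable_energy (hp : 1 < p) (hp_top : p ≠ ⊤) :
    Differentiable ℝ (energy : Control d p → ℝ) := by
  rw [energy_eq_integralFunctional hp hp_top]
  exact (isHomogeneousIntegrand_energyIntegrand
    (one_lt_toReal hp hp_top)).differentiable_integralFunctional hp hp_top

theorem exists_norm_fderiv_energy_le (hp : 1 < p) (hp_top : p ≠ ⊤) (R : ℝ) :
    ∃ C, ∀ u : Control d p, ‖u‖ ≤ R → ‖fderiv ℝ energy u‖ ≤ C := by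
  have hbdd (r : ℝ) : ∃ B, ∀ u : Control d p, ‖u‖ ≤ r → |energy u| ≤ B := by
    obtain ⟨B, hB⟩ := exists_energy_le_of_norm_le (d := d) hp hp_top r
    exact ⟨B, fun u hu => (abs_of_nonneg (energy_nonneg u)).trans_le (hB u hu)⟩
  exact exists_norm_fderiv_le_of_convexOn (E := Control d p) (convexOn_energy hp hp_top) hbdd R

theorem tendsto_sub_of_midpointGap_energy (hp : 1 < p) (hp_top : p ≠ ⊤) {ι : Type*}
    {l : Filter ι} {u v : ι → Control d p} {R : ℝ} (hu : ∀ᶠ i in l, ‖u i‖ ≤ R)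
    (hv : ∀ᶠ i in l, ‖v i‖ ≤ R)
    (hgap : Tendsto (fun i => midpointGap energy (u i) (v i)) l (𝓝 0)) :
    Tendsto (fun i => u i - v i) l (𝓝 0) := by
  rw [energy_eq_integralFunctional hp hp_top] at hgap
  exact (isHomogeneousIntegrand_energyIntegrand
    (one_lt_toReal hp hp_top)).tendsto_sub_of_midpointGap hp hp_top hu hv hgap

end Energy

section Primitive

open scoped BoundedContinuousFunction

variable {d : ℕ} {p : ℝ≥0∞} [Fact (1 ≤ p)]

theorem integrable_control (u : Control d p) :
    Integrable (fun t => u t) (volume.restrict (Icc (0 : ℝ) 1)) :=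
  (Lp.memLp u).integrable Fact.out

theorem intervalIntegrable_control (u : Control d p) {a b : ℝ} (ha : a ∈ Icc (0 : ℝ) 1)
    (hb : b ∈ Icc (0 : ℝ) 1) : IntervalIntegrable (fun t => u t) volume a b := by
  have h : IntegrableOn (fun t => u t) (Icc (0 : ℝ) 1) := integrable_control u
  exact (h.mono_set (uIcc_subset_Icc ha hb)).intervalIntegrable

theorem ae_interval_of_ae_restrict {P : ℝ → Prop} {a b : ℝ} (ha : a ∈ Icc (0 : ℝ) 1)
    (hb : b ∈ Icc (0 : ℝ) 1) (h : ∀ᵐ t ∂(volume.restrict (Icc (0 : ℝ) 1)), P t) :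
    ∀ᵐ t, t ∈ uIoc a b → P t := by
  filter_upwards [(ae_restrict_iff' measurableSet_Icc).1 h] with t ht hmem
  exact ht (uIcc_subset_Icc ha hb (uIoc_subset_uIcc hmem))

theorem integral_norm_control_le_norm (u : Control d p) {a b : ℝ} (ha : 0 ≤ a) (hab : a ≤ b)
    (hb : b ≤ 1) : ∫ t in a..b, ‖u t‖ ≤ ‖u‖ := by
  have hprob : IsProbabilityMeasure (volume.restrict (Icc (0 : ℝ) 1)) := ⟨by simp⟩
  have hsub : Ioc a b ⊆ Icc 0 1 := Ioc_subset_Icc_self.trans (Icc_subset_Icc ha hb)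
  calc ∫ t in a..b, ‖u t‖ = ∫ t in Ioc a b, ‖u t‖ := intervalIntegral.integral_of_le hab
    _ ≤ ∫ t in Icc 0 1, ‖u t‖ :=
      setIntegral_mono_set (integrable_control u).norm (ae_of_all _ fun t => norm_nonneg _)
        hsub.eventuallyLE
    _ = (eLpNorm u 1 (volume.restrict (Icc (0 : ℝ) 1))).toReal := by
      rw [integral_norm_eq_lintegral_enorm (Lp.aestronglyMeasurable u),
        eLpNorm_one_eq_lintegral_enorm]
    _ ≤ ‖u‖ := ENNReal.toReal_mono (Lp.eLpNorm_lt_top u).ne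
      (eLpNorm_le_eLpNorm_of_exponent_le Fact.out (Lp.aestronglyMeasurable u))

theorem integral_norm_control_le (hp_top : p ≠ ⊤) (u : Control d p) {a b : ℝ}
    (ha : 0 ≤ a) (hab : a ≤ b) (hb : b ≤ 1) :
    ∫ t in a..b, ‖u t‖ ≤ (b - a) ^ (1 - p.toReal⁻¹) * ‖u‖ := by
  have h1p : (1 : ℝ≥0∞) ≤ p := Fact.out
  have hP : 1 ≤ p.toReal := by
    simpa using (ENNReal.toReal_le_toReal ENNReal.one_ne_top hp_top).2 h1p
  have hexp : 0 ≤ 1 - p.toReal⁻¹ := sub_nonneg.2 (inv_le_one_of_one_le₀ hP)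
  have hle : volume.restrict (Ioc a b) ≤ volume.restrict (Icc (0 : ℝ) 1) :=
    Measure.restrict_mono (Ioc_subset_Icc_self.trans (Icc_subset_Icc ha hb)) le_rfl
  have hmeas : AEStronglyMeasurable u (volume.restrict (Ioc a b)) :=
    (Lp.aestronglyMeasurable u).mono_measure hle
  have hvol : (volume.restrict (Ioc a b)) univ = ENNReal.ofReal (b - a) := by simp
  have hpow : eLpNorm u 1 (volume.restrict (Ioc a b)) ≤
      eLpNorm u p (volume.restrict (Icc 0 1)) * ENNReal.ofReal ((b - a) ^ (1 - p.toReal⁻¹)) := by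
    have := eLpNorm_le_eLpNorm_mul_rpow_measure_univ h1p hmeas
    rw [hvol, ENNReal.toReal_one, div_one, one_div,
      ENNReal.ofReal_rpow_of_nonneg (by linarith) hexp] at this
    exact this.trans (mul_le_mul_left (eLpNorm_mono_measure _ hle) _)
  calc ∫ t in a..b, ‖u t‖ = (eLpNorm u 1 (volume.restrict (Ioc a b))).toReal := by
        rw [intervalIntegral.integral_of_le hab, integral_norm_eq_lintegral_enorm hmeas,
          eLpNorm_one_eq_lintegral_enorm]
    _ ≤ (eLpNorm u p (volume.restrict (Icc 0 1)) *
          ENNReal.ofReal ((b - a) ^ (1 - p.toReal⁻¹))).toReal :=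
        ENNReal.toReal_mono
          (ENNReal.mul_ne_top (Lp.eLpNorm_lt_top u).ne ENNReal.ofReal_ne_top) hpow
    _ = (b - a) ^ (1 - p.toReal⁻¹) * ‖u‖ := by
        rw [ENNReal.toReal_mul, ENNReal.toReal_ofReal (Real.rpow_nonneg (by linarith) _), mul_comm,
          Lp.norm_def]

theorem norm_integral_control_le (u : Control d p) {t : ℝ} (ht : t ∈ Icc (0 : ℝ) 1) :
    ‖∫ s in (0 : ℝ)..t, u s‖ ≤ ‖u‖ :=
  (intervalIntegral.norm_integral_le_integral_norm ht.1).trans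
    (integral_norm_control_le_norm u le_rfl ht.1 ht.2)

/-- The primitive `t ↦ ∫₀ᵗ u` of a control, as a bounded operator into the continuous functions on
`[0, 1]`. -/
noncomputable def primitive :
    Control d p →L[ℝ] (Icc (0 : ℝ) 1 →ᵇ EuclideanSpace ℝ (Fin d)) :=
  LinearMap.mkContinuous
    { toFun := fun u => BoundedContinuousFunction.mkOfCompact
        ⟨fun t => ∫ s in (0 : ℝ)..t, u s, continuousOn_iff_continuous_domRestrict.1 <| by
          simpa using intervalIntegral.continuousOn_primitive_interval
            (a := 0) (b := 1) (by simpa [IntegrableOn] using integrable_control u)⟩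
      map_add' := fun u v => by
        have h0 : (0 : ℝ) ∈ Icc (0 : ℝ) 1 := by simp
        ext1 t
        change ∫ s in (0 : ℝ)..t, (u + v) s = (∫ s in (0 : ℝ)..t, u s) + ∫ s in (0 : ℝ)..t, v s
        rw [← intervalIntegral.integral_add (intervalIntegrable_control u h0 t.2)
          (intervalIntegrable_control v h0 t.2)]
        exact intervalIntegral.integral_congr_ae
          (ae_interval_of_ae_restrict h0 t.2 (Lp.coeFn_add u v))
      map_smul' := fun c u => by
        ext1 t
        change ∫ s in (0 : ℝ)..t, (c • u) s = c • ∫ s in (0 : ℝ)..t, u s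
        rw [← intervalIntegral.integral_smul]
        exact intervalIntegral.integral_congr_ae
          (ae_interval_of_ae_restrict (by simp) t.2 (Lp.coeFn_smul c u)) }
    1 fun u => by
      rw [one_mul]
      exact (BoundedContinuousFunction.norm_le (norm_nonneg u)).2
        fun t => norm_integral_control_le u t.2

theorem primitive_apply (u : Control d p) (t : Icc (0 : ℝ) 1) :
    primitive u t = ∫ s in (0 : ℝ)..t, u s :=
  rfl

theorem norm_primitive_sub_le (hp_top : p ≠ ⊤) (u : Control d p) (s t : Icc (0 : ℝ) 1) :
    ‖primitive u t - primitive u s‖ ≤ |(t : ℝ) - s| ^ (1 - p.toReal⁻¹) * ‖u‖ := by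
  have h0 : (0 : ℝ) ∈ Icc (0 : ℝ) 1 := by simp
  wlog hst : s ≤ t generalizing s t
  · rw [norm_sub_rev, abs_sub_comm]
    exact this t s (le_of_not_ge hst)
  have hst' : (s : ℝ) ≤ t := hst
  rw [primitive_apply, primitive_apply, intervalIntegral.integral_interval_sub_left
    (intervalIntegrable_control u h0 t.2) (intervalIntegrable_control u h0 s.2),
    abs_of_nonneg (sub_nonneg.2 hst')]
  exact (intervalIntegral.norm_integral_le_integral_norm hst').trans
    (integral_norm_control_le hp_top u s.2.1 hst' t.2.2)

theorem isCompact_closure_primitive_image_closedBall (hp : 1 < p) (hp_top : p ≠ ⊤) (R : ℝ) :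
    IsCompact (closure ((primitive : Control d p →L[ℝ] _) '' Metric.closedBall 0 R)) := by
  have hexp : 0 < 1 - p.toReal⁻¹ := sub_pos.2 (inv_lt_one_of_one_lt₀ (one_lt_toReal hp hp_top))
  refine BoundedContinuousFunction.arzela_ascoli (Metric.closedBall 0 R) (isCompact_closedBall _ _)
    _ ?_ fun s => ?_
  · rintro _ t ⟨u, hu, rfl⟩
    rw [mem_closedBall_zero_iff] at hu ⊢
    exact (norm_integral_control_le u t.2).trans hu
  · have hmod : Tendsto (fun t : Icc (0 : ℝ) 1 => |(t : ℝ) - s| ^ (1 - p.toReal⁻¹) * R)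
        (𝓝 s) (𝓝 0) := by
      have hcont : Continuous fun t : Icc (0 : ℝ) 1 => |(t : ℝ) - s| ^ (1 - p.toReal⁻¹) * R :=
        ((by fun_prop : Continuous fun t : Icc (0 : ℝ) 1 => |(t : ℝ) - s|).rpow_const
          fun _ => Or.inr hexp.le).mul_const R
      simpa [Real.zero_rpow hexp.ne'] using hcont.tendsto s
    rw [Metric.equicontinuousAt_iff_right]
    intro ε hε
    filter_upwards [hmod.eventually (gt_mem_nhds hε)] with t ht
    rintro ⟨_, u, hu, rfl⟩
    rw [mem_closedBall_zero_iff] at hu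
    rw [dist_comm, dist_eq_norm]
    exact (norm_primitive_sub_le hp_top u s t).trans_lt (lt_of_le_of_lt (by gcongr) ht)

end Primitive

section WeakConvergence

variable {d : ℕ} {p : ℝ≥0∞} [Fact (1 ≤ p)]

theorem cauchySeq_of_tendsto_energy (hp : 1 < p) (hp_top : p ≠ ⊤) {K : ℕ → Set (Control d p)}
    (hanti : Antitone K) (hconv : ∀ m, Convex ℝ (K m)) {R : ℝ}
    (hR : ∀ m, K m ⊆ Metric.closedBall 0 R) {e : ℕ → ℝ} {L : ℝ}
    (hle : ∀ m, ∀ w ∈ K m, e m ≤ energy w) (he : Tendsto e atTop (𝓝 L)) {z : ℕ → Control d p}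
    (hz : ∀ m, z m ∈ K m) (hzL : Tendsto (fun m => energy (z m)) atTop (𝓝 L)) : CauchySeq z := by
  have hfst : Tendsto Prod.fst (atTop : Filter (ℕ × ℕ)) atTop := by
    rw [← prod_atTop_atTop_eq]; exact tendsto_fst
  have hsnd : Tendsto Prod.snd (atTop : Filter (ℕ × ℕ)) atTop := by
    rw [← prod_atTop_atTop_eq]; exact tendsto_snd
  have hmin : Tendsto (fun q : ℕ × ℕ => min q.1 q.2) atTop atTop :=
    tendsto_atTop.2 fun m => by
      filter_upwards [hfst.eventually_ge_atTop m, hsnd.eventually_ge_atTop m] with q h h'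
      exact le_min h h'
  have hmid (q : ℕ × ℕ) : e (min q.1 q.2) ≤ energy (midpoint ℝ (z q.1) (z q.2)) :=
    hle _ _ ((hconv _).midpoint_mem (hanti (min_le_left _ _) (hz _))
      (hanti (min_le_right _ _) (hz _)))
  have hupper : Tendsto (fun q : ℕ × ℕ =>
      (energy (z q.1) + energy (z q.2)) / 2 - e (min q.1 q.2)) atTop (𝓝 0) := by
    simpa using (((hzL.comp hfst).add (hzL.comp hsnd)).div_const 2).sub
      (he.comp hmin)
  have hgap : Tendsto (fun q : ℕ × ℕ => midpointGap energy (z q.1) (z q.2)) atTop (𝓝 0) :=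
    squeeze_zero
      (fun q => midpointGap_nonneg (E := Control d p) (convexOn_energy hp hp_top) _ _)
      (fun q => sub_le_sub_left (hmid q) _) hupper
  have hnorm (m : ℕ) : ‖z m‖ ≤ R := mem_closedBall_zero_iff.1 (hR m (hz m))
  have hdiff : Tendsto (fun q : ℕ × ℕ => z q.1 - z q.2) atTop (𝓝 0) :=
    tendsto_sub_of_midpointGap_energy hp hp_top (.of_forall fun q : ℕ × ℕ => hnorm q.1)
      (.of_forall fun q : ℕ × ℕ => hnorm q.2) hgap
  simp only [cauchySeq_iff_tendsto_dist_atTop_0, dist_eq_norm]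
  exact tendsto_zero_iff_norm_tendsto_zero.1 hdiff

theorem exists_tendsto_mem_of_antitone_convex (hp : 1 < p) (hp_top : p ≠ ⊤)
    {K : ℕ → Set (Control d p)} (hanti : Antitone K) (hconv : ∀ m, Convex ℝ (K m))
    (hne : ∀ m, (K m).Nonempty) {R : ℝ} (hR : ∀ m, K m ⊆ Metric.closedBall 0 R) :
    ∃ (z : ℕ → Control d p) (v : Control d p), (∀ m, z m ∈ K m) ∧ Tendsto z atTop (𝓝 v) := by
  obtain ⟨B, hB⟩ := exists_energy_le_of_norm_le (d := d) hp hp_top R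
  set e : ℕ → ℝ := fun m => sInf (energy '' K m)
  have hbelow : ∀ m, BddBelow (energy '' K m) := fun m =>
    ⟨0, forall_mem_image.2 fun w _ => energy_nonneg w⟩
  have hle : ∀ m, ∀ w ∈ K m, e m ≤ energy w := fun m w hw =>
    csInf_le (hbelow m) (mem_image_of_mem _ hw)
  have hmono : Monotone e := fun m m' h =>
    csInf_le_csInf (hbelow m) ((hne m').image _) (image_mono (hanti h))
  obtain ⟨L, hL⟩ : ∃ L, Tendsto e atTop (𝓝 L) := by
    refine ⟨_, tendsto_atTop_ciSup hmono ⟨B, forall_mem_range.2 fun m => ?_⟩⟩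
    obtain ⟨w, hw⟩ := hne m
    exact (hle m w hw).trans (hB w (mem_closedBall_zero_iff.1 (hR m hw)))
  have hex (m : ℕ) : ∃ z ∈ K m, energy z < e m + 1 / ((m : ℝ) + 1) := by
    obtain ⟨_, ⟨z, hz, rfl⟩, hlt⟩ := exists_lt_of_csInf_lt ((hne m).image energy)
      (lt_add_of_pos_right (e m) (show 0 < 1 / ((m : ℝ) + 1) by positivity))
    exact ⟨z, hz, hlt⟩
  choose z hz hzlt using hex
  have hzL : Tendsto (fun m => energy (z m)) atTop (𝓝 L) :=
    tendsto_of_tendsto_of_tendsto_of_le_of_le hL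
      (by simpa using hL.add (tendsto_one_div_add_atTop_nhds_zero_nat (𝕜 := ℝ)))
      (fun m => hle m _ (hz m)) fun m => (hzlt m).le
  obtain ⟨v, hv⟩ := cauchySeq_tendsto_of_complete
    (cauchySeq_of_tendsto_energy hp hp_top hanti hconv hR hle hL hz hzL)
  exact ⟨z, v, hz, hv⟩

theorem isClosed_image_closedBall (hp : 1 < p) (hp_top : p ≠ ⊤) {F : Type*} [NormedAddCommGroup F]
    [NormedSpace ℝ F] (T : Control d p →L[ℝ] F) (R : ℝ) :
    IsClosed (T '' Metric.closedBall 0 R) := by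
  refine isClosed_of_closure_subset fun y hy => ?_
  set K : ℕ → Set (Control d p) := fun m =>
    Metric.closedBall 0 R ∩ T ⁻¹' Metric.closedBall y (1 / ((m : ℝ) + 1))
  have hne (m : ℕ) : (K m).Nonempty := by
    obtain ⟨_, ⟨u, hu, rfl⟩, hdist⟩ :=
      Metric.mem_closure_iff.1 hy (1 / ((m : ℝ) + 1)) (by positivity)
    exact ⟨u, hu, by simpa [dist_comm] using hdist.le⟩
  obtain ⟨z, v, hz, hzv⟩ := exists_tendsto_mem_of_antitone_convex hp hp_top (K := K) (R := R)
    (fun m m' h => inter_subset_inter_right _ (preimage_mono (Metric.closedBall_subset_closedBall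
      (by gcongr))))
    (fun m => (convex_closedBall _ _).inter
      ((convex_closedBall y _).linear_preimage T.toLinearMap))
    hne (fun m => inter_subset_left)
  refine ⟨v, Metric.isClosed_closedBall.mem_of_tendsto hzv (.of_forall fun m => (hz m).1), ?_⟩
  refine tendsto_nhds_unique ((T.continuous.tendsto v).comp hzv) ?_
  exact tendsto_iff_dist_tendsto_zero.2 (squeeze_zero (fun _ => dist_nonneg)
    (fun m => Metric.mem_closedBall.1 (hz m).2) tendsto_one_div_add_atTop_nhds_zero_nat)

variable {ι : Type*} {l : Filter ι} {u u' : ι → Control d p} {v v' : Control d p}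

/-- The primitives of `u i` converge uniformly on `[0, 1]` to the primitive of `v`, along `l`. For
families bounded in `L^p` with `1 < p < ∞` this is weak convergence. -/
def PrimitiveTendsto (l : Filter ι) (u : ι → Control d p) (v : Control d p) : Prop :=
  Tendsto (fun i => primitive (u i)) l (𝓝 (primitive v))

namespace PrimitiveTendsto

theorem of_tendsto (h : Tendsto u l (𝓝 v)) : PrimitiveTendsto l u v :=
  (primitive.continuous.tendsto v).comp h

theorem comp {κ : Type*} {l' : Filter κ} (h : PrimitiveTendsto l u v) {φ : κ → ι}
    (hφ : Tendsto φ l' l) : PrimitiveTendsto l' (fun k => u (φ k)) v :=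
  Filter.Tendsto.comp (g := fun i => primitive (u i)) h hφ

theorem sub (h : PrimitiveTendsto l u v) (h' : PrimitiveTendsto l u' v') :
    PrimitiveTendsto l (fun i => u i - u' i) (v - v') := by
  simpa only [PrimitiveTendsto, map_sub] using Filter.Tendsto.sub h h'

theorem add (h : PrimitiveTendsto l u v) (h' : PrimitiveTendsto l u' v') :
    PrimitiveTendsto l (fun i => u i + u' i) (v + v') := by
  simpa only [PrimitiveTendsto, map_add] using Filter.Tendsto.add h h'

theorem const_smul (h : PrimitiveTendsto l u v) (c : ℝ) :
    PrimitiveTendsto l (fun i => c • u i) (c • v) := by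
  simpa only [PrimitiveTendsto, map_smul] using Filter.Tendsto.const_smul h c

theorem eventually_norm_integral_le (h : PrimitiveTendsto l u v) {ε : ℝ} (hε : 0 < ε) :
    ∀ᶠ i in l, ∀ t ∈ Icc (0 : ℝ) 1, ‖∫ s in (0 : ℝ)..t, (u i - v) s‖ ≤ ε := by
  filter_upwards [(tendsto_iff_norm_sub_tendsto_zero.1 h).eventually (gt_mem_nhds hε)]
    with i hi t ht
  rw [← map_sub] at hi
  exact ((primitive (u i - v)).norm_coe_le_norm ⟨t, ht⟩).trans hi.le

end PrimitiveTendsto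

theorem exists_subseq_primitiveTendsto (hp : 1 < p) (hp_top : p ≠ ⊤) {u : ℕ → Control d p} {R : ℝ}
    (hu : ∀ k, ‖u k‖ ≤ R) :
    ∃ (v : Control d p) (φ : ℕ → ℕ), StrictMono φ ∧
      PrimitiveTendsto atTop (fun k => u (φ k)) v := by
  have hcpt := isCompact_closure_primitive_image_closedBall (d := d) hp hp_top R
  rw [(isClosed_image_closedBall hp hp_top primitive R).closure_eq] at hcpt
  obtain ⟨_, ⟨v, -, rfl⟩, φ, hφ, hlim⟩ := hcpt.tendsto_subseq (x := fun k => primitive (u k))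
    fun k => mem_image_of_mem _ (mem_closedBall_zero_iff.2 (hu k))
  exact ⟨v, φ, hφ, hlim⟩

end WeakConvergence

section AbsoluteContinuity

theorem absolutelyContinuous_of_dist_le {X Y : Type*} [PseudoMetricSpace X] [PseudoMetricSpace Y]
    {f : ℝ → X} {g : ℝ → Y} {a b C : ℝ} (hg : AbsolutelyContinuousOnInterval g a b)
    (h : ∀ s ∈ uIcc a b, ∀ t ∈ uIcc a b, dist (f s) (f t) ≤ C * dist (g s) (g t)) :
    AbsolutelyContinuousOnInterval f a b := by
  have hlim := Filter.Tendsto.const_mul C hg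
  rw [mul_zero] at hlim
  refine squeeze_zero' (.of_forall fun _ => Finset.sum_nonneg fun _ _ => dist_nonneg) ?_ hlim
  filter_upwards [mem_inf_of_right (mem_principal_self _)] with I hI
  rw [Finset.mul_sum]
  exact Finset.sum_le_sum fun i hi => h _ (hI.1 i hi).1 _ (hI.1 i hi).2

theorem intervalIntegrable_of_mem_Icc {E : Type*} [NormedAddCommGroup E] {f : ℝ → E} {a b s t : ℝ}
    (hf : IntervalIntegrable f volume a b) (hs : s ∈ Icc a b) (ht : t ∈ Icc a b) :
    IntervalIntegrable f volume s t :=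
  hf.mono_set (uIcc_of_le (hs.1.trans hs.2) ▸ uIcc_subset_Icc hs ht)

variable {E : Type*} [NormedAddCommGroup E] [NormedSpace ℝ E]

theorem absolutelyContinuous_integral {g : ℝ → E} {a b : ℝ}
    (hg : IntervalIntegrable g volume a b) :
    AbsolutelyContinuousOnInterval (fun t => ∫ s in a..t, g s) a b := by
  refine absolutelyContinuous_of_dist_le (C := 1)
    (hg.norm.absolutelyContinuousOnInterval_intervalIntegral left_mem_uIcc) ?_
  have hsub : ∀ t ∈ uIcc a b, IntervalIntegrable g volume a t :=
    fun t ht => hg.mono_set (uIcc_subset_uIcc left_mem_uIcc ht)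
  intro s hs t ht
  rw [dist_eq_norm, Real.dist_eq, one_mul,
    intervalIntegral.integral_interval_sub_left (hsub s hs) (hsub t ht),
    intervalIntegral.integral_interval_sub_left (hsub s hs).norm (hsub t ht).norm]
  exact intervalIntegral.norm_integral_le_abs_integral_norm

theorem eq_add_integral_of_absolutelyContinuous [CompleteSpace E] {f g : ℝ → E} {a b : ℝ}
    (hab : a ≤ b) (hf : AbsolutelyContinuousOnInterval f a b)
    (hg : IntervalIntegrable g volume a b)
    (hder : ∀ᵐ t, t ∈ Ioo a b → HasDerivAt f (g t) t) {t : ℝ} (ht : t ∈ Icc a b) :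
    f t = f a + ∫ s in a..t, g s := by
  have hne (c : ℝ) : ∀ᵐ t : ℝ, t ≠ c := by simp [ae_iff, measure_singleton]
  have hzero : ∀ᵐ t, t ∈ uIcc a b → HasDerivAt (f - fun t => ∫ s in a..t, g s) 0 t := by
    filter_upwards [hder, hg.ae_hasDerivAt_integral, hne a, hne b] with t hf' hg' hta htb ht
    have htab : t ∈ Ioo a b := by
      rw [uIcc_of_le hab] at ht
      exact ⟨ht.1.lt_of_ne hta.symm, ht.2.lt_of_ne htb⟩
    simpa using (hf' htab).sub (hg' ht a left_mem_uIcc)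
  obtain ⟨C, hC⟩ := (hf.sub (absolutelyContinuous_integral hg)).const_of_ae_hasDerivAt_zero hzero
  have hCa := hC a left_mem_uIcc
  have hCt := hC t (by rwa [uIcc_of_le hab])
  simp only [Pi.sub_apply, intervalIntegral.integral_same, sub_zero] at hCa hCt
  rw [hCa, ← hCt, sub_add_cancel]

end AbsoluteContinuity

section IntegralsAgainstKernels

variable {E F : Type*} [NormedAddCommGroup E] [NormedSpace ℝ E] [NormedAddCommGroup F]
  [NormedSpace ℝ F] {A : ℝ → E →L[ℝ] F} {h : ℝ → E} {a b : ℝ}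

theorem intervalIntegrable_clm_apply (hab : a ≤ b) (hA : ContinuousOn A (Icc a b))
    (hh : IntervalIntegrable h volume a b) :
    IntervalIntegrable (fun s => A s (h s)) volume a b := by
  obtain ⟨C, hC⟩ := isCompact_Icc.exists_bound_of_continuousOn hA
  rw [intervalIntegrable_iff_integrableOn_Icc_of_le hab] at hh ⊢
  refine Integrable.mono' (g := fun s => C * ‖h s‖) (hh.norm.const_mul C) ?_ ?_
  · exact (ContinuousLinearMap.id ℝ (E →L[ℝ] F)).aestronglyMeasurable_comp₂
      (hA.aestronglyMeasurable_of_isCompact isCompact_Icc measurableSet_Icc) hh.1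
  · filter_upwards [ae_restrict_mem measurableSet_Icc] with s hs
    exact (A s).le_of_opNorm_le (hC s hs) _

theorem norm_integral_clm_apply_le {C t : ℝ} (hA : ∀ s ∈ Icc a b, ‖A s‖ ≤ C)
    (hh : IntervalIntegrable h volume a b) (ht : t ∈ Icc a b) :
    ‖∫ s in a..t, A s (h s)‖ ≤ C * ∫ s in a..b, ‖h s‖ := by
  have haI : a ∈ Icc a b := left_mem_Icc.2 (ht.1.trans ht.2)
  have hC : 0 ≤ C := (norm_nonneg _).trans (hA a haI)
  calc ‖∫ s in a..t, A s (h s)‖ ≤ ∫ s in a..t, C * ‖h s‖ :=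
        intervalIntegral.norm_integral_le_of_norm_le ht.1 (ae_of_all _ fun s hs =>
          (A s).le_of_opNorm_le (hA s ⟨hs.1.le, hs.2.trans ht.2⟩) _)
          (intervalIntegrable_of_mem_Icc (hh.norm.const_mul C) haI ht)
    _ = C * ∫ s in a..t, ‖h s‖ := intervalIntegral.integral_const_mul _ _
    _ ≤ C * ∫ s in a..b, ‖h s‖ := by
        gcongr
        exact intervalIntegral.integral_mono_interval le_rfl ht.1 ht.2
          (ae_of_all _ fun s => norm_nonneg _) hh.norm

variable [CompleteSpace E] [CompleteSpace F]

theorem norm_integral_clm_apply_le_of_norm_sub_le {η : ℝ} (hab : a ≤ b)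
    (hA : ContinuousOn A (Icc a b)) (hh : IntervalIntegrable h volume a b)
    (hη : ∀ s ∈ Icc a b, ‖A s - A a‖ ≤ η) :
    ‖∫ s in a..b, A s (h s)‖ ≤ η * (∫ s in a..b, ‖h s‖) + ‖A a‖ * ‖∫ s in a..b, h s‖ := by
  have hsplit : ∫ s in a..b, A s (h s) =
      (∫ s in a..b, (A s - A a) (h s)) + A a (∫ s in a..b, h s) := by
    have hosc : IntervalIntegrable (fun s => (A s - A a) (h s)) volume a b :=
      intervalIntegrable_clm_apply hab (hA.sub continuousOn_const) hh
    have hconst : IntervalIntegrable (fun s => A a (h s)) volume a b :=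
      intervalIntegrable_clm_apply hab continuousOn_const hh
    rw [← ContinuousLinearMap.intervalIntegral_comp_comm _ hh,
      ← intervalIntegral.integral_add hosc hconst]
    simp only [_root_.sub_apply, sub_add_cancel]
  rw [hsplit]
  refine (norm_add_le _ _).trans (add_le_add ?_ ((A a).le_opNorm _))
  rw [← intervalIntegral.integral_const_mul]
  exact intervalIntegral.norm_integral_le_of_norm_le hab (ae_of_all _ fun s hs =>
    (A s - A a).le_of_opNorm_le (hη s ⟨hs.1.le, hs.2⟩) _) (hh.norm.const_mul η)

theorem norm_integral_clm_apply_le_of_uniform {η δ κ C : ℝ} (hδ : 0 ≤ δ)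
    (hA : ContinuousOn A (Icc a b)) (hC : ∀ s ∈ Icc a b, ‖A s‖ ≤ C)
    (hη : ∀ s ∈ Icc a b, ∀ c ∈ Icc a b, |s - c| ≤ δ → ‖A s - A c‖ ≤ η)
    (hh : IntervalIntegrable h volume a b) (hκ : ∀ t ∈ Icc a b, ‖∫ s in a..t, h s‖ ≤ κ) (j : ℕ) :
    ∀ t ∈ Icc a b, t ≤ a + j * δ →
      ‖∫ s in a..t, A s (h s)‖ ≤ η * (∫ s in a..t, ‖h s‖) + j * (C * (2 * κ)) := by
  induction j with
  | zero =>
    intro t ht htj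
    obtain rfl : t = a := le_antisymm (by simpa using htj) ht.1
    simp
  | succ j ih =>
    intro t ht htj
    push_cast at htj ⊢
    have haI : a ∈ Icc a b := left_mem_Icc.2 (ht.1.trans ht.2)
    set c := min t (a + j * δ)
    have hct : c ≤ t := min_le_left _ _
    have hcI : c ∈ Icc a b :=
      ⟨le_min ht.1 (le_add_of_nonneg_right (by positivity)), hct.trans ht.2⟩
    have htc : t - c ≤ δ := by
      rcases min_choice t (a + j * δ) with hc | hc <;> simp only [c, hc] <;> linarith
    have hIcc : Icc c t ⊆ Icc a b := Icc_subset_Icc hcI.1 ht.2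
    have hAh := intervalIntegrable_clm_apply (ht.1.trans ht.2) hA hh
    have hhac := intervalIntegrable_of_mem_Icc hh haI hcI
    have hhct := intervalIntegrable_of_mem_Icc hh hcI ht
    have hlast : ‖∫ s in c..t, A s (h s)‖ ≤ η * (∫ s in c..t, ‖h s‖) + C * (2 * κ) := by
      have hint : ‖∫ s in c..t, h s‖ ≤ 2 * κ := by
        rw [← intervalIntegral.integral_interval_sub_left
          (intervalIntegrable_of_mem_Icc hh haI ht) hhac]
        linarith [norm_sub_le (∫ s in a..t, h s) (∫ s in a..c, h s), hκ t ht, hκ c hcI]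
      refine (norm_integral_clm_apply_le_of_norm_sub_le hct (hA.mono hIcc) hhct fun s hs =>
        hη s (hIcc hs) c hcI ?_).trans ?_
      · rw [abs_of_nonneg (sub_nonneg.2 hs.1)]
        exact (sub_le_sub_right hs.2 c).trans htc
      · gcongr
        · exact (norm_nonneg _).trans (hC c hcI)
        · exact hC c hcI
    rw [← intervalIntegral.integral_add_adjacent_intervals
        (intervalIntegrable_of_mem_Icc hAh haI hcI) (intervalIntegrable_of_mem_Icc hAh hcI ht),
      ← intervalIntegral.integral_add_adjacent_intervals hhac.norm hhct.norm]
    linarith [norm_add_le (∫ s in a..c, A s (h s)) (∫ s in c..t, A s (h s)),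
      ih c hcI (min_le_right _ _)]

theorem exists_norm_integral_clm_apply_le (hab : a ≤ b) (hA : ContinuousOn A (Icc a b))
    {ε R : ℝ} (hε : 0 < ε) (hR : 0 ≤ R) :
    ∃ κ > 0, ∀ h : ℝ → E, IntervalIntegrable h volume a b → ∫ s in a..b, ‖h s‖ ≤ R →
      (∀ t ∈ Icc a b, ‖∫ s in a..t, h s‖ ≤ κ) → ∀ t ∈ Icc a b, ‖∫ s in a..t, A s (h s)‖ ≤ ε := by
  obtain ⟨C, hC⟩ := isCompact_Icc.exists_bound_of_continuousOn hA
  have hC0 : 0 ≤ C := (norm_nonneg _).trans (hC a (left_mem_Icc.2 hab))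
  obtain ⟨δ, hδ, hunif⟩ := Metric.uniformContinuousOn_iff_le.1
    (isCompact_Icc.uniformContinuousOn_of_continuous hA) (ε / (2 * (R + 1))) (by positivity)
  simp only [dist_eq_norm] at hunif
  obtain ⟨N, hN⟩ := exists_nat_gt ((b - a) / δ)
  refine ⟨ε / (4 * (N + 1) * (C + 1)), by positivity, fun h hh hnorm hprim t ht => ?_⟩
  have htN : t ≤ a + N * δ := by linarith [ht.2, (div_lt_iff₀ hδ).1 hN]
  refine (norm_integral_clm_apply_le_of_uniform hδ.le hA hC hunif hh hprim N t ht htN).trans ?_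
  have hle : ∫ s in a..t, ‖h s‖ ≤ R := (intervalIntegral.integral_mono_interval le_rfl ht.1 ht.2
    (ae_of_all _ fun s => norm_nonneg _) hh.norm).trans hnorm
  have hosc : ε / (2 * (R + 1)) * (∫ s in a..t, ‖h s‖) ≤ ε / 2 := by
    calc ε / (2 * (R + 1)) * (∫ s in a..t, ‖h s‖) ≤ ε / (2 * (R + 1)) * (R + 1) := by
          gcongr; linarith
      _ = ε / 2 := by field_simp
  have hsteps : N * (C * (2 * (ε / (4 * (N + 1) * (C + 1))))) ≤ ε / 2 := by
    calc N * (C * (2 * (ε / (4 * (N + 1) * (C + 1)))))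
        ≤ (N + 1) * ((C + 1) * (2 * (ε / (4 * (N + 1) * (C + 1))))) := by gcongr <;> linarith
      _ = ε / 2 := by field_simp; ring
  linarith

end IntegralsAgainstKernels

section SecondOrder

variable {E F : Type*} [NormedAddCommGroup E] [NormedSpace ℝ E] [NormedAddCommGroup F]
  [NormedSpace ℝ F] {g : E → F} {g' : E → E →L[ℝ] F} {K : Set E}

theorem norm_sub_sub_fderiv_le_of_lipschitzOnWith {C : NNReal} (hK : Convex ℝ K)
    (hg : ∀ x ∈ K, HasFDerivWithinAt g (g' x) K x) (hg' : LipschitzOnWith C g' K) {x y : E}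
    (hx : x ∈ K) (hy : y ∈ K) : ‖g y - g x - g' x (y - x)‖ ≤ C * ‖y - x‖ ^ 2 := by
  have hseg : segment ℝ x y ⊆ K := hK.segment_subset hx hy
  have hbound : ∀ w ∈ segment ℝ x y, ‖g' w - g' x‖ ≤ C * ‖y - x‖ := fun w hw => by
    have hdist := hg'.dist_le_mul w (hseg hw) x hx
    rw [dist_eq_norm, dist_eq_norm] at hdist
    refine hdist.trans ?_
    gcongr
    rw [segment_eq_image'] at hw
    obtain ⟨θ, hθ, rfl⟩ := hw
    rw [add_sub_cancel_left, norm_smul, Real.norm_of_nonneg hθ.1]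
    exact mul_le_of_le_one_left (norm_nonneg _) hθ.2
  refine ((convex_segment x y).norm_image_sub_le_of_norm_hasFDerivWithin_le'
    (fun w hw => (hg w (hseg hw)).mono hseg) hbound
    (left_mem_segment ℝ x y) (right_mem_segment ℝ x y)).trans_eq (by ring)

theorem norm_second_difference_le_of_lipschitzOnWith {L : ℝ} {C : NNReal} (hK : Convex ℝ K)
    (hg : ∀ x ∈ K, HasFDerivWithinAt g (g' x) K x) (hg' : LipschitzOnWith C g' K)
    (hL : ∀ x ∈ K, ‖g' x‖ ≤ L) {x y z : E} (hx : x ∈ K) (hy : y ∈ K) (hz : z ∈ K) :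
    ‖g z - (2 : ℝ) • g y + g x‖ ≤
      L * ‖z - (2 : ℝ) • y + x‖ + C * (‖z - y‖ + ‖y - x‖) ^ 2 := by
  have hsplit : g z - (2 : ℝ) • g y + g x =
      (g z - g y - g' y (z - y)) + (g x - g y - g' y (x - y)) + g' y (z - (2 : ℝ) • y + x) := by
    rw [show z - (2 : ℝ) • y + x = (z - y) + (x - y) by module, map_add]; module
  have hzy := norm_sub_sub_fderiv_le_of_lipschitzOnWith hK hg hg' hy hz
  have hxy := norm_sub_sub_fderiv_le_of_lipschitzOnWith hK hg hg' hy hx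
  rw [norm_sub_rev x y] at hxy
  have hsq : C * ‖z - y‖ ^ 2 + C * ‖y - x‖ ^ 2 ≤ C * (‖z - y‖ + ‖y - x‖) ^ 2 := by
    rw [← mul_add]
    gcongr
    nlinarith [mul_nonneg (norm_nonneg (z - y)) (norm_nonneg (y - x))]
  rw [hsplit]
  linarith [norm_add₃_le (a := g z - g y - g' y (z - y)) (b := g x - g y - g' y (x - y))
    (c := g' y (z - (2 : ℝ) • y + x)), (g' y).le_of_opNorm_le (hL y hy) (z - (2 : ℝ) • y + x)]

/-- `g` is bounded and Lipschitz on `K`, and its second differences are controlled by those of the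
argument and by the square of its first differences, all with constant `L`. -/
structure SecondOrderBounded (g : E → F) (K : Set E) (L : ℝ) : Prop where
  bound : ∀ x ∈ K, ‖g x‖ ≤ L
  lipschitz : ∀ x ∈ K, ∀ y ∈ K, ‖g x - g y‖ ≤ L * ‖x - y‖
  second : ∀ x ∈ K, ∀ y ∈ K, ∀ z ∈ K, ‖g z - (2 : ℝ) • g y + g x‖ ≤
    L * (‖z - (2 : ℝ) • y + x‖ + (‖z - y‖ + ‖y - x‖) ^ 2)

theorem SecondOrderBounded.continuousOn {L : ℝ} (h : SecondOrderBounded g K L) :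
    ContinuousOn g K := by
  rcases K.eq_empty_or_nonempty with rfl | ⟨x, hx⟩
  · exact continuousOn_empty g
  · have hL : 0 ≤ L := (norm_nonneg _).trans (h.bound x hx)
    refine (LipschitzOnWith.of_dist_le_mul (K := ⟨L, hL⟩) fun x hx y hy => ?_).continuousOn
    rw [dist_eq_norm, dist_eq_norm]
    exact h.lipschitz x hx y hy

theorem exists_secondOrderBounded_closedBall [FiniteDimensional ℝ E] {U : Set E} (hU : IsOpen U)
    (hg : ContDiffOn ℝ 2 g U) {z : E} {r : ℝ} (hr : Metric.closedBall z r ⊆ U) :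
    ∃ L, 0 ≤ L ∧ SecondOrderBounded g (Metric.closedBall z r) L := by
  set K := Metric.closedBall z r
  have hcpt : IsCompact K := isCompact_closedBall z r
  have hcv : Convex ℝ K := convex_closedBall z r
  have hdg : ContDiffOn ℝ 1 (fderiv ℝ g) U := hg.fderiv_of_isOpen hU (by norm_num)
  have hder : ∀ x ∈ K, HasFDerivWithinAt g (fderiv ℝ g x) K x := fun x hx =>
    ((hg.contDiffAt (hU.mem_nhds (hr hx))).differentiableAt
      (by norm_num)).hasFDerivAt.hasFDerivWithinAt
  obtain ⟨L₀, hL₀⟩ := hcpt.exists_bound_of_continuousOn (hg.continuousOn.mono hr)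
  obtain ⟨L₁, hL₁⟩ := hcpt.exists_bound_of_continuousOn (hdg.continuousOn.mono hr)
  obtain ⟨L₂, hL₂⟩ := (hdg.mono hr).exists_lipschitzOnWith one_ne_zero hcv hcpt
  have hL₁L : L₁ ≤ max L₀ (max L₁ L₂) := (le_max_left _ _).trans (le_max_right _ _)
  have hL₂L : (L₂ : ℝ) ≤ max L₀ (max L₁ L₂) := (le_max_right _ _).trans (le_max_right _ _)
  refine ⟨max L₀ (max L₁ L₂), L₂.2.trans hL₂L, fun x hx => (hL₀ x hx).trans (le_max_left _ _),
    fun x hx y hy => ?_, fun x hx y hy w hw => ?_⟩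
  · exact (hcv.norm_image_sub_le_of_norm_hasFDerivWithin_le hder hL₁ hy hx).trans (by gcongr)
  · refine (norm_second_difference_le_of_lipschitzOnWith hcv hder hL₂ hL₁ hx hy hw).trans ?_
    rw [mul_add]
    gcongr

end SecondOrder

section IntegralEquation

theorem le_two_mul_of_le_add_integral {e m : ℝ → ℝ} {a b A : ℝ}
    (he : ContinuousOn e (Icc a b)) (he0 : ∀ t, 0 ≤ e t) (hm0 : ∀ t, 0 ≤ m t)
    (hm : IntervalIntegrable m volume a b) (hm1 : ∫ s in a..b, m s ≤ 1 / 2)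
    (h : ∀ t ∈ Icc a b, e t ≤ A + ∫ s in a..t, m s * e s) {t : ℝ} (ht : t ∈ Icc a b) :
    e t ≤ 2 * A := by
  obtain ⟨t₀, ht₀, hmax⟩ := isCompact_Icc.exists_isMaxOn ⟨t, ht⟩ he
  have hm' := intervalIntegrable_of_mem_Icc hm (left_mem_Icc.2 (ht.1.trans ht.2)) ht₀
  have hsubset : Icc a t₀ ⊆ Icc a b := Icc_subset_Icc le_rfl ht₀.2
  have hint : ∫ s in a..t₀, m s * e s ≤ (∫ s in a..t₀, m s) * e t₀ := by
    rw [← intervalIntegral.integral_mul_const]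
    refine intervalIntegral.integral_mono_on ht₀.1
      (hm'.mul_continuousOn (he.mono (by rwa [uIcc_of_le ht₀.1]))) (hm'.mul_const _) fun s hs => ?_
    exact mul_le_mul_of_nonneg_left (hmax (hsubset hs)) (hm0 s)
  have hhalf : ∫ s in a..t₀, m s ≤ 1 / 2 :=
    (intervalIntegral.integral_mono_interval le_rfl ht₀.1 ht₀.2 (ae_of_all _ hm0) hm).trans hm1
  exact (hmax ht).trans (by nlinarith [he0 t₀, h t₀ ht₀])

variable {E W : Type*} [NormedAddCommGroup E] [NormedSpace ℝ E] [NormedAddCommGroup W]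
  [NormedSpace ℝ W]

/-- `ξ` solves `ξ' = B(ξ) u` on `[a, b]`, in integral form. -/
structure SolvesOn (B : E → W →L[ℝ] E) (u : ℝ → W) (a b : ℝ) (ξ : ℝ → E) : Prop where
  continuousOn : ContinuousOn ξ (Icc a b)
  eq : ∀ t ∈ Icc a b, ξ t = ξ a + ∫ s in a..t, B (ξ s) (u s)

variable {B : E → W →L[ℝ] E} {K : Set E} {L a b t : ℝ} {u v : ℝ → W} {ξ ζ : ℝ → E}

theorem SolvesOn.intervalIntegrable (hB : ContinuousOn B K) (h : SolvesOn B u a b ξ)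
    (hK : ∀ t ∈ Icc a b, ξ t ∈ K) (hv : IntervalIntegrable v volume a b) (ht : t ∈ Icc a b) :
    IntervalIntegrable (fun s => B (ξ s) (v s)) volume a t :=
  have hab : a ≤ b := ht.1.trans ht.2
  intervalIntegrable_of_mem_Icc (intervalIntegrable_clm_apply hab (hB.comp h.continuousOn hK) hv)
    (left_mem_Icc.2 hab) ht

theorem SolvesOn.norm_sub_le (hab : a ≤ b) (hB : ∀ x ∈ K, ‖B x‖ ≤ L) (h : SolvesOn B u a b ξ)
    (hK : ∀ t ∈ Icc a b, ξ t ∈ K) (hu : IntervalIntegrable u volume a b) :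
    ‖ξ b - ξ a‖ ≤ L * ∫ s in a..b, ‖u s‖ := by
  rw [h.eq b (right_mem_Icc.2 hab), add_sub_cancel_left]
  exact norm_integral_clm_apply_le (fun s hs => hB _ (hK s hs)) hu (right_mem_Icc.2 hab)

theorem SolvesOn.sub_eq (hB : ContinuousOn B K) (hξ : SolvesOn B u a b ξ)
    (hζ : SolvesOn B v a b ζ) (hξK : ∀ t ∈ Icc a b, ξ t ∈ K) (hζK : ∀ t ∈ Icc a b, ζ t ∈ K)
    (hu : IntervalIntegrable u volume a b) (hv : IntervalIntegrable v volume a b)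
    (ht : t ∈ Icc a b) :
    ζ t - ξ t = (ζ a - ξ a) + (∫ s in a..t, (B (ζ s) - B (ξ s)) (v s)) +
      ∫ s in a..t, B (ξ s) (v s - u s) := by
  have hξv := hξ.intervalIntegrable hB hξK hv ht
  simp only [map_sub, _root_.sub_apply]
  rw [hζ.eq t ht, hξ.eq t ht,
    intervalIntegral.integral_sub (hζ.intervalIntegrable hB hζK hv ht) hξv,
    intervalIntegral.integral_sub hξv (hξ.intervalIntegrable hB hξK hu ht)]
  abel

theorem SolvesOn.norm_sub_le_of_integral_le {η : ℝ} (hB : SecondOrderBounded B K L)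
    (hξ : SolvesOn B u a b ξ) (hζ : SolvesOn B v a b ζ) (hξK : ∀ t ∈ Icc a b, ξ t ∈ K)
    (hζK : ∀ t ∈ Icc a b, ζ t ∈ K) (hu : IntervalIntegrable u volume a b)
    (hv : IntervalIntegrable v volume a b) (hsmall : L * ∫ s in a..b, ‖v s‖ ≤ 1 / 2)
    (hη : ∀ t ∈ Icc a b, ‖∫ s in a..t, B (ξ s) (v s - u s)‖ ≤ η) (ht : t ∈ Icc a b) :
    ‖ζ t - ξ t‖ ≤ 2 * (‖ζ a - ξ a‖ + η) := by
  have hdiff : ContinuousOn (fun t => ‖ζ t - ξ t‖) (Icc a b) :=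
    (hζ.continuousOn.sub hξ.continuousOn).norm
  have haI : a ∈ Icc a b := left_mem_Icc.2 (ht.1.trans ht.2)
  have hL : 0 ≤ L := (norm_nonneg _).trans (hB.bound _ (hξK a haI))
  refine le_two_mul_of_le_add_integral (m := fun s => L * ‖v s‖) hdiff (fun t => norm_nonneg _)
    (fun t => by positivity) (hv.norm.const_mul L)
    (by rwa [intervalIntegral.integral_const_mul]) (fun t ht => ?_) ht
  have hint : IntervalIntegrable (fun s => L * ‖v s‖ * ‖ζ s - ξ s‖) volume a t :=
    (intervalIntegrable_of_mem_Icc (hv.norm.const_mul L) haI ht).mul_continuousOn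
      (hdiff.mono (by rw [uIcc_of_le ht.1]; exact Icc_subset_Icc le_rfl ht.2))
  have hlip : ‖∫ s in a..t, (B (ζ s) - B (ξ s)) (v s)‖ ≤
      ∫ s in a..t, L * ‖v s‖ * ‖ζ s - ξ s‖ := by
    refine intervalIntegral.norm_integral_le_of_norm_le ht.1 (ae_of_all _ fun s hs => ?_) hint
    have hs' : s ∈ Icc a b := ⟨hs.1.le, hs.2.trans ht.2⟩
    exact ((B (ζ s) - B (ξ s)).le_of_opNorm_le
      (hB.lipschitz _ (hζK s hs') _ (hξK s hs')) _).trans_eq (by ring)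
  rw [hξ.sub_eq hB.continuousOn hζ hξK hζK hu hv ht]
  linarith [hη t ht, norm_add₃_le (a := ζ a - ξ a) (b := ∫ s in a..t, (B (ζ s) - B (ξ s)) (v s))
    (c := ∫ s in a..t, B (ξ s) (v s - u s))]

theorem SecondOrderBounded.norm_apply_second_difference_le (hB : SecondOrderBounded B K L)
    {x y z : E} (hx : x ∈ K) (hy : y ∈ K) (hz : z ∈ K) {D : ℝ} (hxy : ‖y - x‖ ≤ D)
    (hyz : ‖z - y‖ ≤ D) (v w : W) :
    ‖B z (v + w) - (2 : ℝ) • B y v + B x (v - w)‖ ≤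
      L * ‖v‖ * ‖z - (2 : ℝ) • y + x‖ + (4 * D ^ 2 * (L * ‖v‖) + 2 * L * D * ‖w‖) := by
  have hL : 0 ≤ L := (norm_nonneg _).trans (hB.bound x hx)
  have hsplit : B z (v + w) - (2 : ℝ) • B y v + B x (v - w) =
      (B z - (2 : ℝ) • B y + B x) v + (B z - B x) w := by
    simp only [_root_.add_apply, _root_.sub_apply, _root_.smul_apply, map_add, map_sub]
    module
  have hsum : ‖z - y‖ + ‖y - x‖ ≤ 2 * D := by linarith
  have hsecond : ‖B z - (2 : ℝ) • B y + B x‖ ≤ L * (‖z - (2 : ℝ) • y + x‖ + (2 * D) ^ 2) :=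
    (hB.second _ hx _ hy _ hz).trans (by gcongr)
  have hfirst : ‖B z - B x‖ ≤ L * (2 * D) := by
    refine (hB.lipschitz _ hz _ hx).trans ?_
    gcongr
    exact (norm_sub_le_norm_sub_add_norm_sub z y x).trans hsum
  rw [hsplit]
  refine (norm_add_le _ _).trans ((add_le_add (ContinuousLinearMap.le_of_opNorm_le _ hsecond v)
    (ContinuousLinearMap.le_of_opNorm_le _ hfirst w)).trans_eq ?_)
  ring

variable {u₀ u₁ u₂ : ℝ → W} {ξ₀ ξ₁ ξ₂ : ℝ → E}

theorem SolvesOn.second_difference_eq (hB : ContinuousOn B K) (h₀ : SolvesOn B u₀ a b ξ₀)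
    (h₁ : SolvesOn B u₁ a b ξ₁) (h₂ : SolvesOn B u₂ a b ξ₂) (hK₀ : ∀ t ∈ Icc a b, ξ₀ t ∈ K)
    (hK₁ : ∀ t ∈ Icc a b, ξ₁ t ∈ K) (hK₂ : ∀ t ∈ Icc a b, ξ₂ t ∈ K)
    (hu₀ : IntervalIntegrable u₀ volume a b) (hu₁ : IntervalIntegrable u₁ volume a b)
    (hu₂ : IntervalIntegrable u₂ volume a b) (ht : t ∈ Icc a b) :
    ξ₂ t - (2 : ℝ) • ξ₁ t + ξ₀ t = (ξ₂ a - (2 : ℝ) • ξ₁ a + ξ₀ a) +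
      ∫ s in a..t, (B (ξ₂ s) (u₂ s) - (2 : ℝ) • B (ξ₁ s) (u₁ s) + B (ξ₀ s) (u₀ s)) := by
  have hint₁ : IntervalIntegrable (fun s => (2 : ℝ) • B (ξ₁ s) (u₁ s)) volume a t :=
    (h₁.intervalIntegrable hB hK₁ hu₁ ht).smul (2 : ℝ)
  have hint₂ := h₂.intervalIntegrable hB hK₂ hu₂ ht
  have hint₂₁ : IntervalIntegrable (fun s => B (ξ₂ s) (u₂ s) - (2 : ℝ) • B (ξ₁ s) (u₁ s))
    volume a t := hint₂.sub hint₁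
  rw [intervalIntegral.integral_add hint₂₁ (h₀.intervalIntegrable hB hK₀ hu₀ ht),
    intervalIntegral.integral_sub hint₂ hint₁, intervalIntegral.integral_smul,
    h₂.eq t ht, h₁.eq t ht, h₀.eq t ht]
  module

theorem SolvesOn.norm_second_difference_le {D : ℝ} (hab : a ≤ b)
    (hB : SecondOrderBounded B K L) (h₀ : SolvesOn B u₀ a b ξ₀)
    (h₁ : SolvesOn B u₁ a b ξ₁) (h₂ : SolvesOn B u₂ a b ξ₂) (hK₀ : ∀ t ∈ Icc a b, ξ₀ t ∈ K)
    (hK₁ : ∀ t ∈ Icc a b, ξ₁ t ∈ K) (hK₂ : ∀ t ∈ Icc a b, ξ₂ t ∈ K)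
    (hu₀ : IntervalIntegrable u₀ volume a b) (hu₁ : IntervalIntegrable u₁ volume a b)
    (hu₂ : IntervalIntegrable u₂ volume a b)
    (hu : ∀ᵐ s, s ∈ uIoc a b → u₁ s - u₀ s = u₂ s - u₁ s)
    (hsmall : L * ∫ s in a..b, ‖u₁ s‖ ≤ 1 / 2)
    (hD : ∀ t ∈ Icc a b, ‖ξ₁ t - ξ₀ t‖ ≤ D) (hD' : ∀ t ∈ Icc a b, ‖ξ₂ t - ξ₁ t‖ ≤ D) :
    ‖ξ₂ b - (2 : ℝ) • ξ₁ b + ξ₀ b‖ ≤ 2 * (‖ξ₂ a - (2 : ℝ) • ξ₁ a + ξ₀ a‖ +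
      (2 * D ^ 2 + 2 * L * D * ∫ s in a..b, ‖u₂ s - u₁ s‖)) := by
  have haI : a ∈ Icc a b := left_mem_Icc.2 hab
  have hL : 0 ≤ L := (norm_nonneg _).trans (hB.bound _ (hK₀ a haI))
  have hD0 : 0 ≤ D := (norm_nonneg _).trans (hD a haI)
  have hcont : ContinuousOn (fun t => ‖ξ₂ t - (2 : ℝ) • ξ₁ t + ξ₀ t‖) (Icc a b) :=
    ((h₂.continuousOn.sub (h₁.continuousOn.const_smul 2)).add h₀.continuousOn).norm
  have hv := hu₁.norm.const_mul L
  refine le_two_mul_of_le_add_integral (m := fun s => L * ‖u₁ s‖) hcont (fun t => norm_nonneg _)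
    (fun t => by positivity) hv (by rwa [intervalIntegral.integral_const_mul]) (fun t ht => ?_)
    (right_mem_Icc.2 hab)
  set q : ℝ → ℝ := fun s => 4 * D ^ 2 * (L * ‖u₁ s‖) + 2 * L * D * ‖u₂ s - u₁ s‖
  have hlin : IntervalIntegrable (fun s => L * ‖u₁ s‖ * ‖ξ₂ s - (2 : ℝ) • ξ₁ s + ξ₀ s‖)
      volume a t := (intervalIntegrable_of_mem_Icc hv haI ht).mul_continuousOn
    (hcont.mono (by rw [uIcc_of_le ht.1]; exact Icc_subset_Icc le_rfl ht.2))
  have hq : IntervalIntegrable q volume a b :=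
    (hv.const_mul _).add ((hu₂.sub hu₁).norm.const_mul _)
  have hqt := intervalIntegrable_of_mem_Icc hq haI ht
  have hqle : ∫ s in a..t, q s ≤ 2 * D ^ 2 + 2 * L * D * ∫ s in a..b, ‖u₂ s - u₁ s‖ := by
    refine (intervalIntegral.integral_mono_interval le_rfl ht.1 ht.2
      (ae_of_all _ fun s => by positivity) hq).trans ?_
    rw [intervalIntegral.integral_add (hv.const_mul _) ((hu₂.sub hu₁).norm.const_mul _)]
    simp only [intervalIntegral.integral_const_mul]
    nlinarith [sq_nonneg D]
  have hpoint : ‖∫ s in a..t, (B (ξ₂ s) (u₂ s) - (2 : ℝ) • B (ξ₁ s) (u₁ s) + B (ξ₀ s) (u₀ s))‖ ≤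
      ∫ s in a..t, (L * ‖u₁ s‖ * ‖ξ₂ s - (2 : ℝ) • ξ₁ s + ξ₀ s‖ + q s) := by
    refine intervalIntegral.norm_integral_le_of_norm_le ht.1 ?_ (hlin.add hqt)
    filter_upwards [hu] with s hsu hs
    have hs' : s ∈ Ioc a b := ⟨hs.1, hs.2.trans ht.2⟩
    have hsI := Ioc_subset_Icc_self hs'
    have hu₀s : u₀ s = u₁ s - (u₂ s - u₁ s) := by
      rw [← hsu (by rwa [uIoc_of_le hab]), sub_sub_cancel]
    have := hB.norm_apply_second_difference_le (hK₀ s hsI) (hK₁ s hsI) (hK₂ s hsI) (hD s hsI)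
      (hD' s hsI) (u₁ s) (u₂ s - u₁ s)
    rwa [add_sub_cancel, ← hu₀s] at this
  rw [intervalIntegral.integral_add hlin hqt] at hpoint
  rw [h₀.second_difference_eq hB.continuousOn h₁ h₂ hK₀ hK₁ hK₂ hu₀ hu₁ hu₂ ht]
  linarith [norm_add_le (ξ₂ a - (2 : ℝ) • ξ₁ a + ξ₀ a)
    (∫ s in a..t, (B (ξ₂ s) (u₂ s) - (2 : ℝ) • B (ξ₁ s) (u₁ s) + B (ξ₀ s) (u₀ s)))]

end IntegralEquation

section ChartFields

variable {n d : ℕ} {M : Type*} [TopologicalSpace M] [ChartedSpace (EuclideanSpace ℝ (Fin n)) M]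

/-- The part of the domain of the chart at `c` whose coordinates lie in `s`. -/
def chartPreimage (c : M) (s : Set (EuclideanSpace ℝ (Fin n))) : Set M :=
  (chartAt (EuclideanSpace ℝ (Fin n)) c).source ∩ extChartAt (𝓡 n) c ⁻¹' s

theorem chartPreimage_mono {c : M} {s t : Set (EuclideanSpace ℝ (Fin n))} (h : s ⊆ t) :
    chartPreimage c s ⊆ chartPreimage c t :=
  inter_subset_inter_right _ (preimage_mono h)

theorem isOpen_chartPreimage (c : M) {s : Set (EuclideanSpace ℝ (Fin n))} (hs : IsOpen s) :
    IsOpen (chartPreimage c s) := by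
  rw [chartPreimage, ← extChartAt_source (𝓡 n)]
  exact (continuousOn_extChartAt c).isOpen_inter_preimage (isOpen_extChartAt_source c) hs

theorem isClosed_chartPreimage [T2Space M] {c : M} {s : Set (EuclideanSpace ℝ (Fin n))}
    (hs : IsCompact s) (hst : s ⊆ (extChartAt (𝓡 n) c).target) : IsClosed (chartPreimage c s) := by
  rw [chartPreimage, ← extChartAt_source (𝓡 n),
    ← (extChartAt (𝓡 n) c).symm_image_eq_source_inter_preimage hst]
  exact (hs.image_of_continuousOn ((continuousOn_extChartAt_symm c).mono hst)).isClosed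

theorem continuousOn_extChartAt_comp {c : M} {γ : ℝ → M} {s : Set ℝ} (hγ : ContinuousOn γ s)
    (hs : MapsTo γ s (chartAt (EuclideanSpace ℝ (Fin n)) c).source) :
    ContinuousOn (fun t => extChartAt (𝓡 n) c (γ t)) s :=
  (continuousOn_extChartAt c).comp hγ (by rwa [extChartAt_source])

/-- The differential at `q` of the chart at `c`, as an endomorphism of the model space. -/
noncomputable def chartDifferential (c q : M) :
    EuclideanSpace ℝ (Fin n) →L[ℝ] EuclideanSpace ℝ (Fin n) :=
  mfderiv (𝓡 n) 𝓘(ℝ, EuclideanSpace ℝ (Fin n)) (extChartAt (𝓡 n) c) q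

/-- The value at `q` of a vector field, as an element of the model space. -/
def fieldValue (V : (q : M) → TangentSpace (𝓡 n) q) (q : M) : EuclideanSpace ℝ (Fin n) := V q

/-- The velocity `X₀ + ∑ i, v i • X i` of the system at `q`, as an element of the model space. -/
noncomputable def systemVelocity (X₀ : (q : M) → TangentSpace (𝓡 n) q)
    (X : Fin d → (q : M) → TangentSpace (𝓡 n) q) (q : M) (v : EuclideanSpace ℝ (Fin d)) :
    EuclideanSpace ℝ (Fin n) :=
  fieldValue X₀ q + ∑ i, v i • fieldValue (X i) q

/-- The coordinate expression of a vector field in the chart at `c`. -/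
noncomputable def chartField (V : (q : M) → TangentSpace (𝓡 n) q) (c : M)
    (z : EuclideanSpace ℝ (Fin n)) : EuclideanSpace ℝ (Fin n) :=
  chartDifferential c ((extChartAt (𝓡 n) c).symm z) (fieldValue V ((extChartAt (𝓡 n) c).symm z))

/-- The system in the chart at `c`, as a linear function of the extended control `(1, u)`: the
drift `X₀` is the coefficient of the first component. -/
noncomputable def systemField (X₀ : (q : M) → TangentSpace (𝓡 n) q)
    (X : Fin d → (q : M) → TangentSpace (𝓡 n) q) (c : M) (z : EuclideanSpace ℝ (Fin n)) :
    ℝ × EuclideanSpace ℝ (Fin d) →L[ℝ] EuclideanSpace ℝ (Fin n) :=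
  (ContinuousLinearMap.fst ℝ ℝ (EuclideanSpace ℝ (Fin d))).smulRight (chartField X₀ c z) +
    ∑ i, ((EuclideanSpace.proj i : EuclideanSpace ℝ (Fin d) →L[ℝ] ℝ).comp
      (ContinuousLinearMap.snd ℝ ℝ (EuclideanSpace ℝ (Fin d)))).smulRight (chartField (X i) c z)

variable (X₀ : (q : M) → TangentSpace (𝓡 n) q) (X : Fin d → (q : M) → TangentSpace (𝓡 n) q)

theorem chartField_extChartAt (V : (q : M) → TangentSpace (𝓡 n) q) {c q : M}
    (hq : q ∈ (chartAt (EuclideanSpace ℝ (Fin n)) c).source) :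
    chartField V c (extChartAt (𝓡 n) c q) = chartDifferential c q (fieldValue V q) := by
  rw [chartField, (extChartAt (𝓡 n) c).left_inv (by rwa [extChartAt_source])]

theorem systemField_extChartAt {c q : M} (hq : q ∈ (chartAt (EuclideanSpace ℝ (Fin n)) c).source)
    (v : EuclideanSpace ℝ (Fin d)) :
    systemField X₀ X c (extChartAt (𝓡 n) c q) ((1 : ℝ), v) =
      chartDifferential c q (systemVelocity X₀ X q v) := by
  simp only [systemField, systemVelocity, _root_.add_apply, sum_apply,
    ContinuousLinearMap.smulRight_apply, ContinuousLinearMap.comp_apply,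
    ContinuousLinearMap.coe_fst', ContinuousLinearMap.coe_snd',
    chartField_extChartAt _ hq, one_smul, map_add, map_sum, map_smul]
  rfl

theorem contMDiffOn_chartDifferential_fieldValue [IsManifold (𝓡 n) ∞ M]
    {V : (q : M) → TangentSpace (𝓡 n) q} (hV : IsSmoothField V) (c : M) :
    ContMDiffOn (𝓡 n) 𝓘(ℝ, EuclideanSpace ℝ (Fin n)) ∞
      (fun q : M => chartDifferential c q (fieldValue V q))
      (chartAt (EuclideanSpace ℝ (Fin n)) c).source := by
  set e := trivializationAt (EuclideanSpace ℝ (Fin n)) (TangentSpace (𝓡 n) : M → Type _) c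
  intro q hq
  have hsection :=
    (Bundle.Trivialization.contMDiffAt_section_iff e (by simpa [e] using hq)).1 (hV q)
  refine (hsection.congr_of_eventuallyEq ?_).contMDiffWithinAt
  filter_upwards [(chartAt (EuclideanSpace ℝ (Fin n)) c).open_source.mem_nhds hq] with q' hq'
  exact (DFunLike.congr_fun (TangentBundle.continuousLinearMapAt_trivializationAt
    (I := 𝓡 n) hq') (V q')).symm.trans (congrFun (e.coe_linearMapAt_of_mem (R := ℝ)
      (by simpa [e] using hq')) (V q'))

theorem contDiffOn_chartField [IsManifold (𝓡 n) ∞ M] {V : (q : M) → TangentSpace (𝓡 n) q}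
    (hV : IsSmoothField V) (c : M) :
    ContDiffOn ℝ ∞ (chartField V c) (extChartAt (𝓡 n) c).target := by
  rw [← contMDiffOn_iff_contDiffOn]
  refine (contMDiffOn_chartDifferential_fieldValue hV c).comp (contMDiffOn_extChartAt_symm c)
    fun z hz => ?_
  rw [← extChartAt_source (𝓡 n)]
  exact (extChartAt (𝓡 n) c).map_target hz

variable {X₀ X} in
theorem contDiffOn_systemField [IsManifold (𝓡 n) ∞ M] (hX₀ : IsSmoothField X₀)
    (hX : ∀ i, IsSmoothField (X i)) (c : M) :
    ContDiffOn ℝ ∞ (systemField X₀ X c) (extChartAt (𝓡 n) c).target :=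
  (contDiffOn_const.smulRight (contDiffOn_chartField hX₀ c)).add
    (ContDiffOn.sum fun i _ => contDiffOn_const.smulRight (contDiffOn_chartField (hX i) c))

end ChartFields

section CoordinateChange

variable {n d : ℕ} {M : Type*} [TopologicalSpace M] [ChartedSpace (EuclideanSpace ℝ (Fin n)) M]

/-- The change of coordinates between the charts at `c` and `c'`. -/
noncomputable def coordChange (c c' : M) (z : EuclideanSpace ℝ (Fin n)) :
    EuclideanSpace ℝ (Fin n) :=
  extChartAt (𝓡 n) c' ((extChartAt (𝓡 n) c).symm z)

/-- The domain of the change of coordinates between the charts at `c` and `c'`. -/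
def coordDomain (c c' : M) : Set (EuclideanSpace ℝ (Fin n)) :=
  (extChartAt (𝓡 n) c).target ∩
    (extChartAt (𝓡 n) c).symm ⁻¹' (chartAt (EuclideanSpace ℝ (Fin n)) c').source

theorem isOpen_coordDomain (c c' : M) :
    IsOpen (coordDomain c c' : Set (EuclideanSpace ℝ (Fin n))) :=
  (continuousOn_extChartAt_symm c).isOpen_inter_preimage (isOpen_extChartAt_target c)
    (chartAt _ c').open_source

theorem coordChange_extChartAt {c c' q : M}
    (hq : q ∈ (chartAt (EuclideanSpace ℝ (Fin n)) c).source) :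
    coordChange c c' (extChartAt (𝓡 n) c q) = extChartAt (𝓡 n) c' q := by
  rw [coordChange, (extChartAt (𝓡 n) c).left_inv (by rwa [extChartAt_source])]

theorem extChartAt_mem_coordDomain {c c' q : M}
    (hq : q ∈ (chartAt (EuclideanSpace ℝ (Fin n)) c).source)
    (hq' : q ∈ (chartAt (EuclideanSpace ℝ (Fin n)) c').source) :
    extChartAt (𝓡 n) c q ∈ coordDomain c c' := by
  rw [← extChartAt_source (𝓡 n)] at hq
  exact ⟨(extChartAt (𝓡 n) c).map_source hq,
    by rwa [mem_preimage, (extChartAt (𝓡 n) c).left_inv hq]⟩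

variable [IsManifold (𝓡 n) ∞ M]

theorem contDiffOn_coordChange (c c' : M) :
    ContDiffOn ℝ ∞ (coordChange c c' : EuclideanSpace ℝ (Fin n) → _) (coordDomain c c') := by
  rw [← contMDiffOn_iff_contDiffOn]
  exact (contMDiffOn_extChartAt (I := 𝓡 n) (x := c')).comp
    ((contMDiffOn_extChartAt_symm c).mono inter_subset_left) fun z hz => hz.2

theorem hasFDerivAt_coordChange {c c' : M} {z : EuclideanSpace ℝ (Fin n)}
    (hz : z ∈ coordDomain c c') :
    HasFDerivAt (coordChange c c') (fderiv ℝ (coordChange c c') z) z :=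
  (((contDiffOn_coordChange c c').contDiffAt ((isOpen_coordDomain c c').mem_nhds hz))
    |>.differentiableAt (by simp)).hasFDerivAt

theorem chartDifferential_eq_comp {c c' q : M}
    (hq : q ∈ (chartAt (EuclideanSpace ℝ (Fin n)) c).source)
    (hq' : q ∈ (chartAt (EuclideanSpace ℝ (Fin n)) c').source) :
    chartDifferential c' q =
      (fderiv ℝ (coordChange c c') (extChartAt (𝓡 n) c q)).comp (chartDifferential c q) := by
  have hcomp := (hasMFDerivAt_iff_hasFDerivAt.2 (hasFDerivAt_coordChange
    (extChartAt_mem_coordDomain hq hq'))).comp q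
      (mdifferentiableAt_extChartAt (I := 𝓡 n) hq).hasMFDerivAt
  have heq : coordChange c c' ∘ extChartAt (𝓡 n) c =ᶠ[𝓝 q] extChartAt (𝓡 n) c' := by
    filter_upwards [(chartAt (EuclideanSpace ℝ (Fin n)) c).open_source.mem_nhds hq] with q' h
    exact coordChange_extChartAt h
  exact (hcomp.congr_of_eventuallyEq heq.symm).mfderiv

theorem systemField_coordChange (X₀ : (q : M) → TangentSpace (𝓡 n) q)
    (X : Fin d → (q : M) → TangentSpace (𝓡 n) q) {c c' : M} {z : EuclideanSpace ℝ (Fin n)}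
    (hz : z ∈ coordDomain c c') (v : EuclideanSpace ℝ (Fin d)) :
    systemField X₀ X c' (coordChange c c' z) ((1 : ℝ), v) =
      fderiv ℝ (coordChange c c') z (systemField X₀ X c z ((1 : ℝ), v)) := by
  obtain ⟨q, hq, rfl⟩ : ∃ q ∈ (chartAt (EuclideanSpace ℝ (Fin n)) c).source,
      extChartAt (𝓡 n) c q = z :=
    ⟨_, by simpa using (extChartAt (𝓡 n) c).map_target hz.1, (extChartAt (𝓡 n) c).right_inv hz.1⟩
  have hq' : q ∈ (chartAt (EuclideanSpace ℝ (Fin n)) c').source := by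
    have := hz.2
    rwa [mem_preimage, (extChartAt (𝓡 n) c).left_inv (by rwa [extChartAt_source])] at this
  rw [coordChange_extChartAt hq, systemField_extChartAt X₀ X hq', systemField_extChartAt X₀ X hq,
    chartDifferential_eq_comp hq hq', ContinuousLinearMap.comp_apply]

end CoordinateChange

section ExtendedControl

variable {d : ℕ} {p : ℝ≥0∞}

/-- The extended control `(1, u)`, whose first component drives the drift. -/
noncomputable def extendedControl (u : Control d p) (t : ℝ) : ℝ × EuclideanSpace ℝ (Fin d) :=
  (1, u t)

theorem ae_extendedControl_sub (u v : Control d p) {a b : ℝ} (ha : a ∈ Icc (0 : ℝ) 1)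
    (hb : b ∈ Icc (0 : ℝ) 1) : ∀ᵐ s, s ∈ uIoc a b → extendedControl u s - extendedControl v s =
      ContinuousLinearMap.inr ℝ ℝ (EuclideanSpace ℝ (Fin d)) ((u - v) s) := by
  filter_upwards [ae_interval_of_ae_restrict ha hb (Lp.coeFn_sub u v)] with s hs hmem
  rw [hs hmem]
  simp [extendedControl]

variable [Fact (1 ≤ p)]

theorem intervalIntegrable_extendedControl (u : Control d p) {a b : ℝ} (ha : a ∈ Icc (0 : ℝ) 1)
    (hb : b ∈ Icc (0 : ℝ) 1) : IntervalIntegrable (extendedControl u) volume a b := by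
  have hu := intervalIntegrable_control u ha hb
  rw [intervalIntegrable_iff] at hu ⊢
  exact Integrable.prodMk
    (intervalIntegrable_iff.1 (intervalIntegrable_const (c := (1 : ℝ)))) hu

theorem integral_norm_extendedControl_le (hp_top : p ≠ ⊤) (u : Control d p) {a b : ℝ}
    (ha : 0 ≤ a) (hab : a ≤ b) (hb : b ≤ 1) :
    ∫ t in a..b, ‖extendedControl u t‖ ≤ (b - a) + (b - a) ^ (1 - p.toReal⁻¹) * ‖u‖ := by
  have haI : a ∈ Icc (0 : ℝ) 1 := ⟨ha, hab.trans hb⟩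
  have hbI : b ∈ Icc (0 : ℝ) 1 := ⟨ha.trans hab, hb⟩
  have hu := (intervalIntegrable_control u haI hbI).norm
  calc ∫ t in a..b, ‖extendedControl u t‖ ≤ ∫ t in a..b, (1 + ‖u t‖) := by
        refine intervalIntegral.integral_mono_on hab
          (intervalIntegrable_extendedControl u haI hbI).norm
          (intervalIntegrable_const.add hu) fun t _ => ?_
        rw [extendedControl, Prod.norm_mk, norm_one]
        exact max_le_add_of_nonneg zero_le_one (norm_nonneg _)
    _ = (b - a) + ∫ t in a..b, ‖u t‖ := by
        rw [intervalIntegral.integral_add intervalIntegrable_const hu]; simp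
    _ ≤ (b - a) + (b - a) ^ (1 - p.toReal⁻¹) * ‖u‖ := by
        gcongr
        exact integral_norm_control_le hp_top u ha hab hb

theorem integral_norm_extendedControl_sub_le (u v : Control d p) {a b : ℝ}
    (ha : 0 ≤ a) (hab : a ≤ b) (hb : b ≤ 1) :
    ∫ s in a..b, ‖extendedControl u s - extendedControl v s‖ ≤ ‖u - v‖ := by
  refine le_trans (le_of_eq ?_) (integral_norm_control_le_norm (u - v) ha hab hb)
  apply intervalIntegral.integral_congr_ae
  filter_upwards [ae_extendedControl_sub u v ⟨ha, hab.trans hb⟩ ⟨ha.trans hab, hb⟩] with s hs hmem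
  rw [hs hmem]
  simp [Prod.norm_def]

end ExtendedControl

section Trajectories

variable {n d : ℕ} {M : Type*} [TopologicalSpace M] [ChartedSpace (EuclideanSpace ℝ (Fin n)) M]
  {p : ℝ≥0∞} {X₀ : (q : M) → TangentSpace (𝓡 n) q} {X : Fin d → (q : M) → TangentSpace (𝓡 n) q}
  {u : Control d p} {γ : ℝ → M}

/-- `γ` solves the system driven by `u` on `[a, b]`, in integral form in every chart. -/
structure SolvesChartwiseOn (X₀ : (q : M) → TangentSpace (𝓡 n) q)
    (X : Fin d → (q : M) → TangentSpace (𝓡 n) q) (u : Control d p) (a b : ℝ) (γ : ℝ → M) :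
    Prop where
  continuousOn : ContinuousOn γ (Icc a b)
  solvesOn : ∀ (c : M) (a' b' : ℝ), a ≤ a' → a' ≤ b' → b' ≤ b →
    MapsTo γ (Icc a' b') (chartAt (EuclideanSpace ℝ (Fin n)) c).source →
    SolvesOn (systemField X₀ X c) (extendedControl u) a' b' (fun t => extChartAt (𝓡 n) c (γ t))

theorem SolvesChartwiseOn.mono {a b a' b' : ℝ} (h : SolvesChartwiseOn X₀ X u a b γ)
    (ha : a ≤ a') (hb : b' ≤ b) : SolvesChartwiseOn X₀ X u a' b' γ :=
  ⟨h.continuousOn.mono (Icc_subset_Icc ha hb),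
    fun c s t hs hst ht hm => h.solvesOn c s t (ha.trans hs) hst (ht.trans hb) hm⟩

variable [IsManifold (𝓡 n) ∞ M]

theorem hasDerivAt_extChartAt_of_hasMFDerivAt {t : ℝ} {v : EuclideanSpace ℝ (Fin d)} {c : M}
    (hc : γ t ∈ (chartAt (EuclideanSpace ℝ (Fin n)) c).source)
    (hγ : HasMFDerivAt 𝓘(ℝ, ℝ) (𝓡 n) γ t
      (ContinuousLinearMap.toSpanSingleton ℝ (X₀ (γ t) + ∑ i : Fin d, v i • X i (γ t)))) :
    HasDerivAt (fun t => extChartAt (𝓡 n) c (γ t))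
      (systemField X₀ X c (extChartAt (𝓡 n) c (γ t)) (1, v)) t := by
  have hcomp := (mdifferentiableAt_extChartAt (I := 𝓡 n) hc).hasMFDerivAt.comp t hγ
  have hder : HasFDerivAt (extChartAt (𝓡 n) c ∘ γ) ((chartDifferential c (γ t)).comp
      (ContinuousLinearMap.toSpanSingleton ℝ (systemVelocity X₀ X (γ t) v))) t :=
    hasMFDerivAt_iff_hasFDerivAt.1 hcomp
  rw [systemField_extChartAt X₀ X hc]
  exact hder.hasDerivAt.congr_deriv (by simp)

variable [Fact (1 ≤ p)]

theorem intervalIntegrable_systemField_extChartAt (hX₀ : IsSmoothField X₀)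
    (hX : ∀ i, IsSmoothField (X i)) (u : Control d p) {c : M} {a b : ℝ} (ha : 0 ≤ a) (hab : a ≤ b)
    (hb : b ≤ 1) (hγ : ContinuousOn γ (Icc a b))
    (hmaps : MapsTo γ (Icc a b) (chartAt (EuclideanSpace ℝ (Fin n)) c).source) :
    IntervalIntegrable (fun t => systemField X₀ X c (extChartAt (𝓡 n) c (γ t))
      (extendedControl u t)) volume a b :=
  intervalIntegrable_clm_apply hab
    ((contDiffOn_systemField hX₀ hX c).continuousOn.comp (continuousOn_extChartAt_comp hγ hmaps)
      fun t ht => (extChartAt (𝓡 n) c).map_source (by rw [extChartAt_source]; exact hmaps ht))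
    (intervalIntegrable_extendedControl u ⟨ha, hab.trans hb⟩ ⟨ha.trans hab, hb⟩)

theorem IsTrajectory.solvesChartwiseOn (hX₀ : IsSmoothField X₀) (hX : ∀ i, IsSmoothField (X i))
    {x : M} (h : IsTrajectory X₀ X x u γ) : SolvesChartwiseOn X₀ X u 0 1 γ := by
  refine ⟨h.absolutelyContinuous.1, fun c a b ha hab hb hmaps => ?_⟩
  have hsub : Icc a b ⊆ Icc (0 : ℝ) 1 := Icc_subset_Icc ha hb
  have hγ : ContinuousOn γ (Icc a b) := h.absolutelyContinuous.1.mono hsub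
  refine ⟨continuousOn_extChartAt_comp hγ hmaps, fun t ht =>
    eq_add_integral_of_absolutelyContinuous hab (h.absolutelyContinuous.2 c a b hab hsub hmaps)
      (intervalIntegrable_systemField_extChartAt hX₀ hX u ha hab hb hγ hmaps) ?_ ht⟩
  filter_upwards [(ae_restrict_iff' measurableSet_Icc).1 h.velocity] with t ht htab
  have htI : t ∈ Icc a b := Ioo_subset_Icc_self htab
  exact hasDerivAt_extChartAt_of_hasMFDerivAt (hmaps htI) (ht (hsub htI))

end Trajectories

section RealInterval

theorem forall_mem_Icc_of_local_step {α β : ℝ} {P : ℝ → Prop} (h0 : P α)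
    (hstep : ∀ t₀ ∈ Icc α β, ∃ ε > 0, ∀ a ∈ Icc α β, ∀ b ∈ Icc α β, |a - t₀| < ε → |b - t₀| < ε →
      a ≤ b → P a → P b) : ∀ t ∈ Icc α β, P t := by
  intro T hT
  choose! ε hε hP using hstep
  have hIcc : ∀ s : Icc α T, (s : ℝ) ∈ Icc α β := fun s => ⟨s.2.1, s.2.2.trans hT.2⟩
  obtain ⟨t, ht0, hmono, ⟨m, hm⟩, hsub⟩ := exists_monotone_Icc_subset_open_cover_Icc hT.1
    (c := fun s : Icc α T => {t | |(t : ℝ) - s| < ε s})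
    (fun s => isOpen_lt (by fun_prop) continuous_const)
    (fun s _ => mem_iUnion.2 ⟨s, by simpa using hε s (hIcc s)⟩)
  have hind : ∀ k : ℕ, P (t k) := by
    intro k
    induction k with
    | zero => rwa [ht0]
    | succ k ih =>
      have hk := hmono k.le_succ
      obtain ⟨s, hs⟩ := hsub k
      exact hP s (hIcc s) _ (hIcc _) _ (hIcc _) (hs (left_mem_Icc.2 hk)) (hs (right_mem_Icc.2 hk))
        hk ih
  simpa only [hm m le_rfl] using hind m

/-- A curve can only leave `U` through its closed neighbourhood `K`, so it stays in `U` if it is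
back in `U` at the end of every time interval spent in `K`. -/
theorem mapsTo_Icc_of_isOpen_of_isClosed {Y : Type*} [TopologicalSpace Y] {γ : ℝ → Y} {a b : ℝ}
    {U K : Set Y} (hγ : ContinuousOn γ (Icc a b)) (hU : IsOpen U) (hK : IsClosed K) (hUK : U ⊆ K)
    (ha : γ a ∈ U) (hstay : ∀ T ∈ Icc a b, MapsTo γ (Icc a T) K → γ T ∈ U) :
    MapsTo γ (Icc a b) U := by
  by_contra hleave
  obtain ⟨t, ht, htU⟩ : ∃ t ∈ Icc a b, γ t ∉ U := by
    simpa only [MapsTo, not_forall, exists_prop] using hleave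
  have hexit : IsCompact (Icc a b ∩ γ ⁻¹' Uᶜ) := isCompact_Icc.of_isClosed_subset
    (hγ.preimage_isClosed_of_isClosed isClosed_Icc hU.isClosed_compl) inter_subset_left
  obtain ⟨T, ⟨hT, hTU⟩, hleast⟩ := hexit.exists_isLeast ⟨t, ht, htU⟩
  have hbefore : MapsTo γ (Ico a T) U := fun s hs => by
    by_contra hsU
    exact hs.2.not_ge (hleast ⟨⟨hs.1, hs.2.le.trans hT.2⟩, hsU⟩)
  have haT : a ≠ T := fun h => hTU (h ▸ ha)
  have hclosure : MapsTo γ (closure (Ico a T)) (closure K) :=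
    (hbefore.mono_right hUK).closure_of_continuousOn
      (by rw [closure_Ico haT]; exact hγ.mono (Icc_subset_Icc_right hT.2))
  rw [closure_Ico haT, hK.closure_eq] at hclosure
  exact hTU (hstay T hT hclosure)

end RealInterval

section Stability

variable {n d : ℕ} {M : Type*} [TopologicalSpace M] [ChartedSpace (EuclideanSpace ℝ (Fin n)) M]
  {p : ℝ≥0∞} [Fact (1 ≤ p)] {X₀ : (q : M) → TangentSpace (𝓡 n) q}
  {X : Fin d → (q : M) → TangentSpace (𝓡 n) q}

theorem SolvesChartwiseOn.mapsTo_closedBall [T2Space M] {u : Control d p} {a b r L : ℝ}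
    {γ : ℝ → M} {c : M} {z : EuclideanSpace ℝ (Fin n)} (ha : 0 ≤ a) (hb : b ≤ 1)
    (h : SolvesChartwiseOn X₀ X u a b γ)
    (hball : Metric.closedBall z (2 * r) ⊆ (extChartAt (𝓡 n) c).target)
    (hB : ∀ w ∈ Metric.closedBall z (2 * r), ‖systemField X₀ X c w‖ ≤ L)
    (hsmall : L * ∫ t in a..b, ‖extendedControl u t‖ < r)
    (hinit : γ a ∈ chartPreimage c (Metric.ball z r)) :
    MapsTo γ (Icc a b) (chartPreimage c (Metric.closedBall z (2 * r))) := by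
  have hr : 0 < r := dist_nonneg.trans_lt (Metric.mem_ball.1 hinit.2)
  have hL : 0 ≤ L := (norm_nonneg _).trans (hB z (Metric.mem_closedBall_self (by positivity)))
  have hUK : chartPreimage c (Metric.ball z (2 * r)) ⊆
      chartPreimage c (Metric.closedBall z (2 * r)) :=
    chartPreimage_mono Metric.ball_subset_closedBall
  refine MapsTo.mono_right (mapsTo_Icc_of_isOpen_of_isClosed h.continuousOn
    (isOpen_chartPreimage c Metric.isOpen_ball) (isClosed_chartPreimage (isCompact_closedBall _ _)
      hball) hUK (chartPreimage_mono (Metric.ball_subset_ball (by linarith)) hinit)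
    fun T hT hmaps => ⟨(hmaps (right_mem_Icc.2 hT.1)).1, ?_⟩) hUK
  have haI : a ∈ Icc (0 : ℝ) 1 := ⟨ha, hT.1.trans (hT.2.trans hb)⟩
  have hmoved := (h.solvesOn c a T le_rfl hT.1 hT.2 fun t ht => (hmaps ht).1).norm_sub_le hT.1 hB
    (fun t ht => (hmaps ht).2)
    (intervalIntegrable_extendedControl u haI ⟨ha.trans hT.1, hT.2.trans hb⟩)
  have hlater : ∫ t in a..T, ‖extendedControl u t‖ ≤ ∫ t in a..b, ‖extendedControl u t‖ :=
    intervalIntegral.integral_mono_interval le_rfl hT.1 hT.2 (ae_of_all _ fun t => norm_nonneg _)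
      (intervalIntegrable_extendedControl u haI ⟨ha.trans (hT.1.trans hT.2), hb⟩).norm
  rw [← dist_eq_norm] at hmoved
  calc dist (extChartAt (𝓡 n) c (γ T)) z
      ≤ dist (extChartAt (𝓡 n) c (γ T)) (extChartAt (𝓡 n) c (γ a)) +
        dist (extChartAt (𝓡 n) c (γ a)) z := dist_triangle _ _ _
    _ < r + r := add_lt_add ((hmoved.trans (by gcongr)).trans_lt hsmall) hinit.2
    _ = 2 * r := (two_mul r).symm

theorem exists_integral_norm_extendedControl_lt (hp : 1 < p) (hp_top : p ≠ ⊤) (R : ℝ) {δ : ℝ}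
    (hδ : 0 < δ) : ∃ ε > 0, ∀ u : Control d p, ‖u‖ ≤ R → ∀ a b, 0 ≤ a → a ≤ b → b ≤ 1 →
      b - a < ε → ∫ t in a..b, ‖extendedControl u t‖ < δ := by
  have hexp : 0 < 1 - p.toReal⁻¹ := sub_pos.2 (inv_lt_one_of_one_lt₀ (one_lt_toReal hp hp_top))
  have hlim : Tendsto (fun s : ℝ => s + s ^ (1 - p.toReal⁻¹) * R) (𝓝 0) (𝓝 0) := by
    have hcont : ContinuousAt (fun s : ℝ => s + s ^ (1 - p.toReal⁻¹) * R) 0 :=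
      continuousAt_id.add ((Real.continuousAt_rpow_const 0 _ (Or.inr hexp.le)).mul
        continuousAt_const)
    simpa [ContinuousAt, Real.zero_rpow hexp.ne'] using hcont
  obtain ⟨ε, hε, hball⟩ := Metric.eventually_nhds_iff.1 (hlim.eventually (gt_mem_nhds hδ))
  refine ⟨ε, hε, fun u hu a b ha hab hb hba => ?_⟩
  have hba0 : 0 ≤ b - a := sub_nonneg.2 hab
  calc ∫ t in a..b, ‖extendedControl u t‖
      ≤ (b - a) + (b - a) ^ (1 - p.toReal⁻¹) * ‖u‖ :=
        integral_norm_extendedControl_le hp_top u ha hab hb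
    _ ≤ (b - a) + (b - a) ^ (1 - p.toReal⁻¹) * R := by gcongr
    _ < δ := hball (by rwa [Real.dist_0_eq_abs, abs_of_nonneg hba0])

/-- The coordinate ball of radius `2 * r` at `c` carries the uniform bounds `L` for the system, and
within time `ε` the controls of norm at most `R` move its points by less than `r`. -/
structure IsUniformBall (p : ℝ≥0∞) [Fact (1 ≤ p)] (X₀ : (q : M) → TangentSpace (𝓡 n) q)
    (X : Fin d → (q : M) → TangentSpace (𝓡 n) q) (R : ℝ) (c : M) (r L ε : ℝ) : Prop where
  subset_target :
    Metric.closedBall (extChartAt (𝓡 n) c c) (2 * r) ⊆ (extChartAt (𝓡 n) c).target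
  secondOrderBounded : SecondOrderBounded (systemField X₀ X c)
    (Metric.closedBall (extChartAt (𝓡 n) c c) (2 * r)) L
  integral_le (u : Control d p) : ‖u‖ ≤ R → ∀ a b, 0 ≤ a → a ≤ b → b ≤ 1 → b - a < ε →
    L * ∫ t in a..b, ‖extendedControl u t‖ ≤ 1 / 2
  integral_lt (u : Control d p) : ‖u‖ ≤ R → ∀ a b, 0 ≤ a → a ≤ b → b ≤ 1 → b - a < ε →
    L * ∫ t in a..b, ‖extendedControl u t‖ < r

variable [IsManifold (𝓡 n) ∞ M]

theorem exists_isUniformBall (hp : 1 < p) (hp_top : p ≠ ⊤) (hX₀ : IsSmoothField X₀)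
    (hX : ∀ i, IsSmoothField (X i)) (R : ℝ) (c : M) :
    ∃ r > 0, ∃ L, 0 ≤ L ∧ ∃ ε > 0, IsUniformBall p X₀ X R c r L ε := by
  obtain ⟨r, hr, hsub⟩ := Metric.nhds_basis_closedBall.mem_iff.1
    ((isOpen_extChartAt_target (I := 𝓡 n) c).mem_nhds (mem_extChartAt_target c))
  rw [← mul_div_cancel₀ r two_ne_zero] at hsub
  obtain ⟨L, hL, hbounded⟩ := exists_secondOrderBounded_closedBall
    (isOpen_extChartAt_target (I := 𝓡 n) c)
    (by exact_mod_cast contDiffOn_infty.1 (contDiffOn_systemField hX₀ hX c) 2) hsub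
  obtain ⟨ε, hε, hsmall⟩ := exists_integral_norm_extendedControl_lt (d := d) hp hp_top R
    (show 0 < min (1 / 2) (r / 2) / (L + 1) by positivity)
  have hlt : ∀ u : Control d p, ‖u‖ ≤ R → ∀ a b, 0 ≤ a → a ≤ b → b ≤ 1 → b - a < ε →
      L * ∫ t in a..b, ‖extendedControl u t‖ < min (1 / 2) (r / 2) := by
    intro u hu a b ha hab hb hba
    have hint := (lt_div_iff₀' (by positivity)).1 (hsmall u hu a b ha hab hb hba)
    have hnonneg : 0 ≤ ∫ t in a..b, ‖extendedControl u t‖ :=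
      intervalIntegral.integral_nonneg hab fun t _ => norm_nonneg _
    linarith
  exact ⟨r / 2, half_pos hr, L, hL, ε, hε, hsub, hbounded,
    fun u hu a b ha hab hb hba => ((lt_min_iff.1 (hlt u hu a b ha hab hb hba)).1).le,
    fun u hu a b ha hab hb hba => (lt_min_iff.1 (hlt u hu a b ha hab hb hba)).2⟩

omit [IsManifold (𝓡 n) ∞ M] in
theorem IsUniformBall.mapsTo [T2Space M] {R r L ε a b : ℝ} {c : M}
    (h : IsUniformBall p X₀ X R c r L ε) {u : Control d p} (hu : ‖u‖ ≤ R) {γ : ℝ → M} (ha : 0 ≤ a)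
    (hab : a ≤ b) (hb : b ≤ 1) (hba : b - a < ε) (hγ : SolvesChartwiseOn X₀ X u a b γ)
    (hinit : γ a ∈ chartPreimage c (Metric.ball (extChartAt (𝓡 n) c c) r)) :
    MapsTo γ (Icc a b) (chartPreimage c (Metric.closedBall (extChartAt (𝓡 n) c c) (2 * r))) :=
  hγ.mapsTo_closedBall ha hb h.subset_target h.secondOrderBounded.bound
    (h.integral_lt u hu a b ha hab hb hba) hinit

/-- On `[a, b]` the curve `γ₀`, and every trajectory of a control of norm at most `R` starting at
time `a` close enough to `γ₀ a`, runs in the part `K` of the chart at `c`, where the system has the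
uniform bounds `L`. -/
structure IsTube (p : ℝ≥0∞) [Fact (1 ≤ p)] (X₀ : (q : M) → TangentSpace (𝓡 n) q)
    (X : Fin d → (q : M) → TangentSpace (𝓡 n) q) (R : ℝ) (γ₀ : ℝ → M) (c : M)
    (K : Set (EuclideanSpace ℝ (Fin n))) (L a b : ℝ) : Prop where
  secondOrderBounded : SecondOrderBounded (systemField X₀ X c) K L
  mapsTo : MapsTo γ₀ (Icc a b) (chartPreimage c K)
  integral_le (u : Control d p) : ‖u‖ ≤ R → L * ∫ t in a..b, ‖extendedControl u t‖ ≤ 1 / 2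
  eventually_mapsTo : ∀ᶠ m in 𝓝 (γ₀ a), ∀ (u : Control d p) (γ : ℝ → M), ‖u‖ ≤ R →
    SolvesChartwiseOn X₀ X u 0 1 γ → γ a = m → MapsTo γ (Icc a b) (chartPreimage c K)

theorem forall_mem_Icc_of_isTube_step [T2Space M] (hp : 1 < p) (hp_top : p ≠ ⊤)
    (hX₀ : IsSmoothField X₀) (hX : ∀ i, IsSmoothField (X i)) (R : ℝ) {γ₀ : ℝ → M}
    (hγ₀ : ContinuousOn γ₀ (Icc 0 1)) {P : ℝ → Prop} (h0 : P 0)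
    (hstep : ∀ c K L a b, 0 ≤ a → a ≤ b → b ≤ 1 → IsTube p X₀ X R γ₀ c K L a b → P a → P b) :
    ∀ t ∈ Icc (0 : ℝ) 1, P t := by
  refine forall_mem_Icc_of_local_step h0 fun t₀ ht₀ => ?_
  obtain ⟨r, hr, L, -, ε, hε, hball⟩ := exists_isUniformBall (p := p) hp hp_top hX₀ hX R (γ₀ t₀)
  set z := extChartAt (𝓡 n) (γ₀ t₀) (γ₀ t₀)
  have hopen : IsOpen (chartPreimage (γ₀ t₀) (Metric.ball z r)) :=
    isOpen_chartPreimage _ Metric.isOpen_ball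
  obtain ⟨ε', hε', hnear⟩ := Metric.mem_nhdsWithin_iff.1 ((hγ₀ t₀ ht₀).preimage_mem_nhdsWithin
    (hopen.mem_nhds ⟨mem_chart_source _ _, Metric.mem_ball_self hr⟩))
  refine ⟨min (ε / 2) ε', by positivity, fun a ha b hb hat hbt hab => ?_⟩
  have hba : b - a < ε := by
    have := abs_lt.1 (hat.trans_le (min_le_left _ _))
    have := abs_lt.1 (hbt.trans_le (min_le_left _ _))
    linarith
  have hin : MapsTo γ₀ (Icc a b) (chartPreimage (γ₀ t₀) (Metric.ball z r)) := fun t ht =>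
    hnear ⟨(convex_ball t₀ ε').ordConnected.out (hat.trans_le (min_le_right _ _))
      (hbt.trans_le (min_le_right _ _)) ht, ha.1.trans ht.1, ht.2.trans hb.2⟩
  refine hstep (γ₀ t₀) (Metric.closedBall z (2 * r)) L a b ha.1 hab hb.2
    ⟨hball.secondOrderBounded, hin.mono_right (chartPreimage_mono
      (Metric.ball_subset_closedBall.trans (Metric.closedBall_subset_closedBall (by linarith)))),
      fun u hu => hball.integral_le u hu a b ha.1 hab hb.2 hba, ?_⟩
  filter_upwards [hopen.mem_nhds (hin (left_mem_Icc.2 hab))] with m hm u γ hu hγ hγa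
  exact hball.mapsTo hu ha.1 hab hb.2 hba (hγ.mono ha.1 hb.2) (hγa ▸ hm)

end Stability

section WeakContinuity

variable {n d : ℕ} {M : Type*} [TopologicalSpace M] [ChartedSpace (EuclideanSpace ℝ (Fin n)) M]
  {p : ℝ≥0∞} [Fact (1 ≤ p)] {X₀ : (q : M) → TangentSpace (𝓡 n) q}
  {X : Fin d → (q : M) → TangentSpace (𝓡 n) q} {ι : Type*} {l : Filter ι} {u : ι → Control d p}
  {v : Control d p} {R : ℝ} {γ : ι → ℝ → M} {γ₀ : ℝ → M}

theorem PrimitiveTendsto.eventually_norm_integral_clm_le (hu : ∀ i, ‖u i‖ ≤ R) (hv : ‖v‖ ≤ R)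
    (h : PrimitiveTendsto l u v) {F : Type*} [NormedAddCommGroup F] [NormedSpace ℝ F]
    [CompleteSpace F] {A : ℝ → ℝ × EuclideanSpace ℝ (Fin d) →L[ℝ] F} {a b : ℝ} (ha : 0 ≤ a)
    (hab : a ≤ b) (hb : b ≤ 1) (hA : ContinuousOn A (Icc a b)) {ε : ℝ} (hε : 0 < ε) :
    ∀ᶠ i in l, ∀ t ∈ Icc a b,
      ‖∫ s in a..t, A s (extendedControl (u i) s - extendedControl v s)‖ ≤ ε := by
  have hR : 0 ≤ R := (norm_nonneg _).trans hv
  obtain ⟨κ, hκ, hκA⟩ := exists_norm_integral_clm_apply_le hab hA hε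
    (show 0 ≤ R + R by positivity)
  have h0I : (0 : ℝ) ∈ Icc (0 : ℝ) 1 := by simp
  have haI : a ∈ Icc (0 : ℝ) 1 := ⟨ha, hab.trans hb⟩
  have hbI : b ∈ Icc (0 : ℝ) 1 := ⟨ha.trans hab, hb⟩
  filter_upwards [h.eventually_norm_integral_le (half_pos hκ)] with i hi
  refine hκA _ ((intervalIntegrable_extendedControl (u i) haI hbI).sub
    (intervalIntegrable_extendedControl v haI hbI)) ?_ fun t ht => ?_
  · exact (integral_norm_extendedControl_sub_le (u i) v ha hab hb).trans
      ((norm_sub_le _ _).trans (add_le_add (hu i) hv))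
  have htI : t ∈ Icc (0 : ℝ) 1 := ⟨ha.trans ht.1, ht.2.trans hb⟩
  rw [intervalIntegral.integral_congr_ae (ae_extendedControl_sub (u i) v haI htI),
    ContinuousLinearMap.intervalIntegral_comp_comm _ (intervalIntegrable_control _ haI htI),
    ContinuousLinearMap.inr_apply, Prod.norm_mk, norm_zero, max_eq_right (norm_nonneg _),
    ← intervalIntegral.integral_interval_sub_left (intervalIntegrable_control (u i - v) h0I htI)
      (intervalIntegrable_control (u i - v) h0I haI)]
  exact (_root_.norm_sub_le _ _).trans ((add_le_add (hi t htI) (hi a haI)).trans_eq (add_halves κ))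

theorem IsTube.tendsto_extChartAt_right {c : M} {K : Set (EuclideanSpace ℝ (Fin n))} {L a b : ℝ}
    (htube : IsTube p X₀ X R γ₀ c K L a b) (ha : 0 ≤ a) (hab : a ≤ b) (hb : b ≤ 1)
    (hu : ∀ i, ‖u i‖ ≤ R) (hv : ‖v‖ ≤ R) (h : PrimitiveTendsto l u v)
    (hγ : ∀ i, SolvesChartwiseOn X₀ X (u i) 0 1 (γ i)) (hγ₀ : SolvesChartwiseOn X₀ X v 0 1 γ₀)
    (hlim : Tendsto (fun i => γ i a) l (𝓝 (γ₀ a))) :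
    Tendsto (fun i => extChartAt (𝓡 n) c (γ i b)) l (𝓝 (extChartAt (𝓡 n) c (γ₀ b))) := by
  have haI : a ∈ Icc (0 : ℝ) 1 := ⟨ha, hab.trans hb⟩
  have hbI : b ∈ Icc (0 : ℝ) 1 := ⟨ha.trans hab, hb⟩
  have hsol₀ := hγ₀.solvesOn c a b ha hab hb fun t ht => (htube.mapsTo ht).1
  have hfield : ContinuousOn (fun t => systemField X₀ X c (extChartAt (𝓡 n) c (γ₀ t))) (Icc a b) :=
    htube.secondOrderBounded.continuousOn.comp hsol₀.continuousOn fun t ht => (htube.mapsTo ht).2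
  have hstart : Tendsto (fun i => extChartAt (𝓡 n) c (γ i a)) l (𝓝 (extChartAt (𝓡 n) c (γ₀ a))) :=
    ((continuousAt_extChartAt' (I := 𝓡 n) (by
      rw [extChartAt_source]; exact (htube.mapsTo (left_mem_Icc.2 hab)).1)).tendsto).comp hlim
  rw [Metric.tendsto_nhds] at hstart ⊢
  simp only [dist_eq_norm] at hstart ⊢
  intro η hη
  filter_upwards [hlim.eventually htube.eventually_mapsTo, hstart (η / 8) (by positivity),
    h.eventually_norm_integral_clm_le hu hv ha hab hb hfield (show 0 < η / 8 by positivity)]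
    with i hmaps hclose hint
  have hin := hmaps (u i) (γ i) (hu i) (hγ i) rfl
  have hdiff := hsol₀.norm_sub_le_of_integral_le htube.secondOrderBounded
    ((hγ i).solvesOn c a b ha hab hb fun t ht => (hin ht).1) (fun t ht => (htube.mapsTo ht).2)
    (fun t ht => (hin ht).2) (intervalIntegrable_extendedControl v haI hbI)
    (intervalIntegrable_extendedControl (u i) haI hbI) (htube.integral_le (u i) (hu i)) hint
    (right_mem_Icc.2 hab)
  linarith

theorem tendsto_solution [IsManifold (𝓡 n) ∞ M] [T2Space M] (hp : 1 < p) (hp_top : p ≠ ⊤)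
    (hX₀ : IsSmoothField X₀) (hX : ∀ i, IsSmoothField (X i)) (hu : ∀ i, ‖u i‖ ≤ R) (hv : ‖v‖ ≤ R)
    (h : PrimitiveTendsto l u v) (hγ : ∀ i, SolvesChartwiseOn X₀ X (u i) 0 1 (γ i))
    (hγ₀ : SolvesChartwiseOn X₀ X v 0 1 γ₀) (hinit : ∀ i, γ i 0 = γ₀ 0) :
    ∀ t ∈ Icc (0 : ℝ) 1, Tendsto (fun i => γ i t) l (𝓝 (γ₀ t)) := by
  refine forall_mem_Icc_of_isTube_step hp hp_top hX₀ hX R hγ₀.continuousOn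
    (by simp only [hinit]; exact tendsto_const_nhds) fun c K L a b ha hab hb htube hlim => ?_
  have hbU : γ₀ b ∈ (extChartAt (𝓡 n) c).source := by
    rw [extChartAt_source]
    exact (htube.mapsTo (right_mem_Icc.2 hab)).1
  have hsymm := (continuousAt_extChartAt_symm' (I := 𝓡 n) hbU).tendsto.comp
    (htube.tendsto_extChartAt_right ha hab hb hu hv h hγ hγ₀ hlim)
  rw [(extChartAt (𝓡 n) c).left_inv hbU] at hsymm
  refine hsymm.congr' ?_
  filter_upwards [hlim.eventually htube.eventually_mapsTo] with i hmaps
  refine (extChartAt (𝓡 n) c).left_inv ?_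
  rw [extChartAt_source]
  exact (hmaps (u i) (γ i) (hu i) (hγ i) rfl (right_mem_Icc.2 hab)).1

end WeakContinuity

section SmallDifferences

variable {E F W : Type*} [NormedAddCommGroup E] [NormedSpace ℝ E] [NormedAddCommGroup F]
  [NormedSpace ℝ F] [NormedAddCommGroup W] [NormedSpace ℝ W]

/-- The first differences of three points are `O(s)` and their second difference is `O(s ^ 2)`,
with constant `C`. -/
structure HasSmallDifferences (C s : ℝ) (ξ : Fin 3 → E) : Prop where
  first : ‖ξ 1 - ξ 0‖ ≤ C * s
  first' : ‖ξ 2 - ξ 1‖ ≤ C * s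
  second : ‖ξ 2 - (2 : ℝ) • ξ 1 + ξ 0‖ ≤ C * s ^ 2

theorem SecondOrderBounded.hasSmallDifferences_comp {g : E → F} {K : Set E} {L C s : ℝ}
    (hg : SecondOrderBounded g K L) (hC : 0 ≤ C) {ξ : Fin 3 → E} (hξ : ∀ j, ξ j ∈ K)
    (h : HasSmallDifferences C s ξ) :
    HasSmallDifferences (L * (C + (2 * C) ^ 2) + L * C) s (fun j => g (ξ j)) := by
  have hL : 0 ≤ L := (norm_nonneg _).trans (hg.bound _ (hξ 0))
  have hCs : 0 ≤ C * s := (norm_nonneg _).trans h.first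
  have hfirst : L * (C * s) ≤ (L * (C + (2 * C) ^ 2) + L * C) * s := by
    have : 0 ≤ L * (1 + 4 * C) * (C * s) := by positivity
    linarith
  refine ⟨(hg.lipschitz _ (hξ 1) _ (hξ 0)).trans (le_trans ?_ hfirst),
    (hg.lipschitz _ (hξ 2) _ (hξ 1)).trans (le_trans ?_ hfirst),
    (hg.second _ (hξ 0) _ (hξ 1) _ (hξ 2)).trans ?_⟩
  · gcongr
    exact h.first
  · gcongr
    exact h.first'
  · have : 0 ≤ L * C * s ^ 2 := by positivity
    calc L * (‖ξ 2 - (2 : ℝ) • ξ 1 + ξ 0‖ + (‖ξ 2 - ξ 1‖ + ‖ξ 1 - ξ 0‖) ^ 2)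
        ≤ L * (C * s ^ 2 + (C * s + C * s) ^ 2) := by
          gcongr
          exacts [h.second, h.first', h.first]
      _ ≤ (L * (C + (2 * C) ^ 2) + L * C) * s ^ 2 := by linarith

variable {B : E → W →L[ℝ] E} {K : Set E} {L a b : ℝ}

theorem SolvesOn.norm_sub_le_of_integral_norm_sub_le {u v : ℝ → W} {ξ ζ : ℝ → E} {t : ℝ}
    (hB : SecondOrderBounded B K L) (hξ : SolvesOn B u a b ξ) (hζ : SolvesOn B v a b ζ)
    (hξK : ∀ t ∈ Icc a b, ξ t ∈ K) (hζK : ∀ t ∈ Icc a b, ζ t ∈ K)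
    (hu : IntervalIntegrable u volume a b) (hv : IntervalIntegrable v volume a b)
    (hsmall : L * ∫ s in a..b, ‖v s‖ ≤ 1 / 2) (ht : t ∈ Icc a b) :
    ‖ζ t - ξ t‖ ≤ 2 * (‖ζ a - ξ a‖ + L * ∫ s in a..b, ‖v s - u s‖) := by
  refine hξ.norm_sub_le_of_integral_le hB hζ hξK hζK hu hv hsmall (fun t ht => ?_) ht
  have hab : a ≤ b := ht.1.trans ht.2
  have hdiff : IntervalIntegrable (fun s => ‖v s - u s‖) volume a b := (hv.sub hu).norm
  have hL : 0 ≤ L := (norm_nonneg _).trans (hB.bound _ (hξK a (left_mem_Icc.2 hab)))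
  calc ‖∫ s in a..t, B (ξ s) (v s - u s)‖ ≤ ∫ s in a..t, L * ‖v s - u s‖ :=
        intervalIntegral.norm_integral_le_of_norm_le ht.1 (ae_of_all _ fun s hs =>
          (B (ξ s)).le_of_opNorm_le (hB.bound _ (hξK s ⟨hs.1.le, hs.2.trans ht.2⟩)) _)
          (intervalIntegrable_of_mem_Icc (hdiff.const_mul L) (left_mem_Icc.2 hab) ht)
    _ ≤ L * ∫ s in a..b, ‖v s - u s‖ := by
        rw [intervalIntegral.integral_const_mul]
        exact mul_le_mul_of_nonneg_left (intervalIntegral.integral_mono_interval le_rfl ht.1 ht.2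
          (ae_of_all _ fun s => norm_nonneg _) hdiff) hL

theorem SolvesOn.hasSmallDifferences {U : Fin 3 → ℝ → W} {ξ : Fin 3 → ℝ → E}
    {C D R s : ℝ} (hab : a ≤ b) (hB : SecondOrderBounded B K L)
    (hξ : ∀ j, SolvesOn B (U j) a b (ξ j)) (hK : ∀ j, ∀ t ∈ Icc a b, ξ j t ∈ K)
    (hU : ∀ j, IntervalIntegrable (U j) volume a b)
    (hdiff : ∀ᵐ t, t ∈ uIoc a b → U 1 t - U 0 t = U 2 t - U 1 t)
    (hsmall : ∀ j, L * ∫ t in a..b, ‖U j t‖ ≤ 1 / 2)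
    (hR : ∫ t in a..b, ‖U 1 t - U 0 t‖ ≤ R * s) (hC : 0 ≤ C) (hR0 : 0 ≤ R)
    (hD : D = 2 * (C + L * R)) (h : HasSmallDifferences C s (fun j => ξ j a)) :
    HasSmallDifferences (D + 2 * (C + (2 * D ^ 2 + 2 * L * D * R))) s (fun j => ξ j b) := by
  have hL : 0 ≤ L := (norm_nonneg _).trans (hB.bound _ (hK 0 a (left_mem_Icc.2 hab)))
  have hR' : ∫ t in a..b, ‖U 2 t - U 1 t‖ ≤ R * s := by
    have hcongr : ∫ t in a..b, ‖U 1 t - U 0 t‖ = ∫ t in a..b, ‖U 2 t - U 1 t‖ :=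
      intervalIntegral.integral_congr_ae (hdiff.mono fun t ht hmem => by rw [ht hmem])
    exact hcongr ▸ hR
  have hfirst : ∀ t ∈ Icc a b, ‖ξ 1 t - ξ 0 t‖ ≤ D * s := fun t ht =>
    ((hξ 0).norm_sub_le_of_integral_norm_sub_le hB (hξ 1) (hK 0) (hK 1) (hU 0) (hU 1) (hsmall 1)
      ht).trans (by rw [hD]; linarith [h.first, mul_le_mul_of_nonneg_left hR hL])
  have hfirst' : ∀ t ∈ Icc a b, ‖ξ 2 t - ξ 1 t‖ ≤ D * s := fun t ht =>
    ((hξ 1).norm_sub_le_of_integral_norm_sub_le hB (hξ 2) (hK 1) (hK 2) (hU 1) (hU 2) (hsmall 2)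
      ht).trans (by rw [hD]; linarith [h.first', mul_le_mul_of_nonneg_left hR' hL])
  have hbI := right_mem_Icc.2 hab
  have hD0 : 0 ≤ D := by rw [hD]; positivity
  have hDs : 0 ≤ D * s := (norm_nonneg _).trans (hfirst b hbI)
  have hCs : 0 ≤ C * s := (norm_nonneg _).trans h.first
  have hslack : 0 ≤ 2 * (C + (2 * D ^ 2 + 2 * L * D * R)) * s := by
    have : 0 ≤ 4 * D * (D * s) + 4 * L * R * (D * s) := by positivity
    linarith
  have hsecond := SolvesOn.norm_second_difference_le hab hB (hξ 0) (hξ 1) (hξ 2) (hK 0) (hK 1)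
    (hK 2) (hU 0) (hU 1) (hU 2) hdiff (hsmall 1) hfirst hfirst'
  refine ⟨(hfirst b hbI).trans (by linarith), (hfirst' b hbI).trans (by linarith),
    hsecond.trans ?_⟩
  have : 2 * L * (D * s) * ∫ t in a..b, ‖U 2 t - U 1 t‖ ≤ 2 * L * (D * s) * (R * s) := by gcongr
  have : 0 ≤ D * s ^ 2 := by positivity
  linarith [h.second]

end SmallDifferences

section SecondDifferences

variable {n d : ℕ} {M : Type*} [TopologicalSpace M] [ChartedSpace (EuclideanSpace ℝ (Fin n)) M]
  [IsManifold (𝓡 n) ∞ M] {ι : Type*} {l : Filter ι} {σ : ι → ℝ}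

/-- Along `l`, the first differences of three families of points of `M`, in the chart at `c`, are
`O(σ)` and their second difference is `O(σ ^ 2)`. -/
def SmallDifferencesAt (n : ℕ) {M : Type*} [TopologicalSpace M]
    [ChartedSpace (EuclideanSpace ℝ (Fin n)) M] (l : Filter ι) (σ : ι → ℝ) (c : M)
    (m : Fin 3 → ι → M) : Prop :=
  ∃ C, 0 ≤ C ∧ ∀ᶠ i in l, HasSmallDifferences C (σ i) (fun j => extChartAt (𝓡 n) c (m j i))

theorem SmallDifferencesAt.change_chart {c c' q : M} {m : Fin 3 → ι → M}
    (h : SmallDifferencesAt n l σ c m) (hm : ∀ j, Tendsto (m j) l (𝓝 q))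
    (hq : q ∈ (chartAt (EuclideanSpace ℝ (Fin n)) c).source)
    (hq' : q ∈ (chartAt (EuclideanSpace ℝ (Fin n)) c').source) :
    SmallDifferencesAt n l σ c' m := by
  obtain ⟨C, hC, hev⟩ := h
  obtain ⟨r, hr, hball⟩ := Metric.nhds_basis_closedBall.mem_iff.1
    ((isOpen_coordDomain c c').mem_nhds (extChartAt_mem_coordDomain hq hq'))
  obtain ⟨L, hL, hbounded⟩ := exists_secondOrderBounded_closedBall (isOpen_coordDomain c c')
    (by exact_mod_cast contDiffOn_infty.1 (contDiffOn_coordChange c c') 2) hball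
  have hmem : ∀ᶠ i in l, ∀ j,
      m j i ∈ chartPreimage c (Metric.ball (extChartAt (𝓡 n) c q) r) :=
    eventually_all.2 fun j => (hm j).eventually
      ((isOpen_chartPreimage c Metric.isOpen_ball).mem_nhds ⟨hq, Metric.mem_ball_self hr⟩)
  refine ⟨L * (C + (2 * C) ^ 2) + L * C, by positivity, ?_⟩
  filter_upwards [hev, hmem] with i hi hmi
  simpa only [coordChange_extChartAt (hmi _).1] using hbounded.hasSmallDifferences_comp hC
    (fun j => Metric.ball_subset_closedBall (hmi j).2) hi

variable {p : ℝ≥0∞} [Fact (1 ≤ p)] {X₀ : (q : M) → TangentSpace (𝓡 n) q}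
  {X : Fin d → (q : M) → TangentSpace (𝓡 n) q} {u : Fin 3 → ι → Control d p} {v : Control d p}
  {R : ℝ} {γ : Fin 3 → ι → ℝ → M} {γ₀ : ℝ → M}

omit [IsManifold (𝓡 n) ∞ M] in
theorem IsTube.smallDifferencesAt {c : M} {K : Set (EuclideanSpace ℝ (Fin n))} {L a b : ℝ}
    (htube : IsTube p X₀ X R γ₀ c K L a b) (ha : 0 ≤ a) (hab : a ≤ b) (hb : b ≤ 1)
    (hu : ∀ j i, ‖u j i‖ ≤ R) (hR : 0 ≤ R) (hdiff : ∀ i, u 1 i - u 0 i = u 2 i - u 1 i)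
    (hσ : ∀ i, ‖u 1 i - u 0 i‖ ≤ R * σ i) (hγ : ∀ j i, SolvesChartwiseOn X₀ X (u j i) 0 1 (γ j i))
    (hlim : ∀ j, Tendsto (fun i => γ j i a) l (𝓝 (γ₀ a)))
    (h : SmallDifferencesAt n l σ c (fun j i => γ j i a)) :
    SmallDifferencesAt n l σ c (fun j i => γ j i b) := by
  obtain ⟨C, hC, hev⟩ := h
  have haI : a ∈ Icc (0 : ℝ) 1 := ⟨ha, hab.trans hb⟩
  have hbI : b ∈ Icc (0 : ℝ) 1 := ⟨ha.trans hab, hb⟩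
  have hL : 0 ≤ L := (norm_nonneg _).trans
    (htube.secondOrderBounded.bound _ (htube.mapsTo (left_mem_Icc.2 hab)).2)
  have hmaps : ∀ᶠ i in l, ∀ j, MapsTo (γ j i) (Icc a b) (chartPreimage c K) :=
    eventually_all.2 fun j => ((hlim j).eventually htube.eventually_mapsTo).mono fun i hi =>
      hi (u j i) (γ j i) (hu j i) (hγ j i) rfl
  refine ⟨_, ?_, (hev.and hmaps).mono fun i hi => SolvesOn.hasSmallDifferences hab
    htube.secondOrderBounded (fun j => (hγ j i).solvesOn c a b ha hab hb fun t ht => (hi.2 j ht).1)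
    (fun j t ht => (hi.2 j ht).2) (fun j => intervalIntegrable_extendedControl (u j i) haI hbI) ?_
    (fun j => htube.integral_le _ (hu j i))
    ((integral_norm_extendedControl_sub_le (u 1 i) (u 0 i) ha hab hb).trans (hσ i)) hC hR rfl hi.1⟩
  · positivity
  · filter_upwards [ae_extendedControl_sub (u 1 i) (u 0 i) haI hbI,
      ae_extendedControl_sub (u 2 i) (u 1 i) haI hbI] with s hs hs' hmem
    rw [hs hmem, hs' hmem, hdiff]

theorem smallDifferencesAt_solution [T2Space M] (hp : 1 < p) (hp_top : p ≠ ⊤)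
    (hX₀ : IsSmoothField X₀) (hX : ∀ i, IsSmoothField (X i)) (hu : ∀ j i, ‖u j i‖ ≤ R)
    (hv : ‖v‖ ≤ R) (h : ∀ j, PrimitiveTendsto l (u j) v)
    (hdiff : ∀ i, u 1 i - u 0 i = u 2 i - u 1 i) (hσ : ∀ i, ‖u 1 i - u 0 i‖ ≤ R * σ i)
    (hγ : ∀ j i, SolvesChartwiseOn X₀ X (u j i) 0 1 (γ j i))
    (hγ₀ : SolvesChartwiseOn X₀ X v 0 1 γ₀) (hinit : ∀ j i, γ j i 0 = γ₀ 0) :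
    ∀ t ∈ Icc (0 : ℝ) 1, SmallDifferencesAt n l σ (γ₀ t) (fun j i => γ j i t) := by
  have hlim : ∀ j, ∀ t ∈ Icc (0 : ℝ) 1, Tendsto (fun i => γ j i t) l (𝓝 (γ₀ t)) := fun j =>
    tendsto_solution hp hp_top hX₀ hX (hu j) hv (h j) (hγ j) hγ₀ (hinit j)
  refine forall_mem_Icc_of_isTube_step hp hp_top hX₀ hX R hγ₀.continuousOn ?_
    fun c K L a b ha hab hb htube hPa => ?_
  · refine ⟨0, le_rfl, Eventually.of_forall fun i => ⟨?_, ?_, ?_⟩⟩ <;>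
      simp [hinit, two_smul]
  have haI : a ∈ Icc (0 : ℝ) 1 := ⟨ha, hab.trans hb⟩
  have hbI : b ∈ Icc (0 : ℝ) 1 := ⟨ha.trans hab, hb⟩
  have hstart := hPa.change_chart (hlim · a haI) (mem_chart_source _ _)
    (htube.mapsTo (left_mem_Icc.2 hab)).1
  exact (htube.smallDifferencesAt ha hab hb hu ((norm_nonneg _).trans hv) hdiff hσ hγ
    (hlim · a haI) hstart).change_chart (hlim · b hbI) (htube.mapsTo (right_mem_Icc.2 hab)).1
    (mem_chart_source _ _)

end SecondDifferences

section Slope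

variable {E : Type*} [NormedAddCommGroup E] [NormedSpace ℝ E]

theorem norm_slope_two_mul_sub_slope_le {φ : ℝ → E} {C s : ℝ} (hs : 0 < s)
    (h : ‖φ (2 * s) - (2 : ℝ) • φ s + φ 0‖ ≤ C * s ^ 2) :
    ‖slope φ 0 (2 * s) - slope φ 0 s‖ ≤ C * s / 2 := by
  have hs' : s ≠ 0 := hs.ne'
  have hslope : slope φ 0 (2 * s) - slope φ 0 s =
      (2 * s)⁻¹ • (φ (2 * s) - (2 : ℝ) • φ s + φ 0) := by
    simp only [slope_def_module, sub_zero]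
    match_scalars <;> field_simp
    ring
  rw [hslope, norm_smul, Real.norm_of_nonneg (by positivity)]
  calc (2 * s)⁻¹ * ‖φ (2 * s) - (2 : ℝ) • φ s + φ 0‖ ≤ (2 * s)⁻¹ * (C * s ^ 2) := by gcongr
    _ = C * s / 2 := by field_simp

theorem norm_slope_sub_le_of_second_difference {φ : ℝ → E} {a : E} {C s₀ s : ℝ}
    (hφ : HasDerivAt φ a 0)
    (h : ∀ s ∈ Ioo 0 s₀, ‖φ (2 * s) - (2 : ℝ) • φ s + φ 0‖ ≤ C * s ^ 2) (hs : s ∈ Ioo 0 s₀) :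
    ‖slope φ 0 s - a‖ ≤ C * s / 2 := by
  have hmem : ∀ k : ℕ, s / 2 ^ k ∈ Ioo 0 s₀ := fun k => ⟨div_pos hs.1 (by positivity),
    (div_le_self hs.1.le (one_le_pow₀ one_le_two)).trans_lt hs.2⟩
  have hzero : Tendsto (fun k : ℕ => s / 2 ^ k) atTop (𝓝[≠] 0) :=
    tendsto_nhdsWithin_iff.2 ⟨by
      simpa [div_eq_mul_inv] using
        (tendsto_pow_atTop_nhds_zero_of_lt_one (r := (2⁻¹ : ℝ)) (by norm_num)
          (by norm_num)).const_mul s, Eventually.of_forall fun k => (hmem k).1.ne'⟩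
  have hstep : ∀ k : ℕ, dist (slope φ 0 (s / 2 ^ k)) (slope φ 0 (s / 2 ^ (k + 1))) ≤
      C * s / 2 / 2 / 2 ^ k := fun k => by
    have hdouble : 2 * (s / 2 ^ (k + 1)) = s / 2 ^ k := by ring
    have hk := norm_slope_two_mul_sub_slope_le (hmem (k + 1)).1 (h _ (hmem (k + 1)))
    rw [hdouble] at hk
    rw [dist_eq_norm]
    exact hk.trans_eq (by ring)
  simpa only [pow_zero, div_one, dist_eq_norm] using dist_le_of_le_geometric_two_of_tendsto₀
    hstep ((hasDerivAt_iff_tendsto_slope.1 hφ).comp hzero)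

theorem tendsto_of_second_difference_le {ι : Type*} {l : Filter ι} {φ : ι → ℝ → E} {φ₀ : ℝ → E}
    {a : ι → E} {a₀ : E} {C s₀ : ℝ} (hs₀ : 0 < s₀) (hφ : ∀ i, HasDerivAt (φ i) (a i) 0)
    (hφ₀ : HasDerivAt φ₀ a₀ 0)
    (h : ∀ᶠ i in l, ∀ s ∈ Ioo 0 s₀,
      ‖φ i (2 * s) - (2 : ℝ) • φ i s + φ i 0‖ ≤ C * s ^ 2)
    (hlim : ∀ᶠ s in 𝓝[≥] 0, Tendsto (fun i => φ i s) l (𝓝 (φ₀ s))) :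
    Tendsto a l (𝓝 a₀) := by
  have hlim_zero : Tendsto (fun i => φ i 0) l (𝓝 (φ₀ 0)) := hlim.self_of_nhdsWithin self_mem_Ici
  have hlim_slope : ∀ᶠ s in 𝓝[>] 0, Tendsto (fun i => slope (φ i) 0 s) l (𝓝 (slope φ₀ 0 s)) :=
    (hlim.filter_mono (nhdsWithin_mono 0 Ioi_subset_Ici_self)).mono fun s hs =>
      (hs.sub hlim_zero).const_smul _
  refine TendstoUniformlyOnFilter.tendsto_of_eventually_tendsto (p := 𝓝[>] (0 : ℝ))
    (F := fun s i => slope (φ i) 0 s) ?_ hlim_slope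
    ((hasDerivAt_iff_tendsto_slope.1 hφ₀).mono_left (nhdsWithin_mono 0 fun _ hs => ne_of_gt hs))
  have hsmall : Tendsto (fun s : ℝ => C * s / 2) (𝓝[>] 0) (𝓝 0) := by
    have : Continuous fun s : ℝ => C * s / 2 := by fun_prop
    simpa using (this.tendsto 0).mono_left nhdsWithin_le_nhds
  refine Metric.tendstoUniformlyOnFilter_iff.2 fun ε hε => ?_
  filter_upwards [((hsmall.eventually (gt_mem_nhds hε)).and (Ioo_mem_nhdsGT hs₀)).prod_mk h]
    with i hi
  rw [dist_comm, dist_eq_norm]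
  exact (norm_slope_sub_le_of_second_difference (hφ _) hi.2 hi.1.2).trans_lt hi.1.1

end Slope

section Endpoint

variable {n d : ℕ} {M : Type*} [TopologicalSpace M] [ChartedSpace (EuclideanSpace ℝ (Fin n)) M]
  {p : ℝ≥0∞} {X₀ : (q : M) → TangentSpace (𝓡 n) q}
  {X : Fin d → (q : M) → TangentSpace (𝓡 n) q} {x y : M}

theorem exists_isTrajectory_endpoint {u : Control d p} (hu : u ∈ admissible p X₀ X x) :
    ∃ γ, IsTrajectory X₀ X x u γ ∧ γ 1 = endpoint X₀ X x u := by
  have hexists : ∃ γ : ℝ → M, IsTrajectory X₀ X x u γ := hu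
  exact ⟨hexists.choose, hexists.choose_spec, by rw [endpoint, dif_pos hexists]⟩

/-- The endpoint map read in the chart at `y`. -/
noncomputable def chartEndpoint (X₀ : (q : M) → TangentSpace (𝓡 n) q)
    (X : Fin d → (q : M) → TangentSpace (𝓡 n) q) (x y : M) (u : Control d p) :
    EuclideanSpace ℝ (Fin n) :=
  extChartAt (𝓡 n) y (endpoint X₀ X x u)

variable [Fact (1 ≤ p)]

/-- The differential of the endpoint map at `u`, with its values in the model space, to which every
tangent space of `M` is definitionally equal. The operators at different `u` can thus be
compared. -/
noncomputable def endpointDerivative (X₀ : (q : M) → TangentSpace (𝓡 n) q)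
    (X : Fin d → (q : M) → TangentSpace (𝓡 n) q) (x : M) (u : Control d p) :
    Control d p →L[ℝ] EuclideanSpace ℝ (Fin n) :=
  endpointDifferential X₀ X x u

-- `mfderiv` takes the junk value `0` at points of nondifferentiability; surjectivity excludes
-- this, unless `M` is zero-dimensional.
theorem hasFDerivAt_chartEndpoint {u : Control d p} (hu : endpoint X₀ X x u = y)
    (hsurj : Function.Surjective (endpointDifferential X₀ X x u)) :
    HasFDerivAt (chartEndpoint X₀ X x y) (endpointDerivative X₀ X x u) u := by
  subst hu
  by_cases h : MDifferentiableAt 𝓘(ℝ, Control d p) (𝓡 n) (endpoint X₀ X x : Control d p → M) u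
  · have hderiv := h.hasMFDerivAt.2
    rw [ModelWithCorners.range_eq_univ] at hderiv
    exact hasFDerivWithinAt_univ.1 hderiv
  · have hzero : endpointDerivative X₀ X x u = 0 := mfderiv_zero_of_not_mdifferentiableAt h
    have : Subsingleton (EuclideanSpace ℝ (Fin n)) := subsingleton_of_forall_eq 0 fun e => by
      obtain ⟨w, hw⟩ := hsurj e
      exact hw.symm.trans (DFunLike.congr_fun hzero w)
    rw [hzero, Subsingleton.elim (chartEndpoint X₀ X x _) fun _ => 0]
    exact hasFDerivAt_const 0 u

variable [IsManifold (𝓡 n) ∞ M] [T2Space M] {ι : Type*} {l : Filter ι}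

theorem tendsto_endpoint (hp : 1 < p) (hp_top : p ≠ ⊤)
    (hX₀ : IsSmoothField X₀) (hX : ∀ i, IsSmoothField (X i))
    (hall : ∀ u : Control d p, u ∈ admissible p X₀ X x) {u : ι → Control d p} {v : Control d p}
    {R : ℝ} (hu : ∀ i, ‖u i‖ ≤ R) (h : PrimitiveTendsto l u v) :
    Tendsto (fun i => endpoint X₀ X x (u i)) l (𝓝 (endpoint X₀ X x v)) := by
  choose γ hγ hγ_one using fun u => exists_isTrajectory_endpoint (hall u)
  have hsolution := tendsto_solution hp hp_top hX₀ hX (fun i => (hu i).trans (le_max_left R ‖v‖))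
    (le_max_right R ‖v‖) h (fun i => (hγ (u i)).solvesChartwiseOn hX₀ hX)
    ((hγ v).solvesChartwiseOn hX₀ hX)
    (fun i => (hγ (u i)).initial.trans (hγ v).initial.symm) 1 (right_mem_Icc.2 zero_le_one)
  simpa only [hγ_one] using hsolution

theorem endpoint_eq_of_primitiveTendsto [l.NeBot] (hp : 1 < p) (hp_top : p ≠ ⊤)
    (hX₀ : IsSmoothField X₀) (hX : ∀ i, IsSmoothField (X i))
    (hall : ∀ u : Control d p, u ∈ admissible p X₀ X x) {u : ι → Control d p} {v : Control d p}
    {R : ℝ} (hu : ∀ i, ‖u i‖ ≤ R) (huy : ∀ i, endpoint X₀ X x (u i) = y)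
    (h : PrimitiveTendsto l u v) : endpoint X₀ X x v = y := by
  have hlim := tendsto_endpoint hp hp_top hX₀ hX hall hu h
  simp only [huy] at hlim
  exact tendsto_nhds_unique hlim tendsto_const_nhds

theorem continuous_endpoint (hp : 1 < p) (hp_top : p ≠ ⊤)
    (hX₀ : IsSmoothField X₀) (hX : ∀ i, IsSmoothField (X i))
    (hall : ∀ u : Control d p, u ∈ admissible p X₀ X x) :
    Continuous (endpoint X₀ X x : Control d p → M) := by
  refine SeqContinuous.continuous fun u v huv => ?_
  obtain ⟨R, hR⟩ := huv.norm.bddAbove_range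
  exact tendsto_endpoint hp hp_top hX₀ hX hall (fun k => hR (mem_range_self k))
    (PrimitiveTendsto.of_tendsto huv)

omit [TopologicalSpace M] [ChartedSpace (EuclideanSpace ℝ (Fin n)) M] [IsManifold (𝓡 n) ∞ M]
  [T2Space M] in
theorem PrimitiveTendsto.add_smul {u w : ι → Control d p} {v : Control d p} {c : ι → ℝ} {R : ℝ}
    (h : PrimitiveTendsto l u v) (hc : Tendsto c l (𝓝 0)) (hw : ∀ i, ‖w i‖ ≤ R) :
    PrimitiveTendsto l (fun i => u i + c i • w i) v := by
  have hsmul : Tendsto (fun i => c i • w i) l (𝓝 0) :=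
    NormedField.tendsto_zero_smul_of_tendsto_zero_of_bounded hc (isBoundedUnder_of ⟨R, hw⟩)
  simpa only [add_zero] using h.add (.of_tendsto hsmul)

theorem smallDifferencesAt_endpoint (hp : 1 < p) (hp_top : p ≠ ⊤)
    (hX₀ : IsSmoothField X₀) (hX : ∀ i, IsSmoothField (X i))
    (hall : ∀ u : Control d p, u ∈ admissible p X₀ X x) {u w : ι → Control d p} {v : Control d p}
    {R : ℝ} (hu : ∀ i, ‖u i‖ ≤ R) (hw : ∀ i, ‖w i‖ ≤ R) (hv : ‖v‖ ≤ R) (h : PrimitiveTendsto l u v)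
    {σ : ι → ℝ} (hσ : ∀ i, σ i ∈ Icc (0 : ℝ) 1) (hσ_lim : Tendsto σ l (𝓝 0)) :
    SmallDifferencesAt n l σ (endpoint X₀ X x v) fun j i =>
      endpoint X₀ X x (u i + (((j : ℕ) : ℝ) * σ i) • w i) := by
  choose γ hγ hγ_one using fun u => exists_isTrajectory_endpoint (hall u)
  have hR : 0 ≤ R := (norm_nonneg _).trans hv
  set U : Fin 3 → ι → Control d p := fun j i => u i + (((j : ℕ) : ℝ) * σ i) • w i with hU
  have hbound : ∀ j i, ‖U j i‖ ≤ 3 * R := fun j i => by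
    have hj : ((j : ℕ) : ℝ) ≤ 2 := by exact_mod_cast Nat.lt_succ_iff.1 j.2
    have hjσ : ‖((j : ℕ) : ℝ) * σ i‖ ≤ 2 := by
      rw [Real.norm_of_nonneg (mul_nonneg (Nat.cast_nonneg _) (hσ i).1)]
      nlinarith [(hσ i).1, (hσ i).2]
    calc ‖U j i‖ ≤ ‖u i‖ + ‖((j : ℕ) : ℝ) * σ i‖ * ‖w i‖ :=
          (norm_add_le _ _).trans_eq (by rw [norm_smul])
      _ ≤ R + 2 * R := by gcongr; exacts [hu i, hw i]
      _ = 3 * R := by ring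
  have hstep : ∀ i, U 1 i - U 0 i = σ i • w i := fun i => by simp [hU]
  have hstep' : ∀ i, U 2 i - U 1 i = σ i • w i := fun i => by
    simp only [hU, Fin.val_two, Fin.val_one, Nat.cast_ofNat, Nat.cast_one]
    module
  have hsolution := smallDifferencesAt_solution (σ := σ) (γ := fun j i => γ (U j i)) hp hp_top
    hX₀ hX hbound (by linarith)
    (fun j => h.add_smul (by simpa using hσ_lim.const_mul ((j : ℕ) : ℝ)) hw)
    (fun i => (hstep i).trans (hstep' i).symm)
    (fun i => by
      rw [hstep, norm_smul, Real.norm_of_nonneg (hσ i).1]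
      nlinarith [mul_le_mul_of_nonneg_left (hw i) (hσ i).1, mul_nonneg hR (hσ i).1])
    (fun j i => (hγ _).solvesChartwiseOn hX₀ hX) ((hγ v).solvesChartwiseOn hX₀ hX)
    (fun j i => (hγ _).initial.trans (hγ v).initial.symm) 1 (right_mem_Icc.2 zero_le_one)
  simpa only [hγ_one] using hsolution

theorem exists_second_difference_chartEndpoint_le (hp : 1 < p) (hp_top : p ≠ ⊤)
    (hX₀ : IsSmoothField X₀) (hX : ∀ i, IsSmoothField (X i))
    (hall : ∀ u : Control d p, u ∈ admissible p X₀ X x) {u w : ι → Control d p} {v : Control d p}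
    {R : ℝ} (hu : ∀ i, ‖u i‖ ≤ R) (hw : ∀ i, ‖w i‖ ≤ R) (hv : ‖v‖ ≤ R)
    (hvy : endpoint X₀ X x v = y) (h : PrimitiveTendsto l u v) :
    ∃ C, ∃ s₀ > 0, ∀ᶠ i in l, ∀ s ∈ Ioo 0 s₀,
      ‖chartEndpoint X₀ X x y (u i + (2 * s) • w i) -
        (2 : ℝ) • chartEndpoint X₀ X x y (u i + s • w i) +
        chartEndpoint X₀ X x y (u i + (0 : ℝ) • w i)‖ ≤ C * s ^ 2 := by
  have hsmall := smallDifferencesAt_endpoint (l := l ×ˢ 𝓝 (0 : Icc (0 : ℝ) 1))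
    (σ := fun i => i.2) hp hp_top hX₀ hX hall (fun i => hu i.1) (fun i => hw i.1) hv
    (h.comp tendsto_fst) (fun i => i.2.2) ((continuous_subtype_val.tendsto _).comp tendsto_snd)
  obtain ⟨C, -, hev⟩ := hsmall
  obtain ⟨P, hP, Q, hQ, hPQ⟩ := eventually_prod_iff.1 hev
  obtain ⟨s₀, hs₀, hball⟩ := Metric.eventually_nhds_iff.1 hQ
  refine ⟨C, min s₀ 1, by positivity, ?_⟩
  filter_upwards [hP] with i hi s hs
  have hs_one : s ∈ Icc (0 : ℝ) 1 := ⟨hs.1.le, hs.2.le.trans (min_le_right _ _)⟩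
  have hdist : dist (⟨s, hs_one⟩ : Icc (0 : ℝ) 1) 0 < s₀ := by
    rw [Subtype.dist_eq, Icc.coe_zero, Real.dist_0_eq_abs, abs_of_pos hs.1]
    exact hs.2.trans_le (min_le_left _ _)
  subst hvy
  simpa [chartEndpoint] using (hPQ hi (hball hdist)).second

theorem eventually_tendsto_chartEndpoint (hp : 1 < p) (hp_top : p ≠ ⊤)
    (hX₀ : IsSmoothField X₀) (hX : ∀ i, IsSmoothField (X i))
    (hall : ∀ u : Control d p, u ∈ admissible p X₀ X x) {u w : ι → Control d p}
    {v z : Control d p} {R : ℝ} (hu : ∀ i, ‖u i‖ ≤ R) (hw : ∀ i, ‖w i‖ ≤ R)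
    (hvy : endpoint X₀ X x v = y) (h : PrimitiveTendsto l u v) (h' : PrimitiveTendsto l w z) :
    ∀ᶠ s : ℝ in 𝓝 0, Tendsto (fun i => chartEndpoint X₀ X x y (u i + s • w i)) l
      (𝓝 (chartEndpoint X₀ X x y (v + s • z))) := by
  have hline : Tendsto (fun s : ℝ => endpoint X₀ X x (v + s • z)) (𝓝 0) (𝓝 y) := by
    have hcont : Continuous fun s : ℝ => endpoint X₀ X x (v + s • z) :=
      (continuous_endpoint hp hp_top hX₀ hX hall).comp (by fun_prop)
    simpa only [zero_smul, add_zero, hvy] using hcont.tendsto 0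
  filter_upwards [hline.eventually (extChartAt_source_mem_nhds (I := 𝓡 n) y)] with s hs
  have hbound : ∀ i, ‖u i + s • w i‖ ≤ R + ‖s‖ * R := fun i =>
    (norm_add_le _ _).trans (by rw [norm_smul]; gcongr; exacts [hu i, hw i])
  exact (continuousAt_extChartAt' hs).tendsto.comp
    (tendsto_endpoint hp hp_top hX₀ hX hall hbound (h.add (h'.const_smul s)))

theorem tendsto_endpointDerivative [l.NeBot] (hp : 1 < p) (hp_top : p ≠ ⊤)
    (hX₀ : IsSmoothField X₀) (hX : ∀ i, IsSmoothField (X i))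
    (hall : ∀ u : Control d p, u ∈ admissible p X₀ X x) (hy : IsRegularValue p X₀ X x y)
    {u w : ι → Control d p} {v z : Control d p} {R : ℝ} (hu : ∀ i, ‖u i‖ ≤ R)
    (hw : ∀ i, ‖w i‖ ≤ R) (huy : ∀ i, endpoint X₀ X x (u i) = y) (h : PrimitiveTendsto l u v)
    (h' : PrimitiveTendsto l w z) :
    Tendsto (fun i => endpointDerivative X₀ X x (u i) (w i)) l
      (𝓝 (endpointDerivative X₀ X x v z)) := by
  have hvy := endpoint_eq_of_primitiveTendsto hp hp_top hX₀ hX hall hu huy h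
  have hderiv : ∀ u w : Control d p, endpoint X₀ X x u = y →
      HasDerivAt (fun s : ℝ => chartEndpoint X₀ X x y (u + s • w))
        (endpointDerivative X₀ X x u w) 0 := fun u w huy => by
    have hline : HasDerivAt (fun s : ℝ => u + s • w) w 0 := by
      simpa using ((hasDerivAt_id (0 : ℝ)).smul_const w).const_add u
    have hchart : HasFDerivAt (chartEndpoint X₀ X x y) (endpointDerivative X₀ X x u)
        (u + (0 : ℝ) • w) := by
      rw [zero_smul, add_zero]
      exact hasFDerivAt_chartEndpoint huy (hy u ⟨hall u, huy⟩)
    exact hchart.comp_hasDerivAt 0 hline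
  obtain ⟨C, s₀, hs₀, hsecond⟩ := exists_second_difference_chartEndpoint_le hp hp_top hX₀ hX hall
    (fun i => (hu i).trans (le_max_left R ‖v‖)) (fun i => (hw i).trans (le_max_left R ‖v‖))
    (le_max_right R ‖v‖) hvy h
  exact tendsto_of_second_difference_le hs₀ (fun i => hderiv _ (w i) (huy i)) (hderiv v z hvy)
    hsecond ((eventually_tendsto_chartEndpoint hp hp_top hX₀ hX hall hu hw hvy h h').filter_mono
      nhdsWithin_le_nhds)

end Endpoint

section UniformPreimage

variable {κ : Type*} {l : Filter κ} {Z E : Type*} [NormedAddCommGroup Z] [NormedSpace ℝ Z]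
  [NormedAddCommGroup E] [NormedSpace ℝ E] [FiniteDimensional ℝ E]

theorem tendsto_clm_of_tendsto_apply {T : κ → E →L[ℝ] Z} {T₀ : E →L[ℝ] Z}
    (hT : ∀ e, Tendsto (fun k => T k e) l (𝓝 (T₀ e))) : Tendsto T l (𝓝 T₀) := by
  let b := Module.finBasis ℝ E
  obtain ⟨B, hB, hle⟩ := b.exists_opNorm_le (F := Z)
  refine Metric.tendsto_nhds.2 fun ε hε => ?_
  have hbasis : ∀ᶠ k in l, ∀ i, ‖(T k - T₀) (b i)‖ ≤ ε / (2 * B) := eventually_all.2 fun i =>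
    ((tendsto_iff_norm_sub_tendsto_zero.1 (hT (b i))).eventually
      (gt_mem_nhds (by positivity : 0 < ε / (2 * B)))).mono fun k hk => hk.le
  filter_upwards [hbasis] with k hk
  rw [dist_eq_norm]
  calc ‖T k - T₀‖ ≤ B * (ε / (2 * B)) := hle (M := ε / (2 * B)) (by positivity) hk
    _ = ε / 2 := by field_simp
    _ < ε := half_lt_self hε

theorem exists_uniform_preimage {A : κ → Z →L[ℝ] E} {A₀ : Z →L[ℝ] E}
    (hA₀ : Function.Surjective A₀) (hA : ∀ z, Tendsto (fun k => A k z) l (𝓝 (A₀ z))) :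
    ∃ C, ∀ᶠ k in l, ∀ e, ∃ z, A k z = e ∧ ‖z‖ ≤ C * ‖e‖ := by
  have := FiniteDimensional.complete ℝ E
  obtain ⟨S', hS'⟩ :=
    A₀.toLinearMap.exists_rightInverse_of_surjective (LinearMap.range_eq_top.2 hA₀)
  set S : E →L[ℝ] Z := LinearMap.toContinuousLinearMap S'
  have hAS : Tendsto (fun k => (A k).comp S) l (𝓝 (1 : E →L[ℝ] E)) :=
    tendsto_clm_of_tendsto_apply fun e => by
      have hSe := hA (S e)
      rwa [show A₀ (S e) = e from LinearMap.congr_fun hS' e] at hSe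
  have hinverse := ((NormedRing.inverse_continuousAt (1 : (E →L[ℝ] E)ˣ)).tendsto.comp hAS).norm
  refine ⟨‖S‖ * (‖Ring.inverse (1 : E →L[ℝ] E)‖ + 1), ?_⟩
  filter_upwards [hAS.eventually ((1 : (E →L[ℝ] E)ˣ).nhds),
    hinverse.eventually (gt_mem_nhds (lt_add_one _))] with k hunit hk e
  refine ⟨S (Ring.inverse ((A k).comp S) e),
    DFunLike.congr_fun (Ring.mul_inverse_cancel _ hunit) e, ?_⟩
  calc ‖S (Ring.inverse ((A k).comp S) e)‖ ≤ ‖S‖ * (‖Ring.inverse ((A k).comp S)‖ * ‖e‖) :=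
        (S.le_opNorm _).trans (by gcongr; exact ContinuousLinearMap.le_opNorm _ _)
    _ ≤ ‖S‖ * ((‖Ring.inverse (1 : E →L[ℝ] E)‖ + 1) * ‖e‖) := by gcongr; exact hk.le
    _ = ‖S‖ * (‖Ring.inverse (1 : E →L[ℝ] E)‖ + 1) * ‖e‖ := (mul_assoc _ _ _).symm

end UniformPreimage

section PalaisSmale

theorem cauchySeq_of_tendsto_fderiv_energy_sub {d : ℕ} {p : ℝ≥0∞} [Fact (1 ≤ p)]
    (hp : 1 < p) (hp_top : p ≠ ⊤) {u : ℕ → Control d p} {R : ℝ} (hu : ∀ k, ‖u k‖ ≤ R)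
    (h : Tendsto (fun i : ℕ × ℕ => fderiv ℝ energy (u i.1) (u i.1 - u i.2)) atTop (𝓝 0)) :
    CauchySeq u := by
  have hswap : Tendsto (fun i : ℕ × ℕ => fderiv ℝ energy (u i.2) (u i.2 - u i.1)) atTop (𝓝 0) := by
    rw [← prod_atTop_atTop_eq] at h ⊢
    exact h.comp (tendsto_snd.prodMk tendsto_fst)
  have hconvex : ConvexOn ℝ univ (energy : Control d p → ℝ) := convexOn_energy hp hp_top
  have hgap_le : ∀ i : ℕ × ℕ, midpointGap energy (u i.1) (u i.2) ≤
      (fderiv ℝ energy (u i.1) (u i.1 - u i.2) + fderiv ℝ energy (u i.2) (u i.2 - u i.1)) / 4 :=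
    fun i => midpointGap_le_fderiv_add_fderiv (E := Control d p) hconvex
      (differentiable_energy hp hp_top _) (differentiable_energy hp hp_top _)
  have hgap : Tendsto (fun i : ℕ × ℕ => midpointGap energy (u i.1) (u i.2)) atTop (𝓝 0) :=
    squeeze_zero (fun i => midpointGap_nonneg (E := Control d p) hconvex _ _) hgap_le
      (by simpa using (h.add hswap).div_const 4)
  rw [cauchySeq_iff_tendsto_dist_atTop_0]
  simpa only [dist_eq_norm] using tendsto_zero_iff_norm_tendsto_zero.1
    (tendsto_sub_of_midpointGap_energy hp hp_top (.of_forall fun i : ℕ × ℕ => hu i.1)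
      (.of_forall fun i => hu i.2) hgap)

variable {n d : ℕ} {M : Type*} [TopologicalSpace M] [ChartedSpace (EuclideanSpace ℝ (Fin n)) M]
  {p : ℝ≥0∞} [Fact (1 ≤ p)] {X₀ : (q : M) → TangentSpace (𝓡 n) q}
  {X : Fin d → (q : M) → TangentSpace (𝓡 n) q} {x y : M}

theorem norm_fderiv_energy_le_of_endpointDerivative_eq {u w z : Control d p}
    (hz : endpointDerivative X₀ X x u z = endpointDerivative X₀ X x u w) :
    ‖fderiv ℝ energy u w‖ ≤ ‖restrictedEnergyDifferential X₀ X x u‖ * (‖w‖ + ‖z‖) +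
      ‖fderiv ℝ (energy : Control d p → ℝ) u‖ * ‖z‖ := by
  have hker : w - z ∈ tangentFiber X₀ X x u :=
    show endpointDerivative X₀ X x u (w - z) = 0 by rw [map_sub, hz, sub_self]
  have htangent : ‖fderiv ℝ energy u (w - z)‖ ≤
      ‖restrictedEnergyDifferential X₀ X x u‖ * ‖w - z‖ :=
    (restrictedEnergyDifferential X₀ X x u).le_opNorm ⟨w - z, hker⟩
  calc ‖fderiv ℝ energy u w‖ = ‖fderiv ℝ energy u (w - z) + fderiv ℝ energy u z‖ := by
        rw [← map_add, sub_add_cancel]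
    _ ≤ ‖restrictedEnergyDifferential X₀ X x u‖ * ‖w - z‖ +
        ‖fderiv ℝ (energy : Control d p → ℝ) u‖ * ‖z‖ :=
      (norm_add_le _ _).trans (add_le_add htangent ((fderiv ℝ energy u).le_opNorm z))
    _ ≤ _ := by
      gcongr
      exact norm_sub_le w z

variable [IsManifold (𝓡 n) ∞ M] [T2Space M]

theorem tendsto_fderiv_energy_sub (hp : 1 < p) (hp_top : p ≠ ⊤) (hX₀ : IsSmoothField X₀)
    (hX : ∀ i, IsSmoothField (X i)) (hall : ∀ u : Control d p, u ∈ admissible p X₀ X x)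
    (hy : IsRegularValue p X₀ X x y) {u : ℕ → Control d p} {v : Control d p} {R : ℝ}
    (hu : ∀ k, ‖u k‖ ≤ R) (huy : ∀ k, endpoint X₀ X x (u k) = y) (huv : PrimitiveTendsto atTop u v)
    (hdiff : Tendsto (fun k => ‖restrictedEnergyDifferential X₀ X x (u k)‖) atTop (𝓝 0)) :
    Tendsto (fun i : ℕ × ℕ => fderiv ℝ energy (u i.1) (u i.1 - u i.2)) atTop (𝓝 0) := by
  rw [← prod_atTop_atTop_eq]
  have hsub : ∀ i : ℕ × ℕ, ‖u i.1 - u i.2‖ ≤ R + R := fun i =>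
    (norm_sub_le _ _).trans (add_le_add (hu _) (hu _))
  have hA : Tendsto (fun i : ℕ × ℕ => ‖endpointDerivative X₀ X x (u i.1) (u i.1 - u i.2)‖)
      (atTop ×ˢ atTop) (𝓝 0) := by
    have hweak : PrimitiveTendsto (atTop ×ˢ atTop) (fun i : ℕ × ℕ => u i.1 - u i.2) (v - v) :=
      (huv.comp tendsto_fst).sub (huv.comp tendsto_snd)
    simpa using (tendsto_endpointDerivative (u := fun i : ℕ × ℕ => u i.1) hp hp_top hX₀ hX hall hy
      (fun i => (hu i.1).trans (le_max_left R (R + R)))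
      (fun i => (hsub i).trans (le_max_right R (R + R))) (fun i => huy i.1)
      (huv.comp tendsto_fst) hweak).norm
  have hvy := endpoint_eq_of_primitiveTendsto hp hp_top hX₀ hX hall hu huy huv
  obtain ⟨C, hpre⟩ := exists_uniform_preimage (hy v ⟨hall v, hvy⟩) fun z =>
    tendsto_endpointDerivative hp hp_top hX₀ hX hall hy
      (fun i => (hu i).trans (le_max_left R ‖z‖)) (fun _ => le_max_right R ‖z‖) huy huv
      (.of_tendsto tendsto_const_nhds)
  obtain ⟨D, hD⟩ := exists_norm_fderiv_energy_le (d := d) hp hp_top R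
  have hbound : Tendsto (fun i : ℕ × ℕ => ‖restrictedEnergyDifferential X₀ X x (u i.1)‖ *
      (R + R + C * ‖endpointDerivative X₀ X x (u i.1) (u i.1 - u i.2)‖) +
      D * (C * ‖endpointDerivative X₀ X x (u i.1) (u i.1 - u i.2)‖)) (atTop ×ˢ atTop) (𝓝 0) := by
    have hrestricted : Tendsto (fun i : ℕ × ℕ => ‖restrictedEnergyDifferential X₀ X x (u i.1)‖)
      (atTop ×ˢ atTop) (𝓝 0) := hdiff.comp tendsto_fst
    simpa using (hrestricted.mul ((hA.const_mul C).const_add (R + R))).add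
      ((hA.const_mul C).const_mul D)
  refine squeeze_zero_norm' ?_ hbound
  filter_upwards [tendsto_fst.eventually hpre] with i hi
  obtain ⟨z, hz, hz_le⟩ := hi (endpointDerivative X₀ X x (u i.1) (u i.1 - u i.2))
  have hD_nonneg : 0 ≤ D := (norm_nonneg _).trans (hD _ (hu i.1))
  refine (norm_fderiv_energy_le_of_endpointDerivative_eq hz).trans ?_
  gcongr
  exacts [hsub i, hD _ (hu i.1)]

theorem isClosed_fiber (hp : 1 < p) (hp_top : p ≠ ⊤) (hX₀ : IsSmoothField X₀)
    (hX : ∀ i, IsSmoothField (X i)) (hall : ∀ u : Control d p, u ∈ admissible p X₀ X x) (y : M) :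
    IsClosed (fiber p X₀ X x y) := by
  have hfiber : fiber p X₀ X x y = endpoint X₀ X x ⁻¹' {y} :=
    Set.ext fun u => and_iff_right (hall u)
  rw [hfiber]
  exact isClosed_singleton.preimage (continuous_endpoint hp hp_top hX₀ hX hall)

end PalaisSmale

section LocalExistence

variable {E W : Type*} [NormedAddCommGroup E] [NormedSpace ℝ E] [NormedAddCommGroup W]
  [NormedSpace ℝ W]

/-- The Picard operator of the equation `ξ' = B(ξ) u`, `ξ a = x₀`, whose fixed points are the
solutions. -/
noncomputable def picard (B : E → W →L[ℝ] E) (u : ℝ → W) (a : ℝ) (x₀ : E) (ξ : ℝ → E) (t : ℝ) : E :=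
  x₀ + ∫ s in a..t, B (ξ s) (u s)

variable {B : E → W →L[ℝ] E} {K : Set E} {u : ℝ → W} {x₀ z : E} {a b r L t : ℝ} {ξ η : ℝ → E}

theorem continuousOn_picard (hab : a ≤ b) (hB : ContinuousOn B K)
    (hu : IntervalIntegrable u volume a b) (hξ : ContinuousOn ξ (Icc a b))
    (hξK : MapsTo ξ (Icc a b) K) : ContinuousOn (picard B u a x₀ ξ) (Icc a b) := by
  have hprimitive := intervalIntegral.continuousOn_primitive_interval'
    (intervalIntegrable_clm_apply hab (hB.comp hξ hξK) hu) left_mem_uIcc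
  rw [uIcc_of_le hab] at hprimitive
  exact continuousOn_const.add hprimitive

theorem picard_mem_closedBall (hB : ∀ x ∈ K, ‖B x‖ ≤ L) (hu : IntervalIntegrable u volume a b)
    (hsmall : L * ∫ s in a..b, ‖u s‖ ≤ r) (hξK : MapsTo ξ (Icc a b) K)
    (hx₀ : x₀ ∈ Metric.closedBall z r) (ht : t ∈ Icc a b) :
    picard B u a x₀ ξ t ∈ Metric.closedBall z (2 * r) := by
  rw [mem_closedBall_iff_norm] at hx₀ ⊢
  calc ‖picard B u a x₀ ξ t - z‖ = ‖(x₀ - z) + ∫ s in a..t, B (ξ s) (u s)‖ := by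
        rw [picard, add_sub_right_comm]
    _ ≤ r + r := (norm_add_le _ _).trans (add_le_add hx₀
        ((norm_integral_clm_apply_le (fun s hs => hB _ (hξK hs)) hu ht).trans hsmall))
    _ = 2 * r := (two_mul r).symm

theorem norm_picard_sub_picard_le {D : ℝ} (hB : SecondOrderBounded B K L) (hL : 0 ≤ L)
    (hu : IntervalIntegrable u volume a b) (hξ : ContinuousOn ξ (Icc a b))
    (hη : ContinuousOn η (Icc a b)) (hξK : MapsTo ξ (Icc a b) K) (hηK : MapsTo η (Icc a b) K)
    (hD : ∀ s ∈ Icc a b, ‖ξ s - η s‖ ≤ D) (ht : t ∈ Icc a b) :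
    ‖picard B u a x₀ ξ t - picard B u a x₀ η t‖ ≤ L * D * ∫ s in a..b, ‖u s‖ := by
  have hab : a ≤ b := ht.1.trans ht.2
  have hint {ζ : ℝ → E} (hζ : ContinuousOn ζ (Icc a b)) (hζK : MapsTo ζ (Icc a b) K) :
      IntervalIntegrable (fun s => B (ζ s) (u s)) volume a t :=
    intervalIntegrable_of_mem_Icc
      (intervalIntegrable_clm_apply hab (hB.continuousOn.comp hζ hζK) hu) (left_mem_Icc.2 hab) ht
  rw [picard, picard, add_sub_add_left_eq_sub,
    ← intervalIntegral.integral_sub (hint hξ hξK) (hint hη hηK)]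
  refine norm_integral_clm_apply_le (A := fun s => B (ξ s) - B (η s)) (fun s hs => ?_) hu ht
  exact (hB.lipschitz _ (hξK hs) _ (hηK hs)).trans (by gcongr; exact hD s hs)

theorem exists_solvesOn [CompleteSpace E] (hab : a ≤ b) (hL : 0 ≤ L)
    (hB : SecondOrderBounded B (Metric.closedBall z (2 * r)) L)
    (hu : IntervalIntegrable u volume a b) (hhalf : L * ∫ t in a..b, ‖u t‖ ≤ 1 / 2)
    (hsmall : L * ∫ t in a..b, ‖u t‖ ≤ r) (hx₀ : x₀ ∈ Metric.closedBall z r) :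
    ∃ ξ : ℝ → E, ξ a = x₀ ∧ SolvesOn B u a b ξ ∧
      MapsTo ξ (Icc a b) (Metric.closedBall z (2 * r)) := by
  set K := Metric.closedBall z (2 * r)
  have hr : 0 ≤ r := dist_nonneg.trans (Metric.mem_closedBall.1 hx₀)
  have : CompleteSpace K := Metric.isClosed_closedBall.completeSpace_coe
  have : Nonempty C(Icc a b, K) :=
    ⟨.const _ ⟨x₀, Metric.closedBall_subset_closedBall (by linarith) hx₀⟩⟩
  let ext (ξ : C(Icc a b, K)) (t : ℝ) : E := (IccExtend hab (ξ : Icc a b → K) t : K)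
  have hext ξ : ContinuousOn (ext ξ) (Icc a b) :=
    (continuous_subtype_val.comp ξ.continuous.Icc_extend').continuousOn
  have hextK ξ : MapsTo (ext ξ) (Icc a b) K := fun t _ => Subtype.coe_prop _
  let Γ (ξ : C(Icc a b, K)) : C(Icc a b, K) :=
    ⟨fun t => ⟨picard B u a x₀ (ext ξ) t,
      picard_mem_closedBall hB.bound hu hsmall (hextK ξ) hx₀ t.2⟩,
      ((continuousOn_picard hab hB.continuousOn hu (hext ξ) (hextK ξ)).comp_continuous
        continuous_subtype_val fun t => t.2).subtype_mk _⟩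
  have hΓ : ContractingWith (1 / 2) Γ := by
    refine ⟨half_lt_self one_pos, LipschitzWith.of_dist_le_mul fun ξ η => ?_⟩
    refine (ContinuousMap.dist_le (by positivity)).2 fun t => ?_
    have hdist : ∀ s ∈ Icc a b, ‖ext ξ s - ext η s‖ ≤ dist ξ η := fun s _ => by
      rw [← dist_eq_norm]
      exact ContinuousMap.dist_apply_le_dist (f := ξ) (g := η) (projIcc a b hab s)
    rw [Subtype.dist_eq, dist_eq_norm]
    refine (norm_picard_sub_picard_le hB hL hu (hext ξ) (hext η) (hextK ξ) (hextK η) hdist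
      t.2).trans ?_
    push_cast
    nlinarith [dist_nonneg (x := ξ) (y := η)]
  set ξ := ContractingWith.fixedPoint Γ hΓ
  have hfixed : ∀ t ∈ Icc a b, ext ξ t = picard B u a x₀ (ext ξ) t := fun t ht => by
    have hΓξ := congrArg (fun ζ : C(Icc a b, K) => (ζ ⟨t, ht⟩ : E)) hΓ.fixedPoint_isFixedPt
    exact (congrArg Subtype.val (IccExtend_of_mem hab _ ht)).trans hΓξ.symm
  have hinitial : ext ξ a = x₀ := by
    rw [hfixed a (left_mem_Icc.2 hab), picard, intervalIntegral.integral_same, add_zero]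
  exact ⟨ext ξ, hinitial, ⟨hext ξ, fun t ht => by rw [hinitial]; exact hfixed t ht⟩, hextK ξ⟩

end LocalExistence

section IntegralEquationOperations

variable {E F W : Type*} [NormedAddCommGroup E] [NormedSpace ℝ E] [NormedAddCommGroup F]
  [NormedSpace ℝ F] [NormedAddCommGroup W] [NormedSpace ℝ W] {B : E → W →L[ℝ] E} {u : ℝ → W}
  {a b : ℝ} {ξ : ℝ → E}

theorem SolvesOn.mono (h : SolvesOn B u a b ξ)
    (hint : IntervalIntegrable (fun s => B (ξ s) (u s)) volume a b) {a' b' : ℝ} (ha : a ≤ a')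
    (hab : a' ≤ b') (hb : b' ≤ b) : SolvesOn B u a' b' ξ := by
  refine ⟨h.continuousOn.mono (Icc_subset_Icc ha hb), fun t ht => ?_⟩
  have haI : a ∈ Icc a b := left_mem_Icc.2 (ha.trans (hab.trans hb))
  have ha'I : a' ∈ Icc a b := ⟨ha, hab.trans hb⟩
  have htI : t ∈ Icc a b := ⟨ha.trans ht.1, ht.2.trans hb⟩
  rw [h.eq t htI, h.eq a' ha'I, add_assoc, intervalIntegral.integral_add_adjacent_intervals
    (intervalIntegrable_of_mem_Icc hint haI ha'I) (intervalIntegrable_of_mem_Icc hint ha'I htI)]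

theorem SolvesOn.append {c : ℝ} (hab : a ≤ b) (hbc : b ≤ c) (h : SolvesOn B u a b ξ)
    (h' : SolvesOn B u b c ξ) (hint : IntervalIntegrable (fun s => B (ξ s) (u s)) volume a c) :
    SolvesOn B u a c ξ := by
  refine ⟨?_, fun t ht => ?_⟩
  · rw [← Icc_union_Icc_eq_Icc hab hbc]
    exact h.continuousOn.union_of_isClosed h'.continuousOn isClosed_Icc isClosed_Icc
  rcases le_total t b with htb | hbt
  · exact h.eq t ⟨ht.1, htb⟩
  have hbI : b ∈ Icc a c := ⟨hab, hbc⟩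
  rw [h'.eq t ⟨hbt, ht.2⟩, h.eq b (right_mem_Icc.2 hab), add_assoc,
    intervalIntegral.integral_add_adjacent_intervals
      (intervalIntegrable_of_mem_Icc hint (left_mem_Icc.2 (hab.trans hbc)) hbI)
      (intervalIntegrable_of_mem_Icc hint hbI ht)]

theorem SolvesOn.absolutelyContinuousOnInterval (hab : a ≤ b) (h : SolvesOn B u a b ξ)
    (hint : IntervalIntegrable (fun s => B (ξ s) (u s)) volume a b) :
    AbsolutelyContinuousOnInterval ξ a b := by
  refine absolutelyContinuous_of_dist_le (C := 1) (absolutelyContinuous_integral hint)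
    fun s hs t ht => ?_
  rw [uIcc_of_le hab] at hs ht
  rw [h.eq s hs, h.eq t ht, dist_add_left, one_mul]

theorem SolvesOn.ae_hasDerivAt [CompleteSpace E] (h : SolvesOn B u a b ξ)
    (hint : IntervalIntegrable (fun s => B (ξ s) (u s)) volume a b) :
    ∀ᵐ t, t ∈ Ioo a b → HasDerivAt ξ (B (ξ t) (u t)) t := by
  filter_upwards [hint.ae_hasDerivAt_integral] with t hder ht
  have hab : a ≤ b := (ht.1.trans ht.2).le
  refine ((hder (by rw [uIcc_of_le hab]; exact Ioo_subset_Icc_self ht) a left_mem_uIcc).const_add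
    (ξ a)).congr_of_eventuallyEq ?_
  filter_upwards [Ioo_mem_nhds ht.1 ht.2] with s hs
  exact h.eq s (Ioo_subset_Icc_self hs)

theorem SolvesOn.comp [CompleteSpace E] [CompleteSpace F] {B' : F → W →L[ℝ] F} {g : E → F}
    {g' : E → E →L[ℝ] F} {C : NNReal} (hab : a ≤ b) (h : SolvesOn B u a b ξ)
    (hint : IntervalIntegrable (fun s => B (ξ s) (u s)) volume a b)
    (hg : LipschitzOnWith C g (ξ '' Icc a b))
    (hg' : ∀ t ∈ Icc a b, HasFDerivAt g (g' (ξ t)) (ξ t))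
    (hB' : ∀ t ∈ Icc a b, B' (g (ξ t)) (u t) = g' (ξ t) (B (ξ t) (u t)))
    (hint' : IntervalIntegrable (fun s => B' (g (ξ s)) (u s)) volume a b) :
    SolvesOn B' u a b (fun t => g (ξ t)) := by
  refine ⟨hg.continuousOn.comp h.continuousOn (mapsTo_image _ _), fun t ht =>
    eq_add_integral_of_absolutelyContinuous (f := fun t => g (ξ t)) hab
      (absolutelyContinuous_of_dist_le (C := C) (h.absolutelyContinuousOnInterval hab hint)
        fun s hs t ht => ?_) hint' ?_ ht⟩
  · rw [uIcc_of_le hab] at hs ht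
    exact hg.dist_le_mul _ (mem_image_of_mem ξ hs) _ (mem_image_of_mem ξ ht)
  · filter_upwards [h.ae_hasDerivAt hint] with t hder ht
    have htI := Ioo_subset_Icc_self ht
    rw [hB' t htI]
    exact (hg' t htI).comp_hasDerivAt t (hder ht)

end IntegralEquationOperations

section Concatenation

variable {n d : ℕ} {M : Type*} [TopologicalSpace M] [ChartedSpace (EuclideanSpace ℝ (Fin n)) M]
  {p : ℝ≥0∞} {X₀ : (q : M) → TangentSpace (𝓡 n) q} {X : Fin d → (q : M) → TangentSpace (𝓡 n) q}
  {u : Control d p} {γ : ℝ → M} {a b : ℝ}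

theorem SolvesChartwiseOn.congr {γ' : ℝ → M} (h : SolvesChartwiseOn X₀ X u a b γ)
    (heq : EqOn γ' γ (Icc a b)) : SolvesChartwiseOn X₀ X u a b γ' := by
  refine ⟨h.continuousOn.congr heq, fun c a' b' ha hab hb hm => ?_⟩
  have heq' : EqOn γ' γ (Icc a' b') := heq.mono (Icc_subset_Icc ha hb)
  have hs := h.solvesOn c a' b' ha hab hb fun t ht => by rw [← heq' ht]; exact hm ht
  refine ⟨hs.continuousOn.congr fun t ht => by simp only [heq' ht], fun t ht => ?_⟩
  rw [heq' ht, heq' (left_mem_Icc.2 hab), hs.eq t ht]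
  congr 1
  refine intervalIntegral.integral_congr fun s hs => ?_
  rw [uIcc_of_le ht.1] at hs
  simp only [heq' ⟨hs.1, hs.2.trans ht.2⟩]

variable [IsManifold (𝓡 n) ∞ M]

theorem exists_lipschitzOnWith_coordChange {c c' : M} {s : Set (EuclideanSpace ℝ (Fin n))}
    (hs : IsCompact s) (hsub : s ⊆ coordDomain c c') :
    ∃ C, LipschitzOnWith C (coordChange c c') s := by
  refine LocallyLipschitzOn.exists_lipschitzOnWith_of_compact hs fun z hz => ?_
  obtain ⟨C, t, ht, hC⟩ := (((contDiffOn_coordChange c c').contDiffAt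
    ((isOpen_coordDomain c c').mem_nhds (hsub hz))).of_le (by simp)).exists_lipschitzOnWith
  exact ⟨C, t, mem_nhdsWithin_of_mem_nhds ht, hC⟩

variable [Fact (1 ≤ p)]

theorem SolvesChartwiseOn.append (hX₀ : IsSmoothField X₀) (hX : ∀ i, IsSmoothField (X i)) {c : ℝ}
    (ha : 0 ≤ a) (hab : a ≤ b) (hbc : b ≤ c) (hc : c ≤ 1) (h : SolvesChartwiseOn X₀ X u a b γ)
    (h' : SolvesChartwiseOn X₀ X u b c γ) : SolvesChartwiseOn X₀ X u a c γ := by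
  have hcont : ContinuousOn γ (Icc a c) := by
    rw [← Icc_union_Icc_eq_Icc hab hbc]
    exact h.continuousOn.union_of_isClosed h'.continuousOn isClosed_Icc isClosed_Icc
  refine ⟨hcont, fun q a' b' ha' hab' hb' hmaps => ?_⟩
  rcases le_total b' b with hb'b | hbb'
  · exact h.solvesOn q a' b' ha' hab' hb'b hmaps
  rcases le_total b a' with hba' | ha'b
  · exact h'.solvesOn q a' b' hba' hab' hb' hmaps
  exact (h.solvesOn q a' b ha' ha'b le_rfl (hmaps.mono_left (Icc_subset_Icc_right hbb'))).append
    ha'b hbb' (h'.solvesOn q b b' le_rfl hbb' hb' (hmaps.mono_left (Icc_subset_Icc_left ha'b)))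
    (intervalIntegrable_systemField_extChartAt hX₀ hX u (ha.trans ha') hab' (hb'.trans hc)
      (hcont.mono (Icc_subset_Icc ha' hb')) hmaps)

theorem SolvesOn.solvesChartwiseOn (hX₀ : IsSmoothField X₀) (hX : ∀ i, IsSmoothField (X i))
    (ha : 0 ≤ a) (hb : b ≤ 1) {c : M} {ξ : ℝ → EuclideanSpace ℝ (Fin n)}
    (h : SolvesOn (systemField X₀ X c) (extendedControl u) a b ξ)
    (hmaps : MapsTo ξ (Icc a b) (extChartAt (𝓡 n) c).target) :
    SolvesChartwiseOn X₀ X u a b (fun t => (extChartAt (𝓡 n) c).symm (ξ t)) := by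
  have hγ : ContinuousOn (fun t => (extChartAt (𝓡 n) c).symm (ξ t)) (Icc a b) :=
    (continuousOn_extChartAt_symm c).comp h.continuousOn hmaps
  refine ⟨hγ, fun c' a' b' ha' hab' hb' hmaps' => ?_⟩
  have hab : a ≤ b := ha'.trans (hab'.trans hb')
  have hsub : Icc a' b' ⊆ Icc a b := Icc_subset_Icc ha' hb'
  have hdomain : ∀ t ∈ Icc a' b', ξ t ∈ coordDomain c c' := fun t ht =>
    ⟨hmaps (hsub ht), hmaps' ht⟩
  have hint : IntervalIntegrable (fun s => systemField X₀ X c (ξ s) (extendedControl u s))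
      volume a b := h.intervalIntegrable (contDiffOn_systemField hX₀ hX c).continuousOn hmaps
    (intervalIntegrable_extendedControl u ⟨ha, hab.trans hb⟩ ⟨ha.trans hab, hb⟩)
    (right_mem_Icc.2 hab)
  obtain ⟨C, hC⟩ := exists_lipschitzOnWith_coordChange
    (isCompact_Icc.image_of_continuousOn (h.continuousOn.mono hsub)) (image_subset_iff.2 hdomain)
  exact (h.mono hint ha' hab' hb').comp (g := coordChange c c')
    (g' := fderiv ℝ (coordChange c c')) hab'
    (intervalIntegrable_of_mem_Icc hint (hsub (left_mem_Icc.2 hab')) (hsub (right_mem_Icc.2 hab')))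
    hC (fun t ht => hasFDerivAt_coordChange (hdomain t ht))
    (fun t ht => systemField_coordChange X₀ X (hdomain t ht) (u t))
    (intervalIntegrable_systemField_extChartAt hX₀ hX u (ha.trans ha') hab' (hb'.trans hb)
      (hγ.mono hsub) hmaps')

end Concatenation

section Admissibility

variable {n d : ℕ} {M : Type*} [TopologicalSpace M] [ChartedSpace (EuclideanSpace ℝ (Fin n)) M]
  [IsManifold (𝓡 n) ∞ M] {p : ℝ≥0∞} {X₀ : (q : M) → TangentSpace (𝓡 n) q}
  {X : Fin d → (q : M) → TangentSpace (𝓡 n) q} {u : Control d p} {γ : ℝ → M}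

theorem exists_leftInverse_chartDifferential {c q : M}
    (hq : q ∈ (chartAt (EuclideanSpace ℝ (Fin n)) c).source) :
    ∃ D : EuclideanSpace ℝ (Fin n) →L[ℝ] EuclideanSpace ℝ (Fin n),
      HasMFDerivAt 𝓘(ℝ, EuclideanSpace ℝ (Fin n)) (𝓡 n) (extChartAt (𝓡 n) c).symm
        (extChartAt (𝓡 n) c q) D ∧ ∀ w, D (chartDifferential c q w) = w := by
  rw [← extChartAt_source (𝓡 n)] at hq
  have hderiv := (((contMDiffOn_extChartAt_symm (I := 𝓡 n) (n := ∞) c).contMDiffAt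
    (extChartAt_target_mem_nhds' ((extChartAt (𝓡 n) c).map_source hq))).mdifferentiableAt
      (by simp)).hasMFDerivAt
  have hinverse := mfderivWithin_extChartAt_symm_comp_mfderiv_extChartAt' (I := 𝓡 n) hq
  rw [ModelWithCorners.range_eq_univ, mfderivWithin_univ] at hinverse
  exact ⟨_, hderiv, fun w => DFunLike.congr_fun hinverse w⟩

theorem hasMFDerivAt_of_hasDerivAt_extChartAt {c : M} {t : ℝ} {v : EuclideanSpace ℝ (Fin d)}
    (hγ : ∀ᶠ s in 𝓝 t, γ s ∈ (chartAt (EuclideanSpace ℝ (Fin n)) c).source)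
    (h : HasDerivAt (fun s => extChartAt (𝓡 n) c (γ s))
      (systemField X₀ X c (extChartAt (𝓡 n) c (γ t)) ((1 : ℝ), v)) t) :
    HasMFDerivAt 𝓘(ℝ, ℝ) (𝓡 n) γ t
      (ContinuousLinearMap.toSpanSingleton ℝ (X₀ (γ t) + ∑ i : Fin d, v i • X i (γ t))) := by
  obtain ⟨D, hD, hinverse⟩ := exists_leftInverse_chartDifferential hγ.self_of_nhds
  rw [systemField_extChartAt X₀ X hγ.self_of_nhds] at h
  have hcomp := hD.comp t (hasMFDerivAt_iff_hasFDerivAt.2 h.hasFDerivAt)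
  have hγeq : γ =ᶠ[𝓝 t] fun s => (extChartAt (𝓡 n) c).symm (extChartAt (𝓡 n) c (γ s)) := by
    filter_upwards [hγ] with s hs
    exact ((extChartAt (𝓡 n) c).left_inv (by rwa [extChartAt_source])).symm
  have hvelocity : D.comp (ContinuousLinearMap.toSpanSingleton ℝ
      (chartDifferential c (γ t) (systemVelocity X₀ X (γ t) v))) =
      ContinuousLinearMap.toSpanSingleton ℝ (systemVelocity X₀ X (γ t) v) := by
    rw [ContinuousLinearMap.comp_toSpanSingleton, hinverse]
  exact (hcomp.congr_of_eventuallyEq hγeq).congr_mfderiv hvelocity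

variable [Fact (1 ≤ p)]

theorem SolvesChartwiseOn.ae_hasMFDerivAt (hX₀ : IsSmoothField X₀) (hX : ∀ i, IsSmoothField (X i))
    (h : SolvesChartwiseOn X₀ X u 0 1 γ) : ∀ᵐ t, t ∈ Ioo (0 : ℝ) 1 →
      HasMFDerivAt 𝓘(ℝ, ℝ) (𝓡 n) γ t
        (ContinuousLinearMap.toSpanSingleton ℝ (X₀ (γ t) + ∑ i : Fin d, u t i • X i (γ t))) := by
  refine measure_null_of_locally_null _ fun t₀ hbad => ?_
  have ht₀ : t₀ ∈ Ioo (0 : ℝ) 1 := by_contra fun hout => hbad fun hin => absurd hin hout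
  have hnear : ∀ᶠ t in 𝓝 t₀, t ∈ Icc (0 : ℝ) 1 ∧
      γ t ∈ (chartAt (EuclideanSpace ℝ (Fin n)) (γ t₀)).source :=
    Filter.Eventually.and (Icc_mem_nhds ht₀.1 ht₀.2)
      ((h.continuousOn.continuousAt (Icc_mem_nhds ht₀.1 ht₀.2)).eventually
        (chart_source_mem_nhds (EuclideanSpace ℝ (Fin n)) (γ t₀)))
  obtain ⟨a, b, htab, hnhds, hsub⟩ := exists_Icc_mem_subset_of_mem_nhds hnear
  have hab : a ≤ b := htab.1.trans htab.2
  have hmaps : MapsTo γ (Icc a b) (chartAt (EuclideanSpace ℝ (Fin n)) (γ t₀)).source :=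
    fun t ht => (hsub ht).2
  have ha : 0 ≤ a := (hsub (left_mem_Icc.2 hab)).1.1
  have hb : b ≤ 1 := (hsub (right_mem_Icc.2 hab)).1.2
  have hder := (h.solvesOn (γ t₀) a b ha hab hb hmaps).ae_hasDerivAt
    (intervalIntegrable_systemField_extChartAt hX₀ hX u ha hab hb
      (h.continuousOn.mono (Icc_subset_Icc ha hb)) hmaps)
  have hderOn : ∀ᵐ t, t ∈ Ioo a b → HasMFDerivAt 𝓘(ℝ, ℝ) (𝓡 n) γ t
      (ContinuousLinearMap.toSpanSingleton ℝ (X₀ (γ t) + ∑ i : Fin d, u t i • X i (γ t))) := by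
    filter_upwards [hder] with t hder ht
    refine hasMFDerivAt_of_hasDerivAt_extChartAt ?_ (hder ht)
    filter_upwards [Ioo_mem_nhds ht.1 ht.2] with s hs
    exact hmaps (Ioo_subset_Icc_self hs)
  refine ⟨_, inter_mem self_mem_nhdsWithin (mem_nhdsWithin_of_mem_nhds
    (interior_mem_nhds.2 hnhds)), measure_mono_null ?_ (ae_iff.1 hderOn)⟩
  rw [interior_Icc]
  exact fun t ht hgood => ht.1 fun _ => hgood ht.2

theorem SolvesChartwiseOn.isTrajectory (hX₀ : IsSmoothField X₀) (hX : ∀ i, IsSmoothField (X i))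
    {x : M} (h : SolvesChartwiseOn X₀ X u 0 1 γ) (hinitial : γ 0 = x) :
    IsTrajectory X₀ X x u γ := by
  refine ⟨⟨h.continuousOn, fun c a b hab hsub hmaps => ?_⟩, hinitial, ?_⟩
  · have ha : 0 ≤ a := (hsub (left_mem_Icc.2 hab)).1
    have hb : b ≤ 1 := (hsub (right_mem_Icc.2 hab)).2
    exact (h.solvesOn c a b ha hab hb hmaps).absolutelyContinuousOnInterval hab
      (intervalIntegrable_systemField_extChartAt hX₀ hX u ha hab hb (h.continuousOn.mono hsub)
        hmaps)
  · have hne (c : ℝ) : ∀ᵐ t : ℝ, t ≠ c := by simp [ae_iff]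
    refine (ae_restrict_iff' measurableSet_Icc).2 ?_
    filter_upwards [h.ae_hasMFDerivAt hX₀ hX, hne 0, hne 1] with t hder ht0 ht1 ht
    exact hder ⟨ht.1.lt_of_ne' ht0, ht.2.lt_of_ne ht1⟩

theorem exists_uniform_existence_time [CompactSpace M] (hp : 1 < p) (hp_top : p ≠ ⊤)
    (hX₀ : IsSmoothField X₀) (hX : ∀ i, IsSmoothField (X i)) (u : Control d p) :
    ∃ ε > 0, ∀ m : M, ∀ a b, 0 ≤ a → a ≤ b → b ≤ 1 → b - a < ε →
      ∃ γ : ℝ → M, γ a = m ∧ SolvesChartwiseOn X₀ X u a b γ := by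
  have hlocal : ∀ᶠ δ : ℝ in 𝓝 0, ∀ m ∈ (univ : Set M), ∀ a b, 0 ≤ a → a ≤ b → b ≤ 1 → b - a < δ →
      ∃ γ : ℝ → M, γ a = m ∧ SolvesChartwiseOn X₀ X u a b γ := by
    refine isCompact_univ.eventually_forall_of_forall_eventually fun c _ => ?_
    obtain ⟨r, hr, L, hL, ε, hε, hball⟩ :=
      exists_isUniformBall (X₀ := X₀) (X := X) hp hp_top hX₀ hX ‖u‖ c
    have hnhds : chartPreimage c (Metric.ball (extChartAt (𝓡 n) c c) r) ∈ 𝓝 c :=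
      (isOpen_chartPreimage c Metric.isOpen_ball).mem_nhds
        ⟨mem_chart_source _ c, Metric.mem_ball_self hr⟩
    filter_upwards [prod_mem_nhds (Iio_mem_nhds hε) hnhds] with ⟨δ, m⟩ ⟨hδ, hm⟩ a b ha hab hb hba
    have hbaε : b - a < ε := hba.trans hδ
    obtain ⟨ξ, hξa, hξ, hξK⟩ := exists_solvesOn hab hL hball.secondOrderBounded
      (intervalIntegrable_extendedControl u ⟨ha, hab.trans hb⟩ ⟨ha.trans hab, hb⟩)
      (hball.integral_le u le_rfl a b ha hab hb hbaε)
      (hball.integral_lt u le_rfl a b ha hab hb hbaε).le (Metric.ball_subset_closedBall hm.2)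
    refine ⟨fun t => (extChartAt (𝓡 n) c).symm (ξ t), ?_,
      hξ.solvesChartwiseOn hX₀ hX ha hb fun t ht => hball.subset_target (hξK ht)⟩
    simp only [hξa]
    exact (extChartAt (𝓡 n) c).left_inv (by rw [extChartAt_source]; exact hm.1)
  obtain ⟨ε, h, hε⟩ := ((hlocal.filter_mono nhdsWithin_le_nhds).and
    (self_mem_nhdsWithin (s := Ioi (0 : ℝ)))).exists
  exact ⟨ε, hε, fun m => h m (mem_univ m)⟩

theorem mem_admissible_of_compactSpace [CompactSpace M] (hp : 1 < p) (hp_top : p ≠ ⊤)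
    (hX₀ : IsSmoothField X₀) (hX : ∀ i, IsSmoothField (X i)) (x : M) (u : Control d p) :
    u ∈ admissible p X₀ X x := by
  obtain ⟨ε, hε, hexists⟩ := exists_uniform_existence_time (X₀ := X₀) (X := X) hp hp_top hX₀ hX u
  have hglobal : ∀ T ∈ Icc (0 : ℝ) 1,
      ∃ γ : ℝ → M, γ 0 = x ∧ SolvesChartwiseOn X₀ X u 0 T γ := by
    refine forall_mem_Icc_of_local_step (hexists x 0 0 le_rfl le_rfl zero_le_one (by simpa))
      fun t₀ _ => ⟨ε / 2, half_pos hε, fun a ha b hb hat hbt hab => ?_⟩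
    rintro ⟨γ, hγx, hγ⟩
    have hba : b - a < ε := by linarith [(abs_lt.1 hat).1, (abs_lt.1 hbt).2]
    obtain ⟨γ', hγ'a, hγ'⟩ := hexists (γ a) a b ha.1 hab hb.2 hba
    refine ⟨fun t => if t ≤ a then γ t else γ' t, by simp only [if_pos ha.1, hγx], ?_⟩
    refine SolvesChartwiseOn.append hX₀ hX le_rfl ha.1 hab hb.2
      (hγ.congr fun t ht => if_pos ht.2) (hγ'.congr fun t ht => ?_)
    rcases ht.1.eq_or_lt with rfl | hlt
    · simp only [le_refl, if_true, hγ'a]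
    · exact if_neg hlt.not_ge
  obtain ⟨γ, hγx, hγ⟩ := hglobal 1 (right_mem_Icc.2 zero_le_one)
  exact ⟨γ, hγ.isTrajectory hX₀ hX hγx⟩

end Admissibility

end ControlSystem

theorem mainTheorem8_general {n d : ℕ} {M : Type*} [TopologicalSpace M] [T2Space M]
    [ChartedSpace (EuclideanSpace ℝ (Fin n)) M] [IsManifold (𝓡 n) ∞ M]
    (X₀ : (q : M) → TangentSpace (𝓡 n) q) (X : Fin d → (q : M) → TangentSpace (𝓡 n) q)
    (hX₀ : ControlSystem.IsSmoothField X₀) (hX : ∀ i, ControlSystem.IsSmoothField (X i))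
    (p : ℝ≥0∞) [Fact (1 ≤ p)] (hp : 1 < p) (hp_top : p ≠ ⊤) (x y : M)
    (hall : ∀ u : ControlSystem.Control d p, u ∈ ControlSystem.admissible p X₀ X x)
    (hy : ControlSystem.IsRegularValue p X₀ X x y) (u : ℕ → ControlSystem.Control d p)
    (hu : ∀ k, u k ∈ ControlSystem.fiber p X₀ X x y)
    (hbound : ∃ C : ℝ, ∀ k, ControlSystem.energy (u k) ≤ C)
    (hdiff : Tendsto (fun k => ‖ControlSystem.restrictedEnergyDifferential X₀ X x (u k)‖)
      atTop (𝓝 0)) :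
    ∃ v ∈ ControlSystem.fiber p X₀ X x y, ∃ φ : ℕ → ℕ, StrictMono φ ∧
      Tendsto (fun k => u (φ k)) atTop (𝓝 v) := by
  obtain ⟨C, hC⟩ := hbound
  obtain ⟨R, hR⟩ := ControlSystem.exists_norm_le_of_energy_le (d := d) hp hp_top C
  have hnorm : ∀ k, ‖u k‖ ≤ R := fun k => hR _ (hC k)
  obtain ⟨w, φ, hφ, hweak⟩ := ControlSystem.exists_subseq_primitiveTendsto hp hp_top hnorm
  have hdescent := ControlSystem.tendsto_fderiv_energy_sub hp hp_top hX₀ hX hall hy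
    (fun k => hnorm (φ k)) (fun k => (hu (φ k)).2) hweak (hdiff.comp hφ.tendsto_atTop)
  have hcauchy : CauchySeq fun k => u (φ k) :=
    ControlSystem.cauchySeq_of_tendsto_fderiv_energy_sub hp hp_top (fun k => hnorm (φ k)) hdescent
  obtain ⟨v, hv⟩ := cauchySeq_tendsto_of_complete hcauchy
  have hclosed := ControlSystem.isClosed_fiber hp hp_top hX₀ hX hall y
  exact ⟨v, hclosed.mem_of_tendsto hv (.of_forall fun k => hu (φ k)), φ, hφ, hv⟩

theorem mainTheorem8 {n d : ℕ} {M : Type*} [TopologicalSpace M] [T2Space M]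
    [SecondCountableTopology M] [ChartedSpace (EuclideanSpace ℝ (Fin n)) M]
    [IsManifold (𝓡 n) ∞ M]
    (X₀ : (q : M) → TangentSpace (𝓡 n) q) (X : Fin d → (q : M) → TangentSpace (𝓡 n) q)
    (hX₀ : ControlSystem.IsSmoothField X₀) (hX : ∀ i, ControlSystem.IsSmoothField (X i))
    (p : ℝ≥0∞) [Fact (1 ≤ p)] (hp : 1 < p) (hp_top : p ≠ ⊤)
    (x y : M)
    (hcomplete : CompactSpace M ∨
      ∀ u : ControlSystem.Control d p, u ∈ ControlSystem.admissible p X₀ X x)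
    (hy : ControlSystem.IsRegularValue p X₀ X x y)
    (u : ℕ → ControlSystem.Control d p)
    (hu : ∀ k, u k ∈ ControlSystem.fiber p X₀ X x y)
    (hbound : ∃ C : ℝ, ∀ k, |ControlSystem.energy (u k)| ≤ C)
    (hdiff : Tendsto (fun k => ‖ControlSystem.restrictedEnergyDifferential X₀ X x (u k)‖)
      atTop (𝓝 0)) :
    ∃ v ∈ ControlSystem.fiber p X₀ X x y, ∃ φ : ℕ → ℕ, StrictMono φ ∧
      Tendsto (fun k => u (φ k)) atTop (𝓝 v) :=
  mainTheorem8_general X₀ X hX₀ hX p hp hp_top x y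
    (hcomplete.elim (fun _ => ControlSystem.mem_admissible_of_compactSpace hp hp_top hX₀ hX x) id)
    hy u hu (hbound.imp fun _ hC k => (le_abs_self _).trans (hC k)) hdiff
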